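/- **Setting.** Let $D,T\ge 1$, $\mathcal X=\mathbb R^D$, and let $\mathcal C$ be a standard Borel space. Let $\mathsf P_{\mathcal C}$ be a probability measure on $\mathcal C$ and $\pi^\star(\cdot\mid c)$ a Markov kernel from $\mathcal C$ to $\mathcal X$ with Lebesgue density $\pi^\star(x\mid c)$ for a.e. $c$. For $0\le s<T$ let $q_s$ be Markov kernels on $\mathcal X$ with strictly positive densities $q_s(u\mid v)$, and let $\nu$ be a probability law with a density. Let $q^{\pi^\star}(dx_{0:T}\mid c)=\pi^\star(dx_0\mid c)\prod_{s<T}q_s(dx_{s+1}\mid x_s)$, with marginals $q_s^{\pi^\star}(\cdot\mid c)$; their densities are $q_0^{\pi^\star}=\pi^\star$ and $q^{\pi^\star}_{s+1}(u\mid c)=\int q_s(u\mid v)\,q_s^{\pi^\star}(dv\mid c)$. For $1\le t\le T$ let $\mathsf Q_t$ be the law of $(C,X_{t-1},X_t)$ with $C\sim \mathsf P_{\mathcal C}$, $X_{0:T}\sim q^{\pi^\star}(\cdot\mid C)$, and let $r_t^\star(\cdot\mid c,x_t)$ be the conditional law of $X_{t-1}$ given $(C,X_t)$. Reverse kernels $p_t(dx_{t-1}\mid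 c,x_t)$, $t=1,\dots,T$, induce the predictor $\pi_{p,\nu}(\cdot\mid c)$, the law of $x_0$ under $\nu(dx_T)\prod_{t}p_t(dx_{t-1}\mid c,x_t)$. Put $$\mathcal E_{\mathrm{KL}}(\pi)=\mathbb E_{C\sim \mathsf P_{\mathcal C}}\,\mathrm{KL}(\pi^\star(\cdot\mid C)\,\|\,\pi(\cdot\mid C)),\qquad \mathbb E[\mathrm{Comp}]=\mathbb E_{C\sim \mathsf P_{\mathcal C}}\,\mathrm{KL}(q_T^{\pi^\star}(\cdot\mid C)\,\|\,\nu).$$ Cubes are axis-parallel, $C_r(y)$ is the closed cube of side $r$ centred at $y$, and side lengths $r_0,\dots,r_{T-1}>0$ are fixed. **Feature assumption.** For each $t$ there are a measurable $\phi_t:\mathcal C\times\mathcal X\to\mathbb R^{d_t}$, a compact $K_t\subset\mathbb R^{d_t}$ and a measurable $\rho_t^\star(y\mid z)\ge 0$ such that, with $F_t$ the law of $(X_{t-1},Z_t)$, $Z_t=\phi_t(C,X_t)$, and $F_{Z_t}$ the law of $Z_t$: $F_{Z_t}(K_t)=1$; $F_t(dy,dz)=\rho_t^\star(y\mid z)\,dy\,F_{Z_t}(dz)$;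 and $r_t^\star(\cdot\mid c,x_t)$ has density $\rho_t^\star(\cdot\mid\phi_t(c,x_t))$ for a.e. $(c,x_t)$. **Regularity assumption.** For $0\le s<T$: $\pi^\star(\cdot\mid c)$ is strictly positive and continuous for a.e. $c$; $u\mapsto q_s(u\mid v)$ is continuous for every $v$; for a.e. $c$ and every compact $K$ there is $g\in L^1(q_s^{\pi^\star}(\cdot\mid c))$ with $\sup_{u\in K}q_s(u\mid v)\le g(v)$ for all $v$; $\int\!\!\int\|y\|^2q_s^{\pi^\star}(dy\mid c)\,\mathsf P_{\mathcal C}(dc)<\infty$; and there are cubes $C_s(x)\ni x$ of side $r_s$ and measurable $a_{s-1},b_s\ge0$ with, for a.e. $c$ and a.e. $x$, $\log\frac{q_s^{\pi^\star}(x\mid c)}{\inf_{y\in C_s(x)}q_s^{\pi^\star}(y\mid c)}\le a_{s-1}(x)$, for a.e. $(x,x')$, $\log\frac{q_s(x'\mid x)}{\inf_{y\in C_s(x)}q_s(x'\mid y)}\le b_s(x,x')$, and $\mathbb E_{\mathsf Q_{s+1}}[a_{s-1}(X_s)+b_s(X_s,X_{s+1})]<\infty$. **Partition data at step $t$.** For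 every $m$: $m$ pairwise disjoint half-open cubes $A_{t,1}^m,\dots,A_{t,m}^m$ of side $h_{t,m}$ with centres $\mu_{t,j}^m$, adjacent (any two are joined by a chain of these cubes in which consecutive cubes share a face), the remainder $A_{t,0}^m=\mathbb R^D\setminus\bigcup_{j\ge1}A_{t,j}^m$, and positive numbers $\delta_{t,m},\sigma_{t,m},\sigma_{t,0}$ such that $h_{t,m},\delta_{t,m}\to0$; for every $y$, $C_{\delta_{t,m}}(y)\cap A_{t,0}^m=\emptyset$ for all large $m$; $\sigma_{t,m}/\delta_{t,m}\to0$; $\delta_{t,m}^{D-1}h_{t,m}/\sigma_{t,m}^D\to0$; and $(r_{t-1}/2)^D(2\pi\sigma_{t,0}^2)^{-D/2}\le 2^{-(D+1)}$. For logits $u=(u_1,\dots,u_m)$ let $$\tilde p_t[u](y)=\sum_{j=1}^m\frac{e^{u_j}}{1+\sum_k e^{u_k}}\,\varphi(y;\mu_{t,j}^m,\sigma_{t,m}^2I)+\frac{1}{1+\sum_k e^{u_k}}\,\varphi(y;0,\sigma_{t,0}^2I),$$ $\varphi$ being the Gaussian density. The exact log-odds are $\Lambda_{t,j}^m(z)=\log(G_j(z)/G_0(z))$,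 $G_j(z)=\int_{A_{t,j}^m}\rho_t^\star(y\mid z)\,dy$, and $\tilde p_t^{\mathcal M_0,m}(\cdot\mid z)=\tilde p_t[\Lambda_t^m(z)]$. A *neural reverse model* consists, for each $t$, of an integer $m_t\ge1$ and a ReLU network $a_t:\mathbb R^{d_t}\to\mathbb R^{m_t}$; its reverse kernel at step $t$ has density $\tilde p_t[a_t(\phi_t(c,x_t))]$. Write $d_{\mathrm{KL},t}(\tilde p)=\mathbb E_{Z_t}\mathrm{KL}(\rho_t^\star(\cdot\mid Z_t)\,\|\,\tilde p(\cdot\mid Z_t))$. **Smooth log-odds assumption** (for given partition data). For each $t$ there are a closed cube $Q_t\supset K_t$ and an integer $s_t\ge 0$ such that all $\Lambda_{t,j}^m$ ($1\le j\le m$) extend from $K_t$ to $C^{s_t}$ functions on a neighbourhood of $Q_t$. **Proposition.** (i) Fix partition data at every step. Under the feature, regularity and smooth log-odds assumptions, for every $\varepsilon>0$ there is a neural reverse model $p$ with $\mathcal E_{\mathrm{KL}}(\pi_{p,\nu})\le\mathbb E[\mathrm{Comp}]+\varepsilon$; in particular $\inf_p\mathcal E_{\mathrm{KL}}(\pi_{p,\nu})\le\mathbb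 E[\mathrm{Comp}]$, the infimum being over all neural reverse models. (ii) Let $\theta_t>2$, $\xi_t>0$ and $\beta_t=D^{-1}/\bigl(2+\tfrac1{\theta_t-2}+\xi_t\bigr)$ for $t=1,\dots,T$. There is a choice of partition data, depending only on $D$, $T$ and the numbers $r_{t-1},\theta_t,\xi_t$, with the following property. Suppose that the feature, regularity and smooth log-odds assumptions hold with these partition data and with $s_t\ge1$, and that for every $t$: $\rho_t^\star(\cdot\mid z)\in C^1$ for a.e. $z$; $\int|y_i|^{\theta_t}\,dF_t<\infty$ for $i=1,\dots,D$; and, with $S_t(y,z)=\sup_{u\in C_{r_{t-1}}(y)}\|\nabla_u\log\rho_t^\star(u\mid z)\|$, $\int S_t\,dF_t<\infty$ and $\int|y_{i_t}|^{\theta_t-2}S_t\,dF_t<\infty$ for some coordinate $i_t$. Then there are constants $C_t\in[0,\infty)$ with $d_{\mathrm{KL},t}(\tilde p_t^{\mathcal M_0,m})\le C_t\,m^{-\beta_t}$ for all large $m$ and every $t$, an integer $n_0\ge1$, and neural reverse models $p^n$, where $p^n$ uses $m_t=n$ cells at every step for $n\ge n_0$, such that for every $n\ge n_0$ $$\mathcal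 E_{\mathrm{KL}}(\pi_{p^n,\nu})\le\mathbb E[\mathrm{Comp}]+\sum_{t=1}^TC_t\,n^{-\beta_t}+\frac1{2n},$$ and in particular $\limsup_{n\to\infty}\mathcal E_{\mathrm{KL}}(\pi_{p^n,\nu})\le\mathbb E[\mathrm{Comp}]$. -/

import Mathlib

open MeasureTheory ProbabilityTheory InformationTheory Filter Topology
open scoped ENNReal

noncomputable section

namespace RevDiff

/-- The state space `ℝ^D` with its Euclidean norm and Lebesgue measure. -/
abbrev E (D : ℕ) : Type := EuclideanSpace ℝ (Fin D)

/-- Axis-parallel closed cube with centre `w` and side length `r`. -/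
def cube {D : ℕ} (w : E D) (r : ℝ) : Set (E D) := {y | ∀ i, |y i - w i| ≤ r / 2}

/-- Axis-parallel half-open cube with centre `w` and side length `h`. -/
def cell {D : ℕ} (w : E D) (h : ℝ) : Set (E D) :=
  {y | ∀ i, w i - h / 2 ≤ y i ∧ y i < w i + h / 2}

/-! ### Conditional prediction problem, forward and backward paths -/

/-- The data of the diffusion prediction problem: the law `PC` of the condition `C`, the true
conditional `piStar`, the forward kernels `q_0, …, q_{T-1}` and the reference law `ν`, all with
their Lebesgue densities. `qDens s v u` is the transition density `q_s(u ∣ v)`. The joint law of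
`(C, X_0)` is `PC ⊗ₘ piStar`. -/
structure Diffusion (C : Type*) [MeasurableSpace C] (D T : ℕ) where
  PC : Measure C
  isProb : IsProbabilityMeasure PC
  piStar : Kernel C (E D)
  isMarkov : IsMarkovKernel piStar
  piDens : C → E D → ℝ
  piDens_meas : Measurable (Function.uncurry piDens)
  piStar_eq : ∀ᵐ c ∂PC, piStar c = volume.withDensity fun x => ENNReal.ofReal (piDens c x)
  q : Fin T → Kernel (E D) (E D)
  q_isMarkov : ∀ s, IsMarkovKernel (q s)
  qDens : Fin T → E D → E D → ℝ
  qDens_meas : ∀ s, Measurable (Function.uncurry (qDens s))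
  qDens_pos : ∀ s v u, 0 < qDens s v u
  q_eq : ∀ s v, q s v = volume.withDensity fun u => ENNReal.ofReal (qDens s v u)
  ν : Measure (E D)
  ν_isProb : IsProbabilityMeasure ν
  νDens : E D → ℝ
  νDens_meas : Measurable νDens
  ν_eq : ν = volume.withDensity fun x => ENNReal.ofReal (νDens x)

attribute [instance] Diffusion.isProb Diffusion.isMarkov Diffusion.q_isMarkov Diffusion.ν_isProb

section Paths

variable {C : Type*} [MeasurableSpace C] {D : ℕ}

theorem measurable_snoc {T : ℕ} : Measurable
    (fun p : (Fin (T + 1) → E D) × E D => (Fin.snoc p.1 p.2 : Fin (T + 1 + 1) → E D)) := by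
  refine measurable_pi_iff.2 fun i => ?_
  refine Fin.lastCases ?_ (fun j => ?_) i
  · simpa using measurable_snd
  · simp only [Fin.snoc_castSucc]; fun_prop

theorem measurable_cons {T : ℕ} : Measurable
    (fun p : (Fin (T + 1) → E D) × E D => (Fin.cons p.2 p.1 : Fin (T + 1 + 1) → E D)) := by
  refine measurable_pi_iff.2 fun i => ?_
  refine Fin.cases ?_ (fun j => ?_) i
  · simpa using measurable_snd
  · simp only [Fin.cons_succ]; fun_prop

/-- Forward path kernel `π₀(dx_0 ∣ c) ∏_{t<T} q_t(dx_{t+1} ∣ x_t)` on `x_{0:T}`. -/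
def forwardPath (π₀ : Kernel C (E D)) :
    {T : ℕ} → (Fin T → Kernel (E D) (E D)) → Kernel C (Fin (T + 1) → E D)
  | 0, _ => π₀.map fun x _ => x
  | T + 1, q =>
    (forwardPath π₀ (fun t : Fin T => q t.castSucc) ⊗ₖ
      (q (Fin.last T)).comap (fun cw : C × (Fin (T + 1) → E D) => cw.2 (Fin.last T))
        (by fun_prop)).map
      fun p => (Fin.snoc p.1 p.2 : Fin (T + 1 + 1) → E D)

/-- Backward path kernel `ν(dx_T) ∏_{t=1}^T p_t(dx_{t-1} ∣ c, x_t)` on `x_{0:T}`. Here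
`p t : C × ℝ^D → ℝ^D` with `t : Fin T` is the reverse kernel producing `x_t` from
`(c, x_{t+1})`. -/
def backwardPath (ν : Measure (E D)) :
    {T : ℕ} → (Fin T → Kernel (C × E D) (E D)) → Kernel C (Fin (T + 1) → E D)
  | 0, _ => Kernel.const C (ν.map fun x _ => x)
  | T + 1, p =>
    (backwardPath ν (fun t : Fin T => p t.succ) ⊗ₖ
      (p 0).comap (fun cw : C × (Fin (T + 1) → E D) => (cw.1, cw.2 0)) (by fun_prop)).map
      fun p => (Fin.cons p.2 p.1 : Fin (T + 1 + 1) → E D)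

instance isMarkovKernel_forwardPath (π₀ : Kernel C (E D)) [IsMarkovKernel π₀] :
    {T : ℕ} → (q : Fin T → Kernel (E D) (E D)) → [∀ t, IsMarkovKernel (q t)] →
      IsMarkovKernel (forwardPath π₀ q)
  | 0, _, _ => by
    unfold forwardPath
    exact Kernel.IsMarkovKernel.map _ (by fun_prop)
  | T + 1, q, _ => by
    unfold forwardPath
    have := isMarkovKernel_forwardPath π₀ (fun t : Fin T => q t.castSucc)
    exact Kernel.IsMarkovKernel.map _ measurable_snoc

theorem isMarkovKernel_backwardPath (ν : Measure (E D)) [IsProbabilityMeasure ν] :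
    {T : ℕ} → (p : Fin T → Kernel (C × E D) (E D)) → (∀ t, IsMarkovKernel (p t)) →
      IsMarkovKernel (backwardPath ν p)
  | 0, _, _ => by
    unfold backwardPath
    have : IsProbabilityMeasure (ν.map fun x => (fun _ => x : Fin 1 → E D)) :=
      Measure.isProbabilityMeasure_map (by fun_prop)
    infer_instance
  | T + 1, p, hp => by
    unfold backwardPath
    have := isMarkovKernel_backwardPath ν (fun t : Fin T => p t.succ) fun t => hp _
    have := hp 0
    exact Kernel.IsMarkovKernel.map _ measurable_cons

end Paths

namespace Diffusion

variable {C : Type*} [MeasurableSpace C] {D T : ℕ} (S : Diffusion C D T)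

/-- The forward path kernel of the problem. -/
def path : Kernel C (Fin (T + 1) → E D) := forwardPath S.piStar S.q

instance : IsMarkovKernel S.path := isMarkovKernel_forwardPath _ _

/-- The law of `X_t` given `c` under the forward path kernel. -/
def marg (t : Fin (T + 1)) : Kernel C (E D) := S.path.map fun x => x t

/-- The density of `X_t` given `c`: `π⋆(u ∣ c)` for `t = 0`, and `∫ q_s(u ∣ v) q_s^{π⋆}(dv ∣ c)`
for `t = s + 1`. -/
def margDens (t : Fin (T + 1)) (c : C) (u : E D) : ℝ≥0∞ :=
  Fin.cases (motive := fun _ => ℝ≥0∞) (ENNReal.ofReal (S.piDens c u))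
    (fun s : Fin T => ∫⁻ v, ENNReal.ofReal (S.qDens s v u) ∂(S.marg s.castSucc c)) t

/-- The joint law of `(C, X_{0:T})`. -/
def joint : Measure (C × (Fin (T + 1) → E D)) := S.PC ⊗ₘ S.path

instance : IsProbabilityMeasure S.joint := by unfold joint; infer_instance

/-- The law of `(C, X_t, X_{t+1})`, `t : Fin T`. -/
def stepLaw (t : Fin T) : Measure (C × E D × E D) :=
  S.joint.map fun p => (p.1, p.2 t.castSucc, p.2 t.succ)

instance (t : Fin T) : IsFiniteMeasure (S.stepLaw t) := by unfold stepLaw; infer_instance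

/-- The law of `(C, X_{t+1})`, `t : Fin T`. -/
def condLaw (t : Fin T) : Measure (C × E D) := (S.stepLaw t).map fun p => (p.1, p.2.2)

/-- The true reverse kernel: the conditional law of `X_t` given `(C, X_{t+1})`, obtained by
disintegration of `stepLaw t` over `condLaw t`. -/
def reverseKernel (t : Fin T) : Kernel (C × E D) (E D) :=
  ((S.stepLaw t).map fun p => ((p.1, p.2.2), p.2.1)).condKernel

/-- The predictor induced by a reverse model: the law of `x_0` under the backward path kernel. -/
def predictor (p : Fin T → Kernel (C × E D) (E D)) : Kernel C (E D) :=
  (backwardPath S.ν p).map fun x => x 0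

/-- `E_{C ∼ P_C} KL(π⋆(· ∣ C) ‖ π(· ∣ C))`. -/
def outputKL (π : Kernel C (E D)) : ℝ≥0∞ := ∫⁻ c, klDiv (S.piStar c) (π c) ∂S.PC

/-- The averaged terminal mismatch `E_{C ∼ P_C} KL(q_T^{π⋆}(· ∣ C) ‖ ν)`. -/
def meanComp : ℝ≥0∞ := ∫⁻ c, klDiv (S.marg (Fin.last T) c) S.ν ∂S.PC

/-- Regularity of the forward densities; `r s` is the side length of the cubes at step `s`. -/
structure Regular (r : Fin T → ℝ) : Prop where
  pos : ∀ᵐ c ∂S.PC, ∀ x, 0 < S.piDens c x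
  cont_pi : ∀ᵐ c ∂S.PC, Continuous (S.piDens c)
  cont_q : ∀ s v, Continuous (S.qDens s v)
  dominated : ∀ s : Fin T, ∀ᵐ c ∂S.PC, ∀ K : Set (E D), IsCompact K →
    ∃ g : E D → ℝ, Integrable g (S.marg s.castSucc c) ∧ ∀ v, ∀ u ∈ K, S.qDens s v u ≤ g v
  moment : ∀ s : Fin T,
    ∫⁻ c, ∫⁻ y, ENNReal.ofReal (‖y‖ ^ 2) ∂(S.marg s.castSucc c) ∂S.PC < ∞
  -- `w x` is the centre of the cube attached to `x`; the quotients and logarithms are taken in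
  -- the extended reals, so that an infimum equal to `0` makes the left-hand side `+∞`
  logVar : ∀ s : Fin T, ∃ (w : E D → E D) (a : E D → ℝ) (b : E D → E D → ℝ),
    (∀ x, x ∈ cube (w x) (r s)) ∧
    Measurable a ∧ (∀ x, 0 ≤ a x) ∧ Measurable (Function.uncurry b) ∧ (∀ x x', 0 ≤ b x x') ∧
    (∀ᵐ c ∂S.PC, ∀ᵐ x, ENNReal.log (S.margDens s.castSucc c x /
      ⨅ y ∈ cube (w x) (r s), S.margDens s.castSucc c y) ≤ (a x : EReal)) ∧
    (∀ᵐ p : E D × E D, ENNReal.log (ENNReal.ofReal (S.qDens s p.1 p.2) /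
      ⨅ y ∈ cube (w p.1) (r s), ENNReal.ofReal (S.qDens s y p.2)) ≤ (b p.1 p.2 : EReal)) ∧
    ∫⁻ p, ENNReal.ofReal (a p.2.1 + b p.2.1 p.2.2) ∂(S.stepLaw s) < ∞

end Diffusion

/-! ### Features -/

/-- Feature maps `φ_t : C × ℝ^D → ℝ^{d_t}`, sets `K_t` and functions `ρ_t(y ∣ z)` (used only for
`z ∈ K_t`), together with a cube `Q_t` (centre `qc t`, side `ql t`) and a smoothness order `s_t`.
Step `t : Fin T` is the one that reconstructs `X_t` from `(C, X_{t+1})`. -/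
structure Features (C : Type*) [MeasurableSpace C] (D T : ℕ) where
  d : Fin T → ℕ
  φ : ∀ t, C × E D → E (d t)
  φ_meas : ∀ t, Measurable (φ t)
  K : ∀ t, Set (E (d t))
  ρ : ∀ t, E D → E (d t) → ℝ
  qc : ∀ t, E (d t)
  ql : Fin T → ℝ
  s : Fin T → ℕ

namespace Features

variable {C : Type*} [MeasurableSpace C] {D T : ℕ} (F : Features C D T) (S : Diffusion C D T)

/-- The joint law of `(X_t, Z_t)`, where `Z_t = φ_t(C, X_{t+1})`. -/
def law (t : Fin T) : Measure (E D × E (F.d t)) :=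
  (S.stepLaw t).map fun p => (p.2.1, F.φ t (p.1, p.2.2))

/-- The law of the feature `Z_t`. -/
def featLaw (t : Fin T) : Measure (E (F.d t)) := (F.law S t).map Prod.snd

/-- The measure with density `ρ_t(· ∣ z)`. -/
def target (t : Fin T) (z : E (F.d t)) : Measure (E D) :=
  volume.withDensity fun y => ENNReal.ofReal (F.ρ t y z)

/-- Compact feature support, disintegration and feature sufficiency. -/
structure Valid : Prop where
  compact : ∀ t, IsCompact (F.K t)
  meas : ∀ t, Measurable (Function.uncurry (F.ρ t))
  nonneg : ∀ t y z, 0 ≤ F.ρ t y z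
  support : ∀ t, F.featLaw S t (F.K t) = 1
  disint : ∀ t, F.law S t =
    (volume.prod (F.featLaw S t)).withDensity fun p => ENNReal.ofReal (F.ρ t p.1 p.2)
  sufficient : ∀ t, ∀ᵐ p ∂(S.condLaw t), S.reverseKernel t p = F.target t (F.φ t p)

/-- Stepwise error `E_{Z_t} KL(ρ_t(· ∣ Z_t) ‖ p(· ∣ Z_t))` of a conditional density `p(y ∣ z)`. -/
def stepKL (t : Fin T) (p : E (F.d t) → E D → ℝ) : ℝ≥0∞ :=
  ∫⁻ z, klDiv (F.target t z) (volume.withDensity fun y => ENNReal.ofReal (p z y))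
    ∂(F.featLaw S t)

/-- `sup_{u ∈ C_r(y)} ‖∇_u log ρ_t(u ∣ z)‖`, with `C_r(y)` the cube of side `r` centred at `y`. -/
def gradSup (t : Fin T) (r : ℝ) (y : E D) (z : E (F.d t)) : ℝ≥0∞ :=
  ⨆ u ∈ cube y r, ENNReal.ofReal ‖gradient (fun u => Real.log (F.ρ t u z)) u‖

/-- The hypotheses of the `C¹` branch at step `t`, with exponent `θ` and cube side `r`. -/
structure C1Branch (t : Fin T) (r θ : ℝ) : Prop where
  smooth : ∀ᵐ z ∂(F.featLaw S t), ContDiff ℝ 1 fun y => F.ρ t y z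
  moment : ∀ i, ∫⁻ p, ENNReal.ofReal (|p.1 i| ^ θ) ∂(F.law S t) < ∞
  gradMoment : ∃ i, ∫⁻ p, ENNReal.ofReal (|p.1 i| ^ (θ - 2)) * F.gradSup t r p.1 p.2
    ∂(F.law S t) < ∞
  gradIntegrable : ∫⁻ p, F.gradSup t r p.1 p.2 ∂(F.law S t) < ∞

end Features

/-! ### Partitions and Gaussian mixtures -/

/-- Two cubes of side `h` with centres `x`, `y` share a face. -/
def FaceAdj {D : ℕ} (h : ℝ) (x y : E D) : Prop :=
  ∃ i, |y i - x i| = h ∧ ∀ k, k ≠ i → y k = x k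

/-- Partition data for all resolutions `m`: `m` pairwise disjoint cubes of side `h m` which are
adjacent (any two are linked by a chain of cubes with consecutive ones sharing a face), together
with the scales `δ m`, `σ m`, `σ0`. -/
structure CellPartition (D : ℕ) (r : ℝ) where
  center : (m : ℕ) → Fin m → E D
  h : ℕ → ℝ
  δ : ℕ → ℝ
  σ : ℕ → ℝ
  σ0 : ℝ
  h_pos : ∀ m, 0 < h m
  δ_pos : ∀ m, 0 < δ m
  σ_pos : ∀ m, 0 < σ m
  σ0_pos : 0 < σ0
  disjoint : ∀ m, Pairwise fun j k => Disjoint (cell (center m j) (h m)) (cell (center m k) (h m))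
  adjacent : ∀ m j k,
    Relation.ReflTransGen (fun a b => FaceAdj (h m) (center m a) (center m b)) j k
  h_lim : Tendsto h atTop (𝓝 0)
  δ_lim : Tendsto δ atTop (𝓝 0)
  -- `C_δ(y)` eventually misses the remainder cell, i.e. lies in the union of the small cells
  exhaust : ∀ y, ∀ᶠ m in atTop, Disjoint (cube y (δ m)) (⋃ j, cell (center m j) (h m))ᶜ
  σ_δ : Tendsto (fun m => σ m / δ m) atTop (𝓝 0)
  δ_h_σ : Tendsto (fun m => δ m ^ (D - 1) * h m / σ m ^ D) atTop (𝓝 0)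
  tail : (r / 2) ^ D / (2 * Real.pi * σ0 ^ 2) ^ ((D : ℝ) / 2) ≤ ((2 : ℝ) ^ (D + 1))⁻¹

/-- Density of `N(μ, σ² I_D)`. -/
def gaussDens {D : ℕ} (μ : E D) (σ : ℝ) (y : E D) : ℝ :=
  (2 * Real.pi * σ ^ 2) ^ (-(D : ℝ) / 2) * Real.exp (-‖y - μ‖ ^ 2 / (2 * σ ^ 2))

/-- Softmax weight of component `j ≥ 1` with baseline logit `0`. -/
def softWeight {m : ℕ} (u : Fin m → ℝ) (j : Fin m) : ℝ :=
  Real.exp (u j) / (1 + ∑ k, Real.exp (u k))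

/-- Softmax weight of the baseline component. -/
def softBase {m : ℕ} (u : Fin m → ℝ) : ℝ := 1 / (1 + ∑ k, Real.exp (u k))

namespace CellPartition

variable {D : ℕ} {r : ℝ} (A : CellPartition D r)

/-- The cell `A_j`, `j = 1, …, m` (indexed by `Fin m`). -/
def cellAt (m : ℕ) (j : Fin m) : Set (E D) := cell (A.center m j) (A.h m)

/-- The remainder cell `A_0`. -/
def rest (m : ℕ) : Set (E D) := (⋃ j, A.cellAt m j)ᶜ

/-- Gaussian mixture density with logits `u`. -/
def mixDens {m : ℕ} (u : Fin m → ℝ) (y : E D) : ℝ :=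
  ∑ j, softWeight u j * gaussDens (A.center m j) (A.σ m) y + softBase u * gaussDens 0 A.σ0 y

/-- Exact log-odds `log (G_j(z) / G_0(z))` of the cell probabilities of a density `ρ(y ∣ z)`. -/
def logOdds {Z : Type*} (ρ : E D → Z → ℝ) (m : ℕ) (z : Z) (j : Fin m) : ℝ :=
  Real.log ((∫ y in A.cellAt m j, ρ y z) / ∫ y in A.rest m, ρ y z)

end CellPartition

/-! ### ReLU networks and neural reverse models -/

/-- Feed-forward ReLU networks from `ℝ^a` to `ℝ^b` of arbitrary depth and widths: `output` is an
affine output layer, `hidden` puts a hidden ReLU layer in front of a network. -/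
inductive ReLUNet : ℕ → ℕ → Type
  | output {a b : ℕ} (W : Matrix (Fin b) (Fin a) ℝ) (v : Fin b → ℝ) : ReLUNet a b
  | hidden {a k b : ℕ} (W : Matrix (Fin k) (Fin a) ℝ) (v : Fin k → ℝ) (N : ReLUNet k b) :
      ReLUNet a b

/-- The function computed by a ReLU network. -/
def ReLUNet.eval : {a b : ℕ} → ReLUNet a b → (Fin a → ℝ) → Fin b → ℝ
  | _, _, .output W v, x => W.mulVec x + v
  | _, _, .hidden W v N, x => N.eval fun i => max 0 ((W.mulVec x + v) i)

/-- A neural reverse model of horizon `T` with feature dimensions `d`: at every step a number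
`m t ≥ 1` of cells and a ReLU network computing the logits. -/
structure NeuralModel {T : ℕ} (d : Fin T → ℕ) where
  m : Fin T → ℕ
  m_pos : ∀ t, 1 ≤ m t
  net : ∀ t, ReLUNet (d t) (m t)

section Models

variable {C : Type*} [MeasurableSpace C] {D T : ℕ} {r : Fin T → ℝ}

/-- The reverse kernels of a neural reverse model: at step `t` the Gaussian mixture density with
logits the network output at `φ_t(c, x)`. -/
def NeuralModel.kernel (F : Features C D T) (A : ∀ t, CellPartition D (r t)) (N : NeuralModel F.d)
    (t : Fin T) : Kernel (C × E D) (E D) :=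
  Kernel.withDensity (Kernel.const _ volume) fun p y =>
    ENNReal.ofReal ((A t).mixDens ((N.net t).eval (F.φ t p)) y)

/-- Predictor induced by a neural reverse model. -/
def NeuralModel.predictor (S : Diffusion C D T) (F : Features C D T)
    (A : ∀ t, CellPartition D (r t)) (N : NeuralModel F.d) : Kernel C (E D) :=
  S.predictor (N.kernel F A)

/-- The family of all predictors induced by neural reverse models of horizon `T`. -/
def neuralFamily (S : Diffusion C D T) (F : Features C D T) (A : ∀ t, CellPartition D (r t)) :
    Set (Kernel C (E D)) :=
  Set.range fun N : NeuralModel F.d => N.predictor S F A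

/-- The infeasible mixture density with `m` cells and the exact log-odds as logits. -/
def exactDens (F : Features C D T) (A : ∀ t, CellPartition D (r t)) (t : Fin T) (m : ℕ)
    (z : E (F.d t)) (y : E D) : ℝ :=
  (A t).mixDens ((A t).logOdds (F.ρ t) m z) y

/-- Smooth log-odds: `Q_t` is a cube containing `K_t` and all exact log-odds extend from `K_t` to
`C^{s_t}` functions on a neighbourhood of `Q_t`. (As `Q_t` is compact, the `C^{s_t}` norms of the
finitely many log-odds at a given resolution are then finite on `Q_t`.) -/
def SmoothLogOdds (F : Features C D T) (A : ∀ t, CellPartition D (r t)) : Prop :=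
  ∀ t, 0 < F.ql t ∧ F.K t ⊆ cube (F.qc t) (F.ql t) ∧
    ∀ m, 1 ≤ m → ∀ j : Fin m, ∃ (U : Set (E (F.d t))) (L : E (F.d t) → ℝ),
      IsOpen U ∧ cube (F.qc t) (F.ql t) ⊆ U ∧ ContDiffOn ℝ (F.s t) L U ∧
      ∀ z ∈ F.K t, L z = (A t).logOdds (F.ρ t) m z j

/-- The exponent `D⁻¹ / (2 + 1 / (θ - 2) + ξ)`. -/
def rateExp (D : ℕ) (θ ξ : ℝ) : ℝ := (D : ℝ)⁻¹ / (2 + 1 / (θ - 2) + ξ)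

end Models

end RevDiff

end

open RevDiff

/-!
# Neural reverse models attain the terminal mismatch

The output error of a reverse model is a relative entropy at time `0` of the backward chain. By the
chain rule and data processing along the chain (`Diffusion.outputKL_predictor_le`) it is at most the
terminal mismatch plus the averaged relative entropies of the reverse steps. By feature sufficiency
the true reverse kernels have the densities `ρ_t(· ∣ φ_t)`, so each step costs at most
`logLoss`, the integral of the positive part of `log (ρ_t / p)` under the law of `(X_t, Z_t)`. It
remains to make this integral small for a Gaussian mixture whose logits are computed by a network.

*Networks.* The logits enter the logarithm of the mixture density in a Lipschitz way
(`CellPartition.mixDens_ge`), and networks with one hidden layer are uniformly dense in the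
continuous functions on the compact feature set (`exists_reluNet_approx`: the closed span of the
hinge functions contains all exponentials of linear forms, which span a separating algebra). Hence
any logits that agree on the feature set with continuous functions may be replaced by a network.

*General partitions.* With the exact log-odds the remainder weight may become too small to control
the tails uniformly in `m`, so the weights `(1 - η) G_j` and the baseline `(1 - η) G_0 + η` are used
instead; their logits are continuous functions of the exact ones. The baseline bounds
`log (ρ / p)` from above by `log ρ` plus a quadratic function, and `log ρ` is controlled by the
logarithmic variation of the forward densities: Bayes' formula (`Features.Valid.bayes`) shows that
`ρ` loses at most a factor `exp (a + b)` on a cube, on which its mass is at most one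
(`Features.Valid.density_le`). This gives an integrable majorant. At Lebesgue points the mixture
eventually exceeds `(1 - η)² ρ` (`CellPartition.ae_eventually_smoothing_ge`), and the reverse Fatou
lemma bounds the limit superior of the losses by `-2 log (1 - η)`.

*The explicit rate.* The cells are lattice cubes of side `δ^{2+ξ}` whose labels form a lower set of
`ℕ^D` containing a full cube of `N^D ≈ m` labels, with `δ = (m + 1)^{-β}` and bandwidth
`σ = δ^{1+ξ/(2D)}`. The bound `S` on the logarithmic gradient gives `ρ(u) ≥ ρ(y) exp (-S ‖u - y‖)`
on the cube around `y`. Where the cube of side `2δ` around `y` is covered by cells, smoothing costs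
`√D δ S + O(δ)`. Elsewhere half of the cube of side `2σ` lies in the cells or in the remainder,
which costs `√D σ S + O(log (1/σ) + ‖y‖²)`; since such points satisfy `|y_i| ≥ δ^{-1/(θ-2)} / 4` for
some `i`, the excess is absorbed by `O(δ) ∑ |y_i|^θ`. Integration gives the rate `δ ≤ m^{-β}`.
-/

namespace RevDiff

/-! ### Relative entropy -/

/-- The relative entropy of two composition-products over the same first marginal is the average
of the fibrewise relative entropies. -/
theorem klDiv_compProd_eq_lintegral {α β : Type*} [MeasurableSpace α] [MeasurableSpace β]
    [MeasurableSpace.CountableOrCountablyGenerated α β] (μ : Measure α) [IsFiniteMeasure μ]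
    (κ η : Kernel α β) [IsMarkovKernel κ] [IsMarkovKernel η] :
    klDiv (μ ⊗ₘ κ) (μ ⊗ₘ η) = ∫⁻ a, klDiv (κ a) (η a) ∂μ := by
  by_cases hac : ∀ᵐ a ∂μ, κ a ≪ η a
  · have hac' : μ ⊗ₘ κ ≪ μ ⊗ₘ η := Measure.AbsolutelyContinuous.compProd_right hac
    have hwd : μ ⊗ₘ κ = (μ ⊗ₘ η).withDensity fun p => Kernel.rnDeriv κ η p.1 p.2 := by
      rw [← Measure.compProd_withDensity (Kernel.measurable_rnDeriv κ η)]
      refine Measure.compProd_congr ?_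
      filter_upwards [hac] with a ha using (Kernel.withDensity_rnDeriv_eq ha).symm
    have hrn : (μ ⊗ₘ κ).rnDeriv (μ ⊗ₘ η) =ᵐ[μ ⊗ₘ η] fun p => Kernel.rnDeriv κ η p.1 p.2 := by
      conv_lhs => rw [hwd]
      exact Measure.rnDeriv_withDensity _ (Kernel.measurable_rnDeriv κ η)
    rw [klDiv_eq_lintegral_klFun_of_ac hac']
    have h1 : ∫⁻ p, ENNReal.ofReal (klFun ((μ ⊗ₘ κ).rnDeriv (μ ⊗ₘ η) p).toReal) ∂(μ ⊗ₘ η)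
        = ∫⁻ p, ENNReal.ofReal (klFun (Kernel.rnDeriv κ η p.1 p.2).toReal) ∂(μ ⊗ₘ η) := by
      refine lintegral_congr_ae ?_
      filter_upwards [hrn] with p hp using by rw [hp]
    rw [h1, Measure.lintegral_compProd (by fun_prop)]
    refine lintegral_congr_ae ?_
    filter_upwards [hac] with a ha
    rw [klDiv_eq_lintegral_klFun_of_ac ha]
    refine lintegral_congr_ae ?_
    filter_upwards [Kernel.rnDeriv_eq_rnDeriv_measure (κ := κ) (η := η) (a := a)] with b hb
    rw [hb]
  · rw [klDiv_of_not_ac (by rwa [Measure.absolutelyContinuous_compProd_right_iff])]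
    have hmeas := Kernel.measurableSet_absolutelyContinuous κ η
    have hpos : μ {a | κ a ≪ η a}ᶜ ≠ 0 := by rw [ae_iff] at hac; exact hac
    symm
    rw [eq_top_iff]
    calc (∞ : ℝ≥0∞) = ∫⁻ a in {a | κ a ≪ η a}ᶜ, ∞ ∂μ := by
          rw [setLIntegral_const, ENNReal.top_mul hpos]
      _ ≤ ∫⁻ a in {a | κ a ≪ η a}ᶜ, klDiv (κ a) (η a) ∂μ := by
          refine setLIntegral_mono' hmeas.compl fun a ha => ?_
          rw [klDiv_of_not_ac ha]
      _ ≤ _ := setLIntegral_le_lintegral _ _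

/-- Relative entropy is at most the integral of the positive part of the log-likelihood ratio. -/
theorem klDiv_le_lintegral_llr {α : Type*} [MeasurableSpace α] (μ ν : Measure α)
    [IsProbabilityMeasure μ] [IsProbabilityMeasure ν] (hac : μ ≪ ν) :
    klDiv μ ν ≤ ∫⁻ x, ENNReal.ofReal (llr μ ν x) ∂μ := by
  by_cases htop : ∫⁻ x, ENNReal.ofReal (llr μ ν x) ∂μ = ∞
  · simp [htop]
  have hne : klDiv μ ν ≠ ∞ := by
    rw [klDiv_eq_lintegral_klFun_of_ac hac]
    refine ne_top_of_le_ne_top (b := ∫⁻ x, ENNReal.ofReal (llr μ ν x) ∂μ + 1) (by finiteness) ?_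
    rw [← lintegral_rnDeriv_mul hac (by fun_prop)]
    have : (1 : ℝ≥0∞) = ∫⁻ _, 1 ∂ν := by simp
    rw [this, ← lintegral_add_right _ measurable_const]
    refine lintegral_mono_ae ?_
    filter_upwards [μ.rnDeriv_ne_top ν] with x hx
    set X := μ.rnDeriv ν x
    have hX : X = ENNReal.ofReal X.toReal := (ENNReal.ofReal_toReal hx).symm
    calc ENNReal.ofReal (klFun X.toReal)
        ≤ ENNReal.ofReal (X.toReal * Real.log X.toReal + 1) := by
          refine ENNReal.ofReal_le_ofReal ?_
          rw [klFun_apply]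
          linarith [X.toReal_nonneg]
      _ ≤ ENNReal.ofReal (X.toReal * Real.log X.toReal) + 1 := by
          simpa using ENNReal.ofReal_add_le (p := X.toReal * Real.log X.toReal) (q := 1)
      _ = X * ENNReal.ofReal (llr μ ν x) + 1 := by
          rw [ENNReal.ofReal_mul X.toReal_nonneg, ← hX]; rfl
  obtain ⟨-, hint⟩ := klDiv_ne_top_iff.1 hne
  rw [klDiv_of_ac_of_integrable hac hint]
  simp only [probReal_univ, add_sub_cancel_right]
  refine ENNReal.ofReal_le_of_le_toReal ?_
  rw [integral_eq_lintegral_pos_part_sub_lintegral_neg_part hint]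
  linarith [ENNReal.toReal_nonneg (a := ∫⁻ a, ENNReal.ofReal (-llr μ ν a) ∂μ)]

theorem klDiv_withDensity_le {α : Type*} [MeasurableSpace α] (m : Measure α) [SigmaFinite m]
    {f g : α → ℝ} (hf : Measurable f) (hg : Measurable g)
    (hg0 : ∀ x, 0 < g x) [IsProbabilityMeasure (m.withDensity fun x => ENNReal.ofReal (f x))]
    [IsProbabilityMeasure (m.withDensity fun x => ENNReal.ofReal (g x))] :
    klDiv (m.withDensity fun x => ENNReal.ofReal (f x))
        (m.withDensity fun x => ENNReal.ofReal (g x))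
      ≤ ∫⁻ x, ENNReal.ofReal (Real.log (f x / g x))
          ∂(m.withDensity fun x => ENNReal.ofReal (f x)) := by
  set μ := m.withDensity fun x => ENNReal.ofReal (f x) with hμ
  set ν := m.withDensity fun x => ENNReal.ofReal (g x) with hν
  have hwd : μ = ν.withDensity fun x => ENNReal.ofReal (f x / g x) := by
    rw [hμ, hν, ← withDensity_mul _ (by fun_prop) (by fun_prop)]
    congr 1
    ext x
    simp only [Pi.mul_apply]
    rw [← ENNReal.ofReal_mul (hg0 x).le, mul_div_cancel₀ _ (hg0 x).ne']
  have hac : μ ≪ ν := by rw [hwd]; exact withDensity_absolutelyContinuous _ _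
  refine (klDiv_le_lintegral_llr μ ν hac).trans (le_of_eq (lintegral_congr_ae ?_))
  have hrn : μ.rnDeriv ν =ᵐ[ν] fun x => ENNReal.ofReal (f x / g x) := by
    conv_lhs => rw [hwd]
    exact Measure.rnDeriv_withDensity _ (by fun_prop)
  have hpos : ∀ᵐ x ∂μ, 0 < f x := by
    rw [hμ, ae_withDensity_iff (by fun_prop)]
    refine ae_of_all _ fun x hx => ?_
    simpa using hx
  filter_upwards [hac.ae_eq hrn, hpos] with x hx h0
  rw [llr, hx, ENNReal.toReal_ofReal (div_nonneg h0.le (hg0 x).le)]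


/-! ### The chain rule along the backward path -/

section Backward

variable {C : Type*} [MeasurableSpace C] {D : ℕ}

theorem map_backwardPath_zero (ν : Measure (E D)) (p : Fin 0 → Kernel (C × E D) (E D)) :
    (backwardPath ν p).map (fun x => x 0) = Kernel.const C ν := by
  ext c s hs
  rw [Kernel.map_apply _ (by fun_prop)]
  simp only [backwardPath, Kernel.const_apply]
  rw [Measure.map_map (by fun_prop) (by fun_prop)]
  simp [Function.comp_def]

/-- The last reverse step, integrated over the condition. -/
theorem compProd_map_backwardPath_succ {T : ℕ} (PC : Measure C) [IsProbabilityMeasure PC]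
    (ν : Measure (E D)) [IsProbabilityMeasure ν] (p : Fin (T + 1) → Kernel (C × E D) (E D))
    (hp : ∀ t, IsMarkovKernel (p t)) :
    PC ⊗ₘ (backwardPath ν p).map (fun x => x 0) =
      ((PC ⊗ₘ (backwardPath ν fun t : Fin T => p t.succ).map (fun x => x 0)) ⊗ₘ p 0).map
        fun w => (w.1.1, w.2) := by
  have h1 := isMarkovKernel_backwardPath ν p hp
  have h2 := isMarkovKernel_backwardPath ν (fun t : Fin T => p t.succ) fun t => hp _
  have h3 := hp 0
  have e0 : Measurable fun x : Fin (T + 1) → E D => x 0 := by fun_prop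
  have e1 : Measurable fun x : Fin (T + 1 + 1) → E D => x 0 := by fun_prop
  have := Kernel.IsMarkovKernel.map (backwardPath ν p) e1
  have := Kernel.IsMarkovKernel.map (backwardPath ν (fun t : Fin T => p t.succ)) e0
  refine Measure.ext_of_lintegral _ fun f hf => ?_
  rw [lintegral_map hf (by fun_prop), Measure.lintegral_compProd hf,
    Measure.lintegral_compProd (by fun_prop), Measure.lintegral_compProd]
  swap
  · exact Measurable.lintegral_kernel_prod_right' (κ := p 0)
      (f := fun w : (C × E D) × E D => f (w.1.1, w.2)) (by fun_prop)
  refine lintegral_congr fun c => ?_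
  rw [Kernel.map_apply _ e1, Kernel.map_apply _ e0, lintegral_map (by fun_prop) e1,
    lintegral_map _ e0]
  swap
  · exact (Measurable.lintegral_kernel_prod_right' (κ := p 0)
      (f := fun w : (C × E D) × E D => f (w.1.1, w.2)) (by fun_prop)).comp
      (measurable_prodMk_left (x := c))
  simp only [backwardPath]
  rw [Kernel.map_apply _ measurable_cons, lintegral_map (by fun_prop) measurable_cons,
    Kernel.lintegral_compProd _ _ _ (by simpa using by fun_prop)]
  simp

/-- Chain rule and data processing: if `J t` has marginals `P (t + 1)` and `P t`, the divergence of
`P 0` from the law of the backward chain at time `0` is at most the divergence at the terminal time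
plus the divergences of the reverse steps. -/
theorem klDiv_backward_le (PC : Measure C) [IsProbabilityMeasure PC]
    (ν : Measure (E D)) [IsProbabilityMeasure ν] : ∀ {T : ℕ} (p : Fin T → Kernel (C × E D) (E D))
    (_ : ∀ t, IsMarkovKernel (p t)) (P : Fin (T + 1) → Measure (C × E D))
    (J : Fin T → Measure ((C × E D) × E D)) (_ : ∀ t, IsProbabilityMeasure (P t))
    (_ : ∀ t, IsProbabilityMeasure (J t)) (_ : ∀ t, (J t).fst = P t.succ)
    (_ : ∀ t, (J t).map (fun w => (w.1.1, w.2)) = P t.castSucc),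
    klDiv (P 0) (PC ⊗ₘ (backwardPath ν p).map (fun x => x 0)) ≤
      klDiv (P (Fin.last T)) (PC ⊗ₘ Kernel.const C ν) +
        ∑ t, klDiv (J t) (P t.succ ⊗ₘ p t) := by
  intro T
  induction T with
  | zero =>
    intro p hp P J _ _ _ _
    rw [map_backwardPath_zero]
    simp
  | succ T ih =>
    intro p hp P J hP hJ h1 h2
    have ih' := ih (fun t => p t.succ) (fun t => hp _) (fun t => P t.succ) (fun t => J t.succ)
      (fun t => hP _) (fun t => hJ _) (fun t => h1 _) (fun t => h2 _)
    have h0 := hp 0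
    have hb := isMarkovKernel_backwardPath ν (fun t : Fin T => p t.succ) fun t => hp _
    have e0 : Measurable fun x : Fin (T + 1) → E D => x 0 := by fun_prop
    have := Kernel.IsMarkovKernel.map (backwardPath ν (fun t : Fin T => p t.succ)) e0
    have hdis : P (Fin.succ 0) ⊗ₘ (J 0).condKernel = J 0 := by
      rw [← h1 0]; exact (J 0).disintegrate _
    rw [compProd_map_backwardPath_succ PC ν p hp]
    have hfirst := h2 0
    rw [Fin.castSucc_zero] at hfirst
    rw [← hfirst]
    calc _ ≤ klDiv (J 0) ((PC ⊗ₘ (backwardPath ν fun t : Fin T => p t.succ).map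
              (fun x => x 0)) ⊗ₘ p 0) := klDiv_map_le _ _ (by fun_prop)
      _ = klDiv (P (Fin.succ 0)) (PC ⊗ₘ (backwardPath ν fun t : Fin T => p t.succ).map
              (fun x => x 0)) + klDiv (J 0) (P (Fin.succ 0) ⊗ₘ p 0) := by
          conv_lhs => rw [← hdis]
          rw [klDiv_compProd_eq_add, hdis]
      _ ≤ _ := by
          rw [Fin.sum_univ_succ, add_comm (klDiv (J 0) _), ← add_assoc]
          gcongr
          exact ih'

end Backward

namespace Diffusion

variable {C : Type*} [MeasurableSpace C] {D T : ℕ} (S : Diffusion C D T)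

instance (t : Fin (T + 1)) : IsMarkovKernel (S.marg t) :=
  Kernel.IsMarkovKernel.map _ (by fun_prop)

instance isProbabilityMeasure_stepLaw (t : Fin T) : IsProbabilityMeasure (S.stepLaw t) :=
  Measure.isProbabilityMeasure_map (by fun_prop)

instance isProbabilityMeasure_condLaw (t : Fin T) : IsProbabilityMeasure (S.condLaw t) :=
  Measure.isProbabilityMeasure_map (by fun_prop)

/-- The law of `(C, X_t)` is a marginal of the joint law. -/
theorem compProd_marg (t : Fin (T + 1)) :
    S.PC ⊗ₘ S.marg t = S.joint.map fun p => (p.1, p.2 t) := by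
  refine Measure.ext_of_lintegral _ fun f hf => ?_
  rw [lintegral_map hf (by fun_prop), joint, Measure.lintegral_compProd hf,
    Measure.lintegral_compProd (by fun_prop)]
  refine lintegral_congr fun c => ?_
  rw [marg, Kernel.map_apply _ (by fun_prop), lintegral_map (by fun_prop) (by fun_prop)]

theorem condLaw_eq (t : Fin T) : S.condLaw t = S.PC ⊗ₘ S.marg t.succ := by
  rw [compProd_marg, condLaw, stepLaw, Measure.map_map (by fun_prop) (by fun_prop)]
  rfl

theorem map_stepLaw_fst (t : Fin T) :
    (S.stepLaw t).map (fun p => (p.1, p.2.1)) = S.PC ⊗ₘ S.marg t.castSucc := by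
  rw [compProd_marg, stepLaw, Measure.map_map (by fun_prop) (by fun_prop)]
  rfl

/-- The disintegration defining the true reverse kernel. -/
theorem condLaw_compProd_reverseKernel (t : Fin T) :
    S.condLaw t ⊗ₘ S.reverseKernel t = (S.stepLaw t).map fun p => ((p.1, p.2.2), p.2.1) := by
  rw [reverseKernel]
  convert! Measure.disintegrate _ _ using 2
  · rw [Measure.fst, Measure.map_map (by fun_prop) (by fun_prop)]
    rfl
  · infer_instance

instance (t : Fin T) : IsMarkovKernel (S.reverseKernel t) := by
  unfold reverseKernel; infer_instance

theorem marg_zero : S.marg 0 = S.piStar := by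
  have key : ∀ {T : ℕ} (q : Fin T → Kernel (E D) (E D)) (_ : ∀ t, IsMarkovKernel (q t)),
      (forwardPath S.piStar q).map (fun x => x 0) = S.piStar := by
    intro T
    induction T with
    | zero =>
      intro q _
      ext c : 1
      rw [Kernel.map_apply _ (by fun_prop), forwardPath, Kernel.map_apply _ (by fun_prop),
        Measure.map_map (by fun_prop) (by fun_prop)]
      simp [Function.comp_def]
    | succ T ih =>
      intro q hq
      have := isMarkovKernel_forwardPath S.piStar (fun t : Fin T => q t.castSucc)
      refine Eq.trans ?_ (ih (fun t => q t.castSucc) fun t => hq _)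
      ext c : 1
      rw [Kernel.map_apply _ (by fun_prop), forwardPath, Kernel.map_apply _ measurable_snoc,
        Measure.map_map (by fun_prop) measurable_snoc, Kernel.map_apply _ (by fun_prop)]
      have : ((fun x : Fin (T + 1 + 1) → E D => x 0) ∘
          fun p : (Fin (T + 1) → E D) × E D => (Fin.snoc p.1 p.2 : Fin (T + 1 + 1) → E D))
          = (fun x : Fin (T + 1) → E D => x 0) ∘ Prod.fst := by
        ext p : 1
        simp only [Function.comp]
        rw [← Fin.castSucc_zero, Fin.snoc_castSucc]
      rw [this, ← Measure.map_map (by fun_prop) measurable_fst]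
      congr 1
      rw [← Kernel.fst_apply, Kernel.fst_compProd]
  exact key S.q inferInstance

/-- The output error of a reverse model is at most the terminal mismatch plus the averaged errors
of its reverse kernels. -/
theorem outputKL_predictor_le (p : Fin T → Kernel (C × E D) (E D))
    (hp : ∀ t, IsMarkovKernel (p t)) :
    S.outputKL (S.predictor p) ≤ S.meanComp +
      ∑ t, ∫⁻ w, klDiv (S.reverseKernel t w) (p t w) ∂(S.condLaw t) := by
  have hb := isMarkovKernel_backwardPath S.ν p hp
  have : IsMarkovKernel (S.predictor p) := Kernel.IsMarkovKernel.map _ (by fun_prop)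
  have h := klDiv_backward_le S.PC S.ν p hp (fun t => S.PC ⊗ₘ S.marg t)
    (fun t => S.condLaw t ⊗ₘ S.reverseKernel t) (fun t => inferInstance) (fun t => inferInstance)
    (fun t => by rw [Measure.fst_compProd, condLaw_eq])
    (fun t => by
      rw [condLaw_compProd_reverseKernel, Measure.map_map (by fun_prop) (by fun_prop),
        ← map_stepLaw_fst]
      rfl)
  simp only [marg_zero, ← condLaw_eq] at h
  rw [outputKL, meanComp, ← klDiv_compProd_eq_lintegral]
  refine h.trans (le_of_eq ?_)
  rw [klDiv_compProd_eq_lintegral]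
  simp only [klDiv_compProd_eq_lintegral, Kernel.const_apply]

end Diffusion


/-! ### Markov structure and Bayes' formula -/

theorem measurableSet_cube {D : ℕ} (w : E D) (r : ℝ) : MeasurableSet (cube w r) := by
  have : cube w r = ⋂ i, {y : E D | |y i - w i| ≤ r / 2} := by ext; simp [cube]
  rw [this]
  exact MeasurableSet.iInter fun i => measurableSet_le (by fun_prop) (by fun_prop)

theorem volume_cube {D : ℕ} (w : E D) (r : ℝ) : volume (cube w r) = ENNReal.ofReal r ^ D := by
  have h := (EuclideanSpace.volume_preserving_symm_measurableEquiv_toLp (Fin D))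
  have e : cube w r = (MeasurableEquiv.toLp 2 (Fin D → ℝ)).symm ⁻¹'
      (Set.univ.pi fun i => Metric.closedBall (w i) (r / 2)) := by
    ext y
    simp [cube, Real.dist_eq, Set.mem_pi]
  rw [e, h.measure_preimage_equiv, volume_pi_pi]
  simp only [Real.volume_closedBall, Finset.prod_const, Finset.card_univ, Fintype.card_fin]
  congr 2; ring

namespace Diffusion

variable {C : Type*} [MeasurableSpace C] {D T : ℕ} (S : Diffusion C D T)

theorem forwardPath_map_pair (π₀ : Kernel C (E D)) [IsMarkovKernel π₀] :
    ∀ {T : ℕ} (q : Fin T → Kernel (E D) (E D)) (_ : ∀ t, IsMarkovKernel (q t)) (s : Fin T),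
      (forwardPath π₀ q).map (fun x => (x s.castSucc, x s.succ)) =
        (forwardPath π₀ q).map (fun x => x s.castSucc) ⊗ₖ Kernel.prodMkLeft C (q s) := by
  intro T
  induction T with
  | zero => exact fun _ _ s => s.elim0
  | succ T ih =>
    intro q hq s
    have h1 := isMarkovKernel_forwardPath π₀ (fun t : Fin T => q t.castSucc)
    have hF : ∀ {β : Type} [MeasurableSpace β] (g : (Fin (T + 1) → E D) → β) (_ : Measurable g)
        (k : (Fin (T + 1 + 1) → E D) → β) (_ : Measurable k)
        (_ : ∀ p : (Fin (T + 1) → E D) × E D,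
          k (Fin.snoc p.1 p.2 : Fin (T + 1 + 1) → E D) = g p.1),
        (forwardPath π₀ q).map k = (forwardPath π₀ fun t : Fin T => q t.castSucc).map g := by
      intro β _ g hg k hk hgk
      ext c : 1
      rw [Kernel.map_apply _ hk, forwardPath, Kernel.map_apply _ measurable_snoc,
        Measure.map_map hk measurable_snoc, Kernel.map_apply _ hg]
      have : (k ∘ fun p : (Fin (T + 1) → E D) × E D => (Fin.snoc p.1 p.2 : Fin (T + 1 + 1) → E D))
          = g ∘ Prod.fst := funext hgk
      rw [this, ← Measure.map_map hg measurable_fst]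
      congr 1
      rw [← Kernel.fst_apply, Kernel.fst_compProd]
    refine Fin.lastCases ?_ (fun s => ?_) s
    · have h2 := hF (fun x => x (Fin.last T)) (by fun_prop)
        (fun x => x (Fin.last T).castSucc) (by fun_prop) (fun p => by simp)
      have e1 : Measurable fun x : Fin (T + 1) → E D => x (Fin.last T) := by fun_prop
      have := Kernel.IsMarkovKernel.map (forwardPath π₀ fun t : Fin T => q t.castSucc) e1
      rw [h2]
      ext c : 1
      refine Measure.ext_of_lintegral _ fun f hf => ?_
      rw [Kernel.map_apply _ (by fun_prop), forwardPath, Kernel.map_apply _ measurable_snoc,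
        Measure.map_map (by fun_prop) measurable_snoc,
        lintegral_map hf (Measurable.comp (by fun_prop) measurable_snoc)]
      simp only [Function.comp, Fin.snoc_castSucc, Fin.succ_last, Fin.snoc_last]
      rw [Kernel.lintegral_compProd _ _ _ (by fun_prop),
        Kernel.lintegral_compProd _ _ _ hf, Kernel.map_apply _ e1, lintegral_map _ e1]
      · simp
      · simp only [Kernel.prodMkLeft_apply]
        exact Measurable.lintegral_kernel_prod_right' (κ := q (Fin.last T)) hf
    · have h2 := hF (fun x => x s.castSucc) (by fun_prop)
        (fun x => x s.castSucc.castSucc) (by fun_prop) (fun p => by simp)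
      have h3 := hF (fun x => (x s.castSucc, x s.succ)) (by fun_prop)
        (fun x => (x s.castSucc.castSucc, x s.castSucc.succ)) (by fun_prop)
        (fun p => by simp [← Fin.castSucc_succ])
      rw [h2, h3]
      exact ih (fun t => q t.castSucc) (fun t => hq _) s

theorem lintegral_stepLaw (s : Fin T) {f : C × E D × E D → ℝ≥0∞} (hf : Measurable f) :
    ∫⁻ w, f w ∂(S.stepLaw s) =
      ∫⁻ c, ∫⁻ x, (∫⁻ x', ENNReal.ofReal (S.qDens s x x') * f (c, x, x'))
        ∂(S.marg s.castSucc c) ∂S.PC := by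
  rw [stepLaw, lintegral_map hf (by fun_prop), joint, Measure.lintegral_compProd (by fun_prop)]
  refine lintegral_congr fun c => ?_
  have h := congrArg (fun κ : Kernel C (E D × E D) => ∫⁻ y, f (c, y) ∂(κ c))
    (forwardPath_map_pair S.piStar S.q inferInstance s)
  beta_reduce at h
  rw [Kernel.map_apply _ (by fun_prop), lintegral_map (by fun_prop) (by fun_prop)] at h
  have e1 : Measurable fun x : Fin (T + 1) → E D => x s.castSucc := by fun_prop
  have := Kernel.IsMarkovKernel.map (forwardPath S.piStar S.q) e1
  rw [path, h, Kernel.lintegral_compProd _ _ _ (by fun_prop)]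
  refine lintegral_congr fun x => ?_
  have hq := S.qDens_meas s
  have hq' : Measurable fun u => S.qDens s x u := hq.comp measurable_prodMk_left
  rw [Kernel.prodMkLeft_apply, S.q_eq, lintegral_withDensity_eq_lintegral_mul _ (by fun_prop)
    (by fun_prop)]
  rfl

@[fun_prop]
theorem measurable_margDens (t : Fin (T + 1)) :
    Measurable fun p : C × E D => S.margDens t p.1 p.2 := by
  refine Fin.cases ?_ (fun s => ?_) t
  · simp only [margDens, Fin.cases_zero]
    exact S.piDens_meas.ennreal_ofReal
  · simp only [margDens, Fin.cases_succ]
    have hq := S.qDens_meas s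
    have : Measurable fun p : (C × E D) × E D => ENNReal.ofReal (S.qDens s p.2 p.1.2) :=
      (hq.comp (measurable_snd.prodMk (measurable_snd.comp measurable_fst))).ennreal_ofReal
    exact Measurable.lintegral_kernel_prod_right'
      (κ := Kernel.prodMkRight (E D) (S.marg s.castSucc)) this

theorem marg_succ (s : Fin T) (c : C) : S.marg s.succ c =
    volume.withDensity (S.margDens s.succ c) := by
  have hq := S.qDens_meas s
  have hd : Measurable (S.margDens s.succ c) := (S.measurable_margDens s.succ).comp
    measurable_prodMk_left
  have e1 : Measurable fun x : Fin (T + 1) → E D => x s.castSucc := by fun_prop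
  have := Kernel.IsMarkovKernel.map (forwardPath S.piStar S.q) e1
  refine Measure.ext_of_lintegral _ fun f hf => ?_
  have h := congrArg (fun κ : Kernel C (E D × E D) => ∫⁻ y, f y.2 ∂(κ c))
    (forwardPath_map_pair S.piStar S.q inferInstance s)
  beta_reduce at h
  rw [Kernel.map_apply _ (by fun_prop), lintegral_map (by fun_prop) (by fun_prop),
    Kernel.lintegral_compProd _ _ _ (by fun_prop)] at h
  rw [marg, Kernel.map_apply _ (by fun_prop), lintegral_map hf (by fun_prop), path, h,
    lintegral_withDensity_eq_lintegral_mul _ hd hf]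
  simp only [margDens, Fin.cases_succ, Pi.mul_apply, Kernel.prodMkLeft_apply]
  have : ∀ x, ∫⁻ y, f y ∂(S.q s x) = ∫⁻ u, ENNReal.ofReal (S.qDens s x u) * f u := by
    intro x
    have hq' : Measurable fun u => S.qDens s x u := hq.comp measurable_prodMk_left
    rw [S.q_eq, lintegral_withDensity_eq_lintegral_mul _ (by fun_prop) hf]
    rfl
  simp only [this]
  rw [lintegral_lintegral_swap]
  · refine lintegral_congr fun u => ?_
    have hq' : Measurable fun x => S.qDens s x u := hq.comp measurable_prodMk_right
    rw [lintegral_mul_const _ (by fun_prop)]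
    rfl
  · exact (hq.ennreal_ofReal.mul (hf.comp measurable_snd)).aemeasurable

theorem marg_eq_withDensity (t : Fin (T + 1)) : ∀ᵐ c ∂S.PC, S.marg t c =
    volume.withDensity (S.margDens t c) := by
  refine Fin.cases ?_ (fun s => ?_) t
  · filter_upwards [S.piStar_eq] with c hc
    rw [marg_zero, hc]; rfl
  · exact ae_of_all _ fun c => S.marg_succ s c

theorem margDens_pos {r : Fin T → ℝ} (hS : S.Regular r) (t : Fin (T + 1)) :
    ∀ᵐ c ∂S.PC, ∀ x, 0 < S.margDens t c x := by
  refine Fin.cases ?_ (fun s => ?_) t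
  · filter_upwards [hS.pos] with c hc x
    simpa [margDens] using hc x
  · refine ae_of_all _ fun c x => ?_
    simp only [margDens, Fin.cases_succ]
    have hq : Measurable fun v => S.qDens s v x := (S.qDens_meas s).comp measurable_prodMk_right
    rw [lintegral_pos_iff_support (by fun_prop)]
    have : (Function.support fun v => ENNReal.ofReal (S.qDens s v x)) = Set.univ := by
      ext v; simp [S.qDens_pos]
    simp [this]

theorem margDens_succ_eq (s : Fin T) : ∀ᵐ c ∂S.PC, ∀ x', S.margDens s.succ c x' =
    ∫⁻ x, S.margDens s.castSucc c x * ENNReal.ofReal (S.qDens s x x') := by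
  filter_upwards [S.marg_eq_withDensity s.castSucc] with c hc x'
  have hq : Measurable fun v => S.qDens s v x' := (S.qDens_meas s).comp measurable_prodMk_right
  have hd : Measurable (S.margDens s.castSucc c) := (S.measurable_margDens _).comp
    measurable_prodMk_left
  conv_lhs => simp only [margDens, Fin.cases_succ]
  rw [hc, lintegral_withDensity_eq_lintegral_mul _ hd (by fun_prop)]
  rfl

end Diffusion

namespace Features

variable {C : Type*} [MeasurableSpace C] {D T : ℕ} {F : Features C D T} {S : Diffusion C D T}

/-- Bayes' formula for the density of the reverse kernel. -/
theorem Valid.bayes (hF : F.Valid S) (s : Fin T) :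
    ∀ᵐ w : C × E D × E D ∂(S.PC.prod (volume.prod volume)),
      S.margDens s.castSucc w.1 w.2.2 * ENNReal.ofReal (S.qDens s w.2.2 w.2.1) =
        S.margDens s.succ w.1 w.2.1 * ENNReal.ofReal (F.ρ s w.2.2 (F.φ s (w.1, w.2.1))) := by
  have hq := S.qDens_meas s
  have hρ := hF.meas s
  have hφ := F.φ_meas s
  have m1 : Measurable fun w : C × E D × E D =>
      S.margDens s.castSucc w.1 w.2.2 * ENNReal.ofReal (S.qDens s w.2.2 w.2.1) :=
    ((S.measurable_margDens _).comp (g := S.margDens s.castSucc |> Function.uncurry)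
      (f := fun w : C × E D × E D => (w.1, w.2.2)) (by fun_prop)).mul
      (hq.comp (f := fun w : C × E D × E D => (w.2.2, w.2.1)) (by fun_prop)).ennreal_ofReal
  have m2 : Measurable fun w : C × E D × E D =>
      S.margDens s.succ w.1 w.2.1 * ENNReal.ofReal (F.ρ s w.2.2 (F.φ s (w.1, w.2.1))) :=
    ((S.measurable_margDens _).comp (g := S.margDens s.succ |> Function.uncurry)
      (f := fun w : C × E D × E D => (w.1, w.2.1)) (by fun_prop)).mul
      (hρ.comp (f := fun w : C × E D × E D => (w.2.2, F.φ s (w.1, w.2.1)))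
        (by fun_prop)).ennreal_ofReal
  refine (withDensity_eq_iff_of_sigmaFinite m1.aemeasurable m2.aemeasurable).1 ?_
  refine Measure.ext_of_lintegral _ fun f hf => ?_
  rw [lintegral_withDensity_eq_lintegral_mul _ m1 hf, lintegral_withDensity_eq_lintegral_mul _ m2 hf]
  -- both sides are the integral of `f` under the law of `(C, X_{s+1}, X_s)`
  trans ∫⁻ w, f (w.1, w.2.2, w.2.1) ∂(S.stepLaw s)
  · rw [S.lintegral_stepLaw s (by fun_prop), lintegral_prod _ (m1.mul hf).aemeasurable]
    refine lintegral_congr_ae ?_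
    filter_upwards [S.marg_eq_withDensity s.castSucc] with c hc
    have hd : Measurable (S.margDens s.castSucc c) := (S.measurable_margDens _).comp
      measurable_prodMk_left
    have m3 : Measurable fun x : E D × E D => ENNReal.ofReal (S.qDens s x.1 x.2) * f (c, x.2, x.1) :=
      hq.ennreal_ofReal.mul (by fun_prop)
    rw [hc, lintegral_withDensity_eq_lintegral_mul _ hd m3.lintegral_prod_right']
    have m5 : Measurable fun y : E D × E D => S.margDens s.castSucc c y.2 *
        ENNReal.ofReal (S.qDens s y.2 y.1) * f (c, y) := (m1.mul hf).comp measurable_prodMk_left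
    refine (lintegral_prod_symm _ m5.aemeasurable).trans ?_
    refine lintegral_congr fun x => ?_
    simp only [Pi.mul_apply, mul_assoc]
    exact lintegral_const_mul _ (m3.comp measurable_prodMk_left)
  · have h := S.condLaw_compProd_reverseKernel s
    have h2 : ∫⁻ w, f (w.1, w.2.2, w.2.1) ∂(S.stepLaw s) =
        ∫⁻ w, f (w.1.1, w.1.2, w.2) ∂(S.condLaw s ⊗ₘ S.reverseKernel s) := by
      rw [h, lintegral_map (by fun_prop) (by fun_prop)]
    have m4 : Measurable fun w : (C × E D) × E D =>
        ENNReal.ofReal (F.ρ s w.2 (F.φ s w.1)) * f (w.1.1, w.1.2, w.2) :=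
      (hρ.comp (f := fun w : (C × E D) × E D => (w.2, F.φ s w.1))
        (by fun_prop)).ennreal_ofReal.mul (by fun_prop)
    have h3 : ∫⁻ w, f (w.1.1, w.1.2, w.2) ∂(S.condLaw s ⊗ₘ S.reverseKernel s) =
        ∫⁻ p, (∫⁻ x, ENNReal.ofReal (F.ρ s x (F.φ s p)) * f (p.1, p.2, x)) ∂(S.condLaw s) := by
      rw [Measure.lintegral_compProd (by fun_prop)]
      refine lintegral_congr_ae ?_
      filter_upwards [hF.sufficient s] with p hp
      have : Measurable fun x => F.ρ s x (F.φ s p) := hρ.comp measurable_prodMk_right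
      rw [hp, target, lintegral_withDensity_eq_lintegral_mul _ (by fun_prop) (by fun_prop)]
      rfl
    rw [h2, h3, S.condLaw_eq, Measure.lintegral_compProd m4.lintegral_prod_right',
      lintegral_prod _ (m2.mul hf).aemeasurable]
    refine lintegral_congr fun c => ?_
    have hd : Measurable (S.margDens s.succ c) := (S.measurable_margDens _).comp
      measurable_prodMk_left
    have m5 : Measurable fun y : E D × E D => S.margDens s.succ c y.1 *
        ENNReal.ofReal (F.ρ s y.2 (F.φ s (c, y.1))) * f (c, y) :=
      (m2.mul hf).comp measurable_prodMk_left
    have m6 : Measurable fun x : E D =>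
        ∫⁻ y, ENNReal.ofReal (F.ρ s y (F.φ s (c, x))) * f (c, x, y) :=
      m4.lintegral_prod_right'.comp measurable_prodMk_left
    rw [S.marg_succ]
    refine (lintegral_withDensity_eq_lintegral_mul _ hd m6).trans
      (Eq.trans ?_ (lintegral_prod _ m5.aemeasurable).symm)
    refine lintegral_congr fun x => ?_
    simp only [Pi.mul_apply, mul_assoc]
    exact (lintegral_const_mul _ (m4.comp measurable_prodMk_left)).symm

end Features


/-! ### Consequences of feature sufficiency, and the stepwise loss -/

theorem le_mul_of_log_div_le {x i : ℝ≥0∞} {a : ℝ} (h : ENNReal.log (x / i) ≤ (a : EReal)) :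
    x ≤ ENNReal.ofReal (Real.exp a) * i := by
  have h1 : x / i ≤ ENNReal.ofReal (Real.exp a) := by
    rw [← EReal.exp_coe, ← ENNReal.exp_log (x / i)]
    exact EReal.exp_monotone h
  exact (ENNReal.div_le_iff_le_mul (Or.inr (by simp)) (Or.inr (by simp [Real.exp_pos]))).1 h1

namespace Features

variable {C : Type*} [MeasurableSpace C] {D T : ℕ} {F : Features C D T} {S : Diffusion C D T}

theorem featLaw_eq (F : Features C D T) (S : Diffusion C D T) (hφ : ∀ t, Measurable (F.φ t))
    (t : Fin T) : F.featLaw S t = (S.condLaw t).map (F.φ t) := by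
  have := hφ t
  rw [featLaw, law, Diffusion.condLaw, Measure.map_map (by fun_prop) (by fun_prop),
    Measure.map_map (by fun_prop) (by fun_prop)]
  rfl

theorem ae_featLaw_iff (t : Fin T) {P : E (F.d t) → Prop} (hP : MeasurableSet {z | P z}) :
    (∀ᵐ z ∂(F.featLaw S t), P z) ↔ ∀ᵐ w ∂(S.condLaw t), P (F.φ t w) := by
  rw [featLaw_eq F S F.φ_meas, ae_map_iff (F.φ_meas t).aemeasurable hP]

theorem isProbabilityMeasure_law (F : Features C D T) (S : Diffusion C D T) (t : Fin T) :
    IsProbabilityMeasure (F.law S t) := by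
  have := F.φ_meas t
  exact Measure.isProbabilityMeasure_map (by fun_prop)

theorem isProbabilityMeasure_featLaw (F : Features C D T) (S : Diffusion C D T) (t : Fin T) :
    IsProbabilityMeasure (F.featLaw S t) := by
  have := F.isProbabilityMeasure_law S t
  exact Measure.isProbabilityMeasure_map (by fun_prop)

theorem ae_stepLaw_of_ae (S : Diffusion C D T) (t : Fin T) {P : C × E D × E D → Prop}
    (hP : MeasurableSet {w | P w})
    (h : ∀ᵐ c ∂S.PC, ∀ᵐ y : E D × E D ∂(volume.prod volume), P (c, y)) :
    ∀ᵐ w ∂(S.stepLaw t), P w := by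
  rw [ae_iff, ← Set.compl_ofPred, ← lintegral_indicator_one hP.compl,
    S.lintegral_stepLaw t (measurable_one.indicator hP.compl),
    lintegral_eq_zero_of_ae_eq_zero]
  filter_upwards [h, S.marg_eq_withDensity t.castSucc] with c hc hm
  refine lintegral_eq_zero_of_ae_eq_zero ?_
  rw [hm]
  refine (withDensity_absolutelyContinuous _ _) ?_
  filter_upwards [Measure.ae_ae_of_ae_prod hc] with x hx
  refine lintegral_eq_zero_of_ae_eq_zero ?_
  filter_upwards [hx] with x' hx'
  simp [hx']

/-- The feature density is a strictly positive probability density, for almost every feature. -/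
theorem Valid.ae_featLaw {r : Fin T → ℝ} (hF : F.Valid S) (hS : S.Regular r) (t : Fin T) :
    ∀ᵐ z ∂(F.featLaw S t), z ∈ F.K t ∧ IsProbabilityMeasure (F.target t z) ∧
      ∀ᵐ y : E D, 0 < F.ρ t y z := by
  have hρ := hF.meas t
  have hφ := F.φ_meas t
  have := F.isProbabilityMeasure_featLaw S t
  refine eventually_and.2 ⟨?_, eventually_and.2 ⟨?_, ?_⟩⟩
  · exact (prob_compl_eq_zero_iff (hF.compact t).measurableSet).2 (hF.support t)
  · have h1 : ∀ z, IsProbabilityMeasure (F.target t z) ↔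
        ∫⁻ y, ENNReal.ofReal (F.ρ t y z) = 1 := by
      intro z
      rw [isProbabilityMeasure_iff, target, withDensity_apply _ MeasurableSet.univ,
        Measure.restrict_univ]
    simp only [h1]
    rw [ae_featLaw_iff]
    · filter_upwards [hF.sufficient t] with w hw
      rw [← h1, ← hw]
      infer_instance
    · refine measurableSet_eq_fun ?_ measurable_const
      exact (hρ.comp measurable_swap).ennreal_ofReal.lintegral_prod_right'
  · have hms : MeasurableSet {w : E D × E (F.d t) | 0 < F.ρ t w.1 w.2} :=
      measurableSet_lt measurable_const hρ
    have hz : MeasurableSet {z | ∀ᵐ y : E D, 0 < F.ρ t y z} :=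
      measurable_measure_prodMk_right hms.compl (measurableSet_singleton 0)
    rw [ae_featLaw_iff t hz, S.condLaw_eq]
    refine Measure.ae_compProd_of_ae_ae (hφ hz) ?_
    filter_upwards [Measure.ae_ae_of_ae_prod (hF.bayes t), S.margDens_pos hS t.castSucc]
      with c hc hpos
    rw [S.marg_succ]
    refine (withDensity_absolutelyContinuous _ _).ae_le ?_
    filter_upwards [Measure.ae_ae_of_ae_prod hc] with x' hx'
    filter_upwards [hx'] with x hx
    by_contra hcon
    have h0 : ENNReal.ofReal (F.ρ t x (F.φ t (c, x'))) = 0 := by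
      rw [ENNReal.ofReal_eq_zero]; exact not_lt.1 hcon
    rw [h0, mul_zero, mul_eq_zero] at hx
    rcases hx with hx | hx
    · exact (hpos x).ne' hx
    · rw [ENNReal.ofReal_eq_zero] at hx
      exact absurd (S.qDens_pos t x x') (not_lt.2 hx)

/-- The bound on the logarithmic variation of the forward densities over cubes bounds the reverse
density: its mass on a cube is at most one. -/
theorem Valid.density_le {r : Fin T → ℝ} (hr : ∀ t, 0 < r t) (hF : F.Valid S) (hS : S.Regular r)
    (t : Fin T) {w : E D → E D} {a : E D → ℝ} {b : E D → E D → ℝ}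
    (ha : Measurable a) (hb : Measurable (Function.uncurry b))
    (h1 : ∀ᵐ c ∂S.PC, ∀ᵐ x, ENNReal.log (S.margDens t.castSucc c x /
      ⨅ y ∈ cube (w x) (r t), S.margDens t.castSucc c y) ≤ (a x : EReal))
    (h2 : ∀ᵐ p : E D × E D, ENNReal.log (ENNReal.ofReal (S.qDens t p.1 p.2) /
      ⨅ y ∈ cube (w p.1) (r t), ENNReal.ofReal (S.qDens t y p.2)) ≤ (b p.1 p.2 : EReal)) :
    ∀ᵐ p ∂(S.stepLaw t), F.ρ t p.2.1 (F.φ t (p.1, p.2.2)) * r t ^ D ≤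
      Real.exp (a p.2.1 + b p.2.1 p.2.2) := by
  have hρ := hF.meas t
  have hφ := F.φ_meas t
  have hq := S.qDens_meas t
  refine ae_stepLaw_of_ae S t ?_ ?_
  · refine measurableSet_le (Measurable.mul_const ?_ _) (Real.measurable_exp.comp ?_)
    · exact hρ.comp (f := fun p : C × E D × E D => (p.2.1, F.φ t (p.1, p.2.2))) (by fun_prop)
    · exact (ha.comp (by fun_prop)).add
        (hb.comp (f := fun p : C × E D × E D => (p.2.1, p.2.2)) (by fun_prop))
  filter_upwards [Measure.ae_ae_of_ae_prod (hF.bayes t), S.margDens_pos hS t.succ, h1,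
    S.margDens_succ_eq t] with c hbayes hpos ha' hsucc
  have hd : Measurable (S.margDens t.castSucc c) := (S.measurable_margDens _).comp
    measurable_prodMk_left
  have hd' : Measurable (S.margDens t.succ c) := (S.measurable_margDens _).comp
    measurable_prodMk_left
  have hfin : ∀ᵐ x' : E D, S.margDens t.succ c x' < ∞ := by
    refine ae_lt_top hd' ?_
    rw [← setLIntegral_univ, ← withDensity_apply _ MeasurableSet.univ, ← S.marg_succ]
    simp
  have hbayes' : ∀ᵐ y : E D × E D ∂(volume.prod volume),
      S.margDens t.castSucc c y.1 * ENNReal.ofReal (S.qDens t y.1 y.2) =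
        S.margDens t.succ c y.2 * ENNReal.ofReal (F.ρ t y.1 (F.φ t (c, y.2))) :=
    (Measure.measurePreserving_swap (μ := (volume : Measure (E D)))
      (ν := (volume : Measure (E D)))).quasiMeasurePreserving.ae hbayes
  filter_upwards [hbayes', h2, Measure.quasiMeasurePreserving_fst.ae ha',
    Measure.quasiMeasurePreserving_snd.ae hfin] with y hy hyb hya hyfin
  obtain ⟨x, x'⟩ := y
  simp only at hy hyb hya hyfin ⊢
  have e1 := le_mul_of_log_div_le hya
  have e2 := le_mul_of_log_div_le hyb
  have key : S.margDens t.castSucc c x * ENNReal.ofReal (S.qDens t x x') *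
      ENNReal.ofReal (r t) ^ D ≤
      ENNReal.ofReal (Real.exp (a x + b x x')) * S.margDens t.succ c x' := by
    calc _ = ∫⁻ _ in cube (w x) (r t),
          S.margDens t.castSucc c x * ENNReal.ofReal (S.qDens t x x') := by
          rw [setLIntegral_const, volume_cube]
      _ ≤ ∫⁻ y in cube (w x) (r t), ENNReal.ofReal (Real.exp (a x + b x x')) *
            (S.margDens t.castSucc c y * ENNReal.ofReal (S.qDens t y x')) := by
          refine setLIntegral_mono' (measurableSet_cube _ _) fun y hy => ?_
          rw [Real.exp_add, ENNReal.ofReal_mul (Real.exp_pos _).le, mul_mul_mul_comm]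
          refine mul_le_mul' (e1.trans ?_) (e2.trans ?_)
          · gcongr; exact iInf₂_le y hy
          · gcongr; exact iInf₂_le y hy
      _ ≤ ∫⁻ y, ENNReal.ofReal (Real.exp (a x + b x x')) *
            (S.margDens t.castSucc c y * ENNReal.ofReal (S.qDens t y x')) :=
          setLIntegral_le_lintegral _ _
      _ = _ := by
          rw [hsucc, lintegral_const_mul]
          exact hd.mul (hq.comp measurable_prodMk_right).ennreal_ofReal
  rw [hy, mul_assoc, mul_comm, ENNReal.mul_le_mul_iff_left (hpos x').ne' hyfin.ne,
    ← ENNReal.ofReal_pow (hr t).le, ← ENNReal.ofReal_mul (hF.nonneg t _ _),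
    ENNReal.ofReal_le_ofReal_iff (Real.exp_pos _).le] at key
  exact key

/-- The integral of the positive part of the log-likelihood ratio of `ρ_t(y ∣ z)` and `p(y ∣ z)`,
an upper bound for the stepwise error. -/
noncomputable def logLoss (F : Features C D T) (S : Diffusion C D T) (t : Fin T)
    (p : E (F.d t) → E D → ℝ) : ℝ≥0∞ :=
  ∫⁻ w, ENNReal.ofReal (Real.log (F.ρ t w.1 w.2 / p w.2 w.1)) ∂(F.law S t)

theorem lintegral_law (F : Features C D T) (S : Diffusion C D T) (t : Fin T)
    {f : E D × E (F.d t) → ℝ≥0∞} (hf : Measurable f) :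
    ∫⁻ w, f w ∂(F.law S t) = ∫⁻ p, f (p.2.1, F.φ t (p.1, p.2.2)) ∂(S.stepLaw t) := by
  have hφ := F.φ_meas t
  rw [law, lintegral_map hf (by fun_prop)]

theorem Valid.lintegral_law_eq (hF : F.Valid S) (t : Fin T)
    {f : E D × E (F.d t) → ℝ≥0∞} (hf : Measurable f) :
    ∫⁻ w, f w ∂(F.law S t) = ∫⁻ z, ∫⁻ y, f (y, z) ∂(F.target t z) ∂(F.featLaw S t) := by
  have hρ := hF.meas t
  have hρ' : Measurable fun w : E D × E (F.d t) => F.ρ t w.1 w.2 := hρ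
  have := F.isProbabilityMeasure_featLaw S t
  rw [hF.disint t, lintegral_withDensity_eq_lintegral_mul _ (by fun_prop) hf,
    lintegral_prod_symm _ (hρ'.ennreal_ofReal.mul hf).aemeasurable]
  refine lintegral_congr fun z => ?_
  have : Measurable fun y => F.ρ t y z := hρ.comp measurable_prodMk_right
  rw [target, lintegral_withDensity_eq_lintegral_mul _ (by fun_prop) (by fun_prop)]
  rfl

theorem Valid.measurable_logRatio (hF : F.Valid S) (t : Fin T) {p : E (F.d t) → E D → ℝ}
    (hp : Measurable (Function.uncurry p)) : Measurable fun w : E D × E (F.d t) =>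
      ENNReal.ofReal (Real.log (F.ρ t w.1 w.2 / p w.2 w.1)) :=
  (((hF.meas t).div (hp.comp measurable_swap)).log).ennreal_ofReal

theorem Valid.klDiv_target_le (hF : F.Valid S) {t : Fin T} {p : E (F.d t) → E D → ℝ}
    (hp : Measurable (Function.uncurry p)) (hpos : ∀ z y, 0 < p z y)
    (hprob : ∀ z, IsProbabilityMeasure (volume.withDensity fun y => ENNReal.ofReal (p z y)))
    {z : E (F.d t)} (hz : IsProbabilityMeasure (F.target t z)) :
    klDiv (F.target t z) (volume.withDensity fun y => ENNReal.ofReal (p z y)) ≤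
      ∫⁻ y, ENNReal.ofReal (Real.log (F.ρ t y z / p z y)) ∂(F.target t z) :=
  have := hprob z
  have : IsProbabilityMeasure (volume.withDensity fun y => ENNReal.ofReal (F.ρ t y z)) := hz
  klDiv_withDensity_le volume ((hF.meas t).comp measurable_prodMk_right)
    (hp.comp measurable_prodMk_left) (hpos z)

theorem Valid.stepKL_le_logLoss {r : Fin T → ℝ} (hF : F.Valid S) (hS : S.Regular r) (t : Fin T)
    {p : E (F.d t) → E D → ℝ}
    (hp : Measurable (Function.uncurry p)) (hpos : ∀ z y, 0 < p z y)
    (hprob : ∀ z, IsProbabilityMeasure (volume.withDensity fun y => ENNReal.ofReal (p z y))) :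
    F.stepKL S t p ≤ F.logLoss S t p := by
  rw [logLoss, hF.lintegral_law_eq t (hF.measurable_logRatio t hp), stepKL]
  refine lintegral_mono_ae ?_
  filter_upwards [hF.ae_featLaw hS t] with z hz using hF.klDiv_target_le hp hpos hprob hz.2.1

theorem Valid.lintegral_klDiv_reverseKernel_le (hF : F.Valid S)
    (t : Fin T) {p : E (F.d t) → E D → ℝ}
    (hp : Measurable (Function.uncurry p)) (hpos : ∀ z y, 0 < p z y)
    (hprob : ∀ z, IsProbabilityMeasure (volume.withDensity fun y => ENNReal.ofReal (p z y))) :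
    ∫⁻ w, klDiv (S.reverseKernel t w)
        (volume.withDensity fun y => ENNReal.ofReal (p (F.φ t w) y)) ∂(S.condLaw t) ≤
      F.logLoss S t p := by
  have hφ := F.φ_meas t
  have hm := hF.measurable_logRatio t hp
  calc _ ≤ ∫⁻ w, ∫⁻ y, ENNReal.ofReal (Real.log (F.ρ t y (F.φ t w) / p (F.φ t w) y))
          ∂(S.reverseKernel t w) ∂(S.condLaw t) := by
        refine lintegral_mono_ae ?_
        filter_upwards [hF.sufficient t] with w hw
        have : IsProbabilityMeasure (F.target t (F.φ t w)) := by rw [← hw]; infer_instance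
        rw [hw]
        exact hF.klDiv_target_le hp hpos hprob this
    _ = F.logLoss S t p := by
        have hm' : Measurable fun w : (C × E D) × E D =>
            ENNReal.ofReal (Real.log (F.ρ t w.2 (F.φ t w.1) / p (F.φ t w.1) w.2)) :=
          hm.comp (f := fun w : (C × E D) × E D => (w.2, F.φ t w.1)) (by fun_prop)
        rw [← Measure.lintegral_compProd hm', S.condLaw_compProd_reverseKernel,
          lintegral_map hm' (by fun_prop), logLoss, F.lintegral_law S t hm]

end Features


/-! ### Universal approximation by ReLU networks -/

/-- The functions `x ↦ max 0 (w ⬝ x + b)` on a compact set. -/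
noncomputable def reluUnit {a : ℕ} (K : Set (E a)) (p : (Fin a → ℝ) × ℝ) : C(K, ℝ) where
  toFun x := max 0 (∑ i, p.1 i * x.1 i + p.2)
  continuous_toFun := by fun_prop

/-- The exponential is a superposition of hinge functions. -/
theorem exp_eq_integral_hinge {A B t : ℝ} (hA : A ≤ t) (hB : t ≤ B) :
    Real.exp t = Real.exp A + Real.exp A * (t - A) +
      ∫ s in A..B, Real.exp s * max 0 (t - s) := by
  have h1 : ∫ s in A..B, Real.exp s * max 0 (t - s) = ∫ s in A..t, Real.exp s * (t - s) := by
    rw [← intervalIntegral.integral_add_adjacent_intervals (b := t)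
      (Continuous.intervalIntegrable (by fun_prop) _ _)
      (Continuous.intervalIntegrable (by fun_prop) _ _)]
    have h2 : ∫ s in t..B, Real.exp s * max 0 (t - s) = 0 := by
      refine intervalIntegral.integral_zero_ae (ae_of_all _ fun s hs => ?_)
      rw [Set.uIoc_of_le hB] at hs
      rw [max_eq_left (by linarith [hs.1]), mul_zero]
    rw [h2, add_zero]
    refine intervalIntegral.integral_congr fun s hs => ?_
    rw [Set.uIcc_of_le hA] at hs
    rw [max_eq_right (by linarith [hs.2])]
  have h3 : ∫ s in A..t, Real.exp s * (t - s) =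
      Real.exp t * (t - t + 1) - Real.exp A * (t - A + 1) := by
    refine intervalIntegral.integral_eq_sub_of_hasDerivAt
      (f := fun s => Real.exp s * (t - s + 1)) (fun s _ => ?_)
      (Continuous.intervalIntegrable (by fun_prop) _ _)
    have := (Real.hasDerivAt_exp s).mul (((hasDerivAt_id s).const_sub t).add_const 1)
    convert! this using 1
    simp; ring
  rw [h1, h3]; ring

/-- The closed linear span of the ReLU units on `K`. -/
noncomputable def reluSpan {a : ℕ} (K : Set (E a)) [CompactSpace K] : Submodule ℝ C(K, ℝ) :=
  (Submodule.span ℝ (Set.range (reluUnit K))).topologicalClosure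

theorem reluUnit_mem {a : ℕ} (K : Set (E a)) [CompactSpace K] (p : (Fin a → ℝ) × ℝ) :
    reluUnit K p ∈ reluSpan K :=
  Submodule.le_topologicalClosure _ (Submodule.subset_span ⟨p, rfl⟩)

/-- The exponential of a linear form on `K`. -/
noncomputable def expLin {a : ℕ} (K : Set (E a)) (w : Fin a → ℝ) : C(K, ℝ) where
  toFun x := Real.exp (∑ i, w i * x.1 i)
  continuous_toFun := by fun_prop

theorem expLin_mem {a : ℕ} (K : Set (E a)) [CompactSpace K] (w : Fin a → ℝ) :
    expLin K w ∈ reluSpan K := by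
  have hb : ∃ R : ℝ, 0 < R ∧ ∀ x : K, |∑ i, w i * x.1 i| ≤ R := by
    have hc : Continuous fun x : K => |∑ i, w i * x.1 i| := by fun_prop
    obtain ⟨R, hR⟩ := (isCompact_range hc).bddAbove
    exact ⟨max R 1, by positivity, fun x => (hR ⟨x, rfl⟩).trans (le_max_left _ _)⟩
  obtain ⟨R, hR0, hR⟩ := hb
  -- the hinge functions depend continuously on the threshold `s`
  have hcont : Continuous fun s : ℝ => Real.exp s • reluUnit K (w, -s) := by
    refine ContinuousMap.continuous_of_continuous_uncurry _ ?_
    change Continuous fun q : ℝ × K => Real.exp q.1 * max 0 (∑ i, w i * q.2.1 i + -q.1)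
    fun_prop
  have hint : IntervalIntegrable (fun s : ℝ => Real.exp s • reluUnit K (w, -s)) volume (-R) R :=
    hcont.intervalIntegrable _ _
  have hI : ∫ s in (-R)..R, Real.exp s • reluUnit K (w, -s) ∈ reluSpan K := by
    have hcl : IsClosed (reluSpan K : Set C(K, ℝ)) := Submodule.isClosed_topologicalClosure _
    have hav := (reluSpan K).convex.set_average_mem hcl (μ := volume) (t := Set.Ioc (-R) R)
      (f := fun s : ℝ => Real.exp s • reluUnit K (w, -s)) (by simp; linarith) (by simp)
      (ae_of_all _ fun s => Submodule.smul_mem _ _ (reluUnit_mem K _)) hint.1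
    rw [setAverage_eq] at hav
    have := (reluSpan K).smul_mem (volume.real (Set.Ioc (-R) R)) hav
    rwa [smul_inv_smul₀, ← intervalIntegral.integral_of_le (by linarith)] at this
    simp; linarith
  have heq : expLin K w = Real.exp (-R) • reluUnit K (0, 1) +
      Real.exp (-R) • (reluUnit K (w, R) - reluUnit K (-w, -R)) +
      ∫ s in (-R)..R, Real.exp s • reluUnit K (w, -s) := by
    ext x
    have h1 := abs_le.1 (hR x)
    have h2 := exp_eq_integral_hinge h1.1 h1.2
    have h3 : (∫ s in (-R)..R, Real.exp s • reluUnit K (w, -s)) x =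
        ∫ s in (-R)..R, Real.exp s * max 0 (∑ i, w i * x.1 i - s) := by
      have := ContinuousLinearMap.intervalIntegral_comp_comm (ContinuousMap.evalCLM ℝ x) hint
      simp only [ContinuousMap.evalCLM_apply] at this
      rw [← this]
      simp [reluUnit, sub_eq_add_neg]
    rw [ContinuousMap.add_apply, h3]
    change Real.exp _ = _
    rw [h2]
    simp only [reluUnit, ContinuousMap.add_apply, ContinuousMap.smul_apply,
      ContinuousMap.sub_apply, ContinuousMap.coe_mk, smul_eq_mul, Pi.zero_apply, Pi.neg_apply,
      zero_mul, neg_mul, Finset.sum_const_zero, Finset.sum_neg_distrib]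
    have e1 : max 0 (∑ i, w i * x.1 i + R) = ∑ i, w i * x.1 i + R := max_eq_right (by linarith)
    have e2 : max 0 (-∑ i, w i * x.1 i + -R) = 0 := max_eq_left (by linarith)
    rw [e1, e2]
    norm_num
  rw [heq]
  exact add_mem (add_mem (Submodule.smul_mem _ _ (reluUnit_mem K _))
    (Submodule.smul_mem _ _ (sub_mem (reluUnit_mem K _) (reluUnit_mem K _)))) hI

theorem reluSpan_eq_top {a : ℕ} (K : Set (E a)) [CompactSpace K] : reluSpan K = ⊤ := by
  have hone : (1 : C(K, ℝ)) = expLin K 0 := by ext x; simp [expLin]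
  have hmul : ∀ w w', expLin K w * expLin K w' = expLin K (w + w') := by
    intro w w'
    ext x
    simp [expLin, ← Real.exp_add, add_mul, Finset.sum_add_distrib]
  let V := Submodule.span ℝ (Set.range (expLin K))
  have hV : V ≤ reluSpan K := by
    refine Submodule.span_le.2 ?_
    rintro _ ⟨w, rfl⟩
    exact expLin_mem K w
  let A : Subalgebra ℝ C(K, ℝ) := V.toSubalgebra
    (Submodule.subset_span ⟨0, hone.symm⟩) (by
      intro x y hx hy
      have : V * V ≤ V := by
        rw [Submodule.span_mul_span]
        refine Submodule.span_mono ?_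
        rintro _ ⟨_, ⟨w, rfl⟩, _, ⟨w', rfl⟩, rfl⟩
        exact ⟨w + w', (hmul w w').symm⟩
      exact this (Submodule.mul_mem_mul hx hy))
  have hsep : A.SeparatesPoints := by
    intro x y hxy
    obtain ⟨i, hi⟩ : ∃ i, x.1 i ≠ y.1 i := by
      by_contra hcon
      push Not at hcon
      exact hxy (Subtype.ext (PiLp.ext hcon))
    refine ⟨_, ⟨expLin K (Pi.single i 1), Submodule.subset_span ⟨_, rfl⟩, rfl⟩, ?_⟩
    simpa [expLin, Pi.single_apply] using hi
  have htop := ContinuousMap.subalgebra_topologicalClosure_eq_top_of_separatesPoints A hsep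
  rw [eq_top_iff]
  intro f _
  have hf : f ∈ A.topologicalClosure := by rw [htop]; trivial
  have hsub : (A : Set C(K, ℝ)) ⊆ reluSpan K := hV
  exact closure_minimal hsub (Submodule.isClosed_topologicalClosure _) hf

/-- Uniform approximation of continuous functions on a compact set by networks with one hidden
layer. -/
theorem exists_reluNet_approx {a b : ℕ} {K : Set (E a)} (hK : IsCompact K) (g : E a → Fin b → ℝ)
    (hg : ∀ j, ContinuousOn (fun x => g x j) K) {ε : ℝ} (hε : 0 < ε) :
    ∃ N : ReLUNet a b, ∀ x ∈ K, ∀ j, |N.eval x j - g x j| ≤ ε := by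
  have : CompactSpace K := isCompact_iff_compactSpace.1 hK
  have h1 : ∀ j, ∃ (n : ℕ) (c : Fin n → ℝ) (p : Fin n → (Fin a → ℝ) × ℝ),
      ∀ x ∈ K, |∑ i, c i * max 0 (∑ k, (p i).1 k * x k + (p i).2) - g x j| ≤ ε := by
    intro j
    let G : C(K, ℝ) := ⟨fun x => g x.1 j, (hg j).domRestrict⟩
    have hG : G ∈ closure (Submodule.span ℝ (Set.range (reluUnit K)) : Set C(K, ℝ)) := by
      have : G ∈ reluSpan K := by rw [reluSpan_eq_top]; trivial
      exact this
    obtain ⟨f, hf, hfG⟩ := Metric.mem_closure_iff.1 hG ε hε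
    obtain ⟨n, c, p, rfl⟩ := Submodule.mem_span_set'.1 hf
    choose q hq using fun i => (p i).2
    refine ⟨n, c, q, fun x hx => ?_⟩
    have h2 := (ContinuousMap.dist_apply_le_dist (f := G) (g := ∑ i, c i • (p i : C(K, ℝ)))
      ⟨x, hx⟩).trans hfG.le
    rw [dist_comm, Real.dist_eq] at h2
    have hGx : G ⟨x, hx⟩ = g x j := rfl
    rw [hGx] at h2
    simpa [← hq, reluUnit] using h2
  choose n c p h using h1
  let e := Fintype.equivFin (Σ j, Fin (n j))
  obtain ⟨P, hP⟩ : ∃ P : (Σ j, Fin (n j)) → (Fin a → ℝ) × ℝ, ∀ j i, P ⟨j, i⟩ = p j i :=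
    ⟨fun s => p s.1 s.2, fun _ _ => rfl⟩
  obtain ⟨Q, hQ⟩ : ∃ Q : (Σ j, Fin (n j)) → ℝ, ∀ j i, Q ⟨j, i⟩ = c j i :=
    ⟨fun s => c s.1 s.2, fun _ _ => rfl⟩
  let W : Matrix (Fin (Fintype.card (Σ j, Fin (n j)))) (Fin a) ℝ := fun i => (P (e.symm i)).1
  let v : Fin (Fintype.card (Σ j, Fin (n j))) → ℝ := fun i => (P (e.symm i)).2
  let W' : Matrix (Fin b) (Fin (Fintype.card (Σ j, Fin (n j)))) ℝ :=
    fun j i => if (e.symm i).1 = j then Q (e.symm i) else 0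
  refine ⟨.hidden W v (.output W' 0), fun x hx j => ?_⟩
  have heval : (ReLUNet.hidden W v (.output W' 0)).eval x j =
      ∑ i, c j i * max 0 (∑ k, (p j i).1 k * x k + (p j i).2) := by
    simp only [ReLUNet.eval, Matrix.mulVec, dotProduct, Pi.add_apply, Pi.zero_apply, add_zero,
      W, v, W']
    rw [← e.sum_comp]
    simp only [Equiv.symm_apply_apply]
    rw [Fintype.sum_sigma, Finset.sum_eq_single j]
    · simp [hP, hQ]
    · intro j' _ hj'
      simp [hj']
    · simp
  rw [heval]
  exact h j x hx

theorem ReLUNet.continuous_eval : ∀ {a b : ℕ} (N : ReLUNet a b), Continuous N.eval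
  | _, _, .output W v => by
    have h : (ReLUNet.output W v).eval = fun x => W.mulVec x + v := by
      ext x : 1; rw [ReLUNet.eval]
    rw [h]
    fun_prop
  | _, _, .hidden W v N => by
    have h : (ReLUNet.hidden W v N).eval =
        N.eval ∘ fun x i => max 0 ((W.mulVec x + v) i) := by
      ext x : 1; rw [ReLUNet.eval]; rfl
    rw [h]
    exact N.continuous_eval.comp (by fun_prop)


/-! ### Gaussian densities and softmax mixtures -/

section Gaussian

variable {D : ℕ}

theorem gaussDens_pos (μ : E D) {σ : ℝ} (hσ : 0 < σ) (y : E D) : 0 < gaussDens μ σ y := by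
  unfold gaussDens; positivity

theorem continuous_gaussDens (μ : E D) (σ : ℝ) : Continuous (gaussDens μ σ) := by
  unfold gaussDens; fun_prop

theorem gaussDens_le (μ : E D) (σ : ℝ) (y : E D) :
    gaussDens μ σ y ≤ (2 * Real.pi * σ ^ 2) ^ (-(D : ℝ) / 2) := by
  unfold gaussDens
  refine mul_le_of_le_one_right (by positivity) (Real.exp_le_one_iff.2 ?_)
  have : 0 ≤ ‖y - μ‖ ^ 2 / (2 * σ ^ 2) := by positivity
  rw [neg_div]; linarith

theorem integral_exp_neg_sq {b : ℝ} (hb : 0 < b) (μ : E D) :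
    ∫ y : E D, Real.exp (-b * ‖y - μ‖ ^ 2) = (Real.pi / b) ^ ((D : ℝ) / 2) := by
  rw [integral_sub_right_eq_self (fun y : E D => Real.exp (-b * ‖y‖ ^ 2)) μ,
    GaussianFourier.integral_rexp_neg_mul_sq_norm hb, finrank_euclideanSpace_fin]

theorem integrable_exp_neg_sq {b : ℝ} (hb : 0 < b) (μ : E D) :
    Integrable fun y : E D => Real.exp (-b * ‖y - μ‖ ^ 2) := by
  by_contra h
  have := integral_exp_neg_sq hb μ
  rw [integral_undef h] at this
  exact absurd this (by positivity)

theorem gaussDens_eq (μ : E D) (σ : ℝ) (y : E D) : gaussDens μ σ y =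
    (2 * Real.pi * σ ^ 2) ^ (-(D : ℝ) / 2) * Real.exp (-(1 / (2 * σ ^ 2)) * ‖y - μ‖ ^ 2) := by
  unfold gaussDens
  congr 2; ring

theorem integrable_gaussDens (μ : E D) {σ : ℝ} (hσ : 0 < σ) : Integrable (gaussDens μ σ) := by
  have := (integrable_exp_neg_sq (b := 1 / (2 * σ ^ 2)) (by positivity) μ).const_mul
    ((2 * Real.pi * σ ^ 2) ^ (-(D : ℝ) / 2))
  refine this.congr (ae_of_all _ fun y => (gaussDens_eq μ σ y).symm)

theorem integral_gaussDens (μ : E D) {σ : ℝ} (hσ : 0 < σ) : ∫ y, gaussDens μ σ y = 1 := by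
  simp only [gaussDens_eq]
  rw [integral_const_mul, integral_exp_neg_sq (by positivity)]
  have : Real.pi / (1 / (2 * σ ^ 2)) = 2 * Real.pi * σ ^ 2 := by field_simp
  rw [this, neg_div, Real.rpow_neg (by positivity)]
  exact inv_mul_cancel₀ (by positivity)

/-- Gaussian concentration on a cube. -/
theorem integral_cube_gaussDens_ge (y : E D) {σ τ : ℝ} (hσ : 0 < σ) (hτ : 0 < τ) :
    1 - 2 ^ ((D : ℝ) / 2) * Real.exp (-τ ^ 2 / (4 * σ ^ 2)) ≤
      ∫ u in cube y (2 * τ), gaussDens y σ u := by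
  have hint := integrable_gaussDens y hσ
  have hadd := integral_add_compl (measurableSet_cube y (2 * τ)) hint
  rw [integral_gaussDens y hσ] at hadd
  have hI := integrable_exp_neg_sq (b := 1 / (4 * σ ^ 2)) (by positivity) y
  have hle : ∫ u in (cube y (2 * τ))ᶜ, gaussDens y σ u ≤
      2 ^ ((D : ℝ) / 2) * Real.exp (-τ ^ 2 / (4 * σ ^ 2)) := by
    calc ∫ u in (cube y (2 * τ))ᶜ, gaussDens y σ u
        ≤ ∫ u in (cube y (2 * τ))ᶜ, (2 * Real.pi * σ ^ 2) ^ (-(D : ℝ) / 2) *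
            Real.exp (-τ ^ 2 / (4 * σ ^ 2)) * Real.exp (-(1 / (4 * σ ^ 2)) * ‖u - y‖ ^ 2) := by
          refine setIntegral_mono_on hint.integrableOn (hI.const_mul _).integrableOn
            (measurableSet_cube _ _).compl fun u hu => ?_
          rw [gaussDens_eq, mul_assoc ((2 * Real.pi * σ ^ 2) ^ (-(D : ℝ) / 2)), ← Real.exp_add]
          refine mul_le_mul_of_nonneg_left (Real.exp_le_exp.2 ?_) (by positivity)
          have hu' : ∃ i, τ < |u i - y i| := by
            by_contra hcon
            push Not at hcon
            exact hu fun i => by linarith [hcon i]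
          obtain ⟨i, hi⟩ := hu'
          have h1 : |u i - y i| ≤ ‖u - y‖ := by
            simpa using PiLp.norm_apply_le (u - y) i
          have h2 : τ ^ 2 ≤ ‖u - y‖ ^ 2 := by gcongr; linarith
          have h3 : -τ ^ 2 / (4 * σ ^ 2) + -(1 / (4 * σ ^ 2)) * ‖u - y‖ ^ 2
              - -(1 / (2 * σ ^ 2)) * ‖u - y‖ ^ 2 = (‖u - y‖ ^ 2 - τ ^ 2) / (4 * σ ^ 2) := by
            field_simp; ring
          have h4 : 0 ≤ (‖u - y‖ ^ 2 - τ ^ 2) / (4 * σ ^ 2) := by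
            apply div_nonneg <;> [linarith; positivity]
          linarith
      _ ≤ ∫ u, (2 * Real.pi * σ ^ 2) ^ (-(D : ℝ) / 2) *
            Real.exp (-τ ^ 2 / (4 * σ ^ 2)) * Real.exp (-(1 / (4 * σ ^ 2)) * ‖u - y‖ ^ 2) :=
          setIntegral_le_integral (hI.const_mul _) (ae_of_all _ fun u => by positivity)
      _ = _ := by
          rw [integral_const_mul, integral_exp_neg_sq (by positivity)]
          have : Real.pi / (1 / (4 * σ ^ 2)) = 2 * (2 * Real.pi * σ ^ 2) := by field_simp; ring
          rw [this, Real.mul_rpow (x := 2) (y := 2 * Real.pi * σ ^ 2) (by positivity) (by positivity),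
            neg_div, Real.rpow_neg (x := 2 * Real.pi * σ ^ 2) (by positivity)]
          have : (2 * Real.pi * σ ^ 2) ^ ((D : ℝ) / 2) ≠ 0 := by positivity
          have h : ∀ a b c : ℝ, a ≠ 0 → a⁻¹ * c * (b * a) = b * c := by
            intro a b c ha; field_simp
          exact h _ _ _ this
  linarith

end Gaussian

section Softmax

variable {m : ℕ}

theorem softDenom_pos (u : Fin m → ℝ) : 0 < 1 + ∑ k, Real.exp (u k) := by positivity

theorem softWeight_pos (u : Fin m → ℝ) (j : Fin m) : 0 < softWeight u j :=
  div_pos (Real.exp_pos _) (softDenom_pos u)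

theorem softBase_pos (u : Fin m → ℝ) : 0 < softBase u := div_pos one_pos (softDenom_pos u)

theorem sum_softWeight_add_softBase (u : Fin m → ℝ) :
    ∑ j, softWeight u j + softBase u = 1 := by
  have := (softDenom_pos u).ne'
  simp only [softWeight, softBase, ← Finset.sum_div]
  field_simp
  ring

/-- Softmax inverts log-odds. -/
theorem softmax_log_div {w : Fin m → ℝ} {w₀ : ℝ} (hw : ∀ j, 0 < w j) (h0 : 0 < w₀)
    (hsum : ∑ j, w j + w₀ = 1) :
    (∀ j, softWeight (fun j => Real.log (w j / w₀)) j = w j) ∧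
      softBase (fun j => Real.log (w j / w₀)) = w₀ := by
  have h1 : ∀ j, Real.exp (Real.log (w j / w₀)) = w j / w₀ := fun j =>
    Real.exp_log (div_pos (hw j) h0)
  have h2 : 1 + ∑ k, w k / w₀ = 1 / w₀ := by
    rw [← Finset.sum_div, eq_sub_of_add_eq hsum]; field_simp; ring
  refine ⟨fun j => ?_, ?_⟩
  · simp only [softWeight, h1, h2]; field_simp
  · simp only [softBase, h1, h2]; field_simp

theorem softDenom_le {u v : Fin m → ℝ} {ε : ℝ} (hε : 0 ≤ ε) (h : ∀ j, |v j - u j| ≤ ε) :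
    1 + ∑ k, Real.exp (v k) ≤ Real.exp ε * (1 + ∑ k, Real.exp (u k)) := by
  rw [mul_add, Finset.mul_sum]
  refine add_le_add (by simpa using hε) (Finset.sum_le_sum fun k _ => ?_)
  rw [← Real.exp_add]
  exact Real.exp_le_exp.2 (by linarith [(abs_le.1 (h k)).2])

theorem softWeight_ge {u v : Fin m → ℝ} {ε : ℝ} (hε : 0 ≤ ε) (h : ∀ j, |v j - u j| ≤ ε)
    (j : Fin m) : Real.exp (-(2 * ε)) * softWeight u j ≤ softWeight v j := by
  have h1 := softDenom_le hε h
  have h2 : Real.exp (u j) ≤ Real.exp ε * Real.exp (v j) := by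
    rw [← Real.exp_add]
    exact Real.exp_le_exp.2 (by linarith [(abs_le.1 (h j)).1])
  unfold softWeight
  rw [← mul_div_assoc, div_le_div_iff₀ (softDenom_pos u) (softDenom_pos v)]
  have h3 : Real.exp (-(2 * ε)) * Real.exp ε * Real.exp ε = 1 := by
    rw [← Real.exp_add, ← Real.exp_add]; simp; ring
  calc Real.exp (-(2 * ε)) * Real.exp (u j) * (1 + ∑ k, Real.exp (v k))
      ≤ Real.exp (-(2 * ε)) * (Real.exp ε * Real.exp (v j)) *
          (Real.exp ε * (1 + ∑ k, Real.exp (u k))) := by gcongr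
    _ = (Real.exp (-(2 * ε)) * Real.exp ε * Real.exp ε) *
          (Real.exp (v j) * (1 + ∑ k, Real.exp (u k))) := by ring
    _ = _ := by rw [h3, one_mul]

theorem softBase_ge {u v : Fin m → ℝ} {ε : ℝ} (hε : 0 ≤ ε) (h : ∀ j, |v j - u j| ≤ ε) :
    Real.exp (-(2 * ε)) * softBase u ≤ softBase v := by
  have h1 := softDenom_le hε h
  unfold softBase
  rw [← mul_div_assoc, div_le_div_iff₀ (softDenom_pos u) (softDenom_pos v), mul_one, one_mul]
  calc Real.exp (-(2 * ε)) * (1 + ∑ k, Real.exp (v k))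
      ≤ Real.exp (-ε) * (Real.exp ε * (1 + ∑ k, Real.exp (u k))) := by
        gcongr; linarith
    _ = _ := by rw [← mul_assoc, ← Real.exp_add]; simp

end Softmax

namespace CellPartition

variable {D : ℕ} {r : ℝ} (A : CellPartition D r) {m : ℕ}

theorem mixDens_pos (u : Fin m → ℝ) (y : E D) : 0 < A.mixDens u y := by
  unfold mixDens
  refine add_pos_of_nonneg_of_pos (Finset.sum_nonneg fun j _ => ?_) ?_
  · exact (mul_pos (softWeight_pos u j) (gaussDens_pos _ (A.σ_pos m) _)).le
  · exact mul_pos (softBase_pos u) (gaussDens_pos _ A.σ0_pos _)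

theorem measurable_mixDens {Z : Type*} [MeasurableSpace Z] {u : Z → Fin m → ℝ}
    (hu : Measurable u) : Measurable fun p : Z × E D => A.mixDens (u p.1) p.2 := by
  have h1 : ∀ (μ : E D) (σ : ℝ), Measurable fun p : Z × E D => gaussDens μ σ p.2 :=
    fun μ σ => (continuous_gaussDens μ σ).measurable.comp measurable_snd
  have h2 : ∀ j, Measurable fun p : Z × E D => u p.1 j := fun j => by fun_prop
  unfold mixDens softWeight softBase
  refine Measurable.add (Finset.measurable_sum _ fun j _ => Measurable.mul ?_ (h1 _ _))
    (Measurable.mul ?_ (h1 _ _))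
  · exact (h2 j).exp.div (measurable_const.add (Finset.measurable_sum _ fun k _ => (h2 k).exp))
  · exact measurable_const.div
      (measurable_const.add (Finset.measurable_sum _ fun k _ => (h2 k).exp))

theorem integrable_mixDens (u : Fin m → ℝ) : Integrable (A.mixDens u) := by
  unfold mixDens
  exact (integrable_finsetSum _ fun j _ => (integrable_gaussDens _ (A.σ_pos m)).const_mul _).add
    ((integrable_gaussDens _ A.σ0_pos).const_mul _)

theorem integral_mixDens (u : Fin m → ℝ) : ∫ y, A.mixDens u y = 1 := by
  unfold mixDens
  rw [integral_add (integrable_finsetSum _ fun j _ =>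
      (integrable_gaussDens _ (A.σ_pos m)).const_mul _)
    ((integrable_gaussDens _ A.σ0_pos).const_mul _),
    integral_finsetSum _ fun j _ => (integrable_gaussDens _ (A.σ_pos m)).const_mul _]
  simp only [integral_const_mul, integral_gaussDens _ (A.σ_pos m), integral_gaussDens _ A.σ0_pos,
    mul_one]
  exact sum_softWeight_add_softBase u

theorem isProbabilityMeasure_mixDens (u : Fin m → ℝ) :
    IsProbabilityMeasure (volume.withDensity fun y => ENNReal.ofReal (A.mixDens u y)) := by
  refine ⟨?_⟩
  rw [withDensity_apply _ MeasurableSet.univ, Measure.restrict_univ,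
    ← ofReal_integral_eq_lintegral_ofReal (A.integrable_mixDens u)
      (ae_of_all _ fun y => (A.mixDens_pos u y).le), A.integral_mixDens, ENNReal.ofReal_one]

/-- The logarithm of the mixture density is Lipschitz in the logits. -/
theorem mixDens_ge {u v : Fin m → ℝ} {ε : ℝ} (hε : 0 ≤ ε) (h : ∀ j, |v j - u j| ≤ ε) (y : E D) :
    Real.exp (-(2 * ε)) * A.mixDens u y ≤ A.mixDens v y := by
  unfold mixDens
  rw [mul_add, Finset.mul_sum, ← mul_assoc]
  refine add_le_add (Finset.sum_le_sum fun j _ => ?_) ?_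
  · rw [← mul_assoc]
    exact mul_le_mul_of_nonneg_right (softWeight_ge hε h j) (gaussDens_pos _ (A.σ_pos m) _).le
  · exact mul_le_mul_of_nonneg_right (softBase_ge hε h) (gaussDens_pos _ A.σ0_pos _).le

theorem measurableSet_cellAt (j : Fin m) : MeasurableSet (A.cellAt m j) := by
  have : A.cellAt m j = ⋂ i, ({y : E D | A.center m j i - A.h m / 2 ≤ y i} ∩
      {y : E D | y i < A.center m j i + A.h m / 2}) := by ext; simp [cellAt, cell]
  rw [this]
  exact MeasurableSet.iInter fun i => (measurableSet_le (by fun_prop) (by fun_prop)).inter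
    (measurableSet_lt (by fun_prop) (by fun_prop))

theorem measurableSet_rest : MeasurableSet (A.rest m) :=
  (MeasurableSet.iUnion fun j => A.measurableSet_cellAt j).compl

theorem pairwise_disjoint_cellAt : Pairwise fun j k => Disjoint (A.cellAt m j) (A.cellAt m k) :=
  A.disjoint m

theorem sum_integral_cellAt_add_rest {f : E D → ℝ} (hf : Integrable f) :
    ∑ j, (∫ y in A.cellAt m j, f y) + ∫ y in A.rest m, f y = ∫ y, f y := by
  rw [rest, ← integral_add_compl (MeasurableSet.iUnion fun j => A.measurableSet_cellAt (m := m) j)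
    hf, integral_iUnion_fintype (fun j => A.measurableSet_cellAt j) A.pairwise_disjoint_cellAt
    fun j => hf.integrableOn]

/-- Replacing the centre of a cell by a point of the cell changes the Gaussian density at a point
within sup-distance `τ` by a bounded factor. -/
theorem gaussDens_center_ge {j : Fin m} {u y : E D} {τ : ℝ} (hu : u ∈ A.cellAt m j)
    (huy : u ∈ cube y (2 * τ)) :
    Real.exp (-(D * (τ * A.h m + A.h m ^ 2 / 4) / (2 * A.σ m ^ 2))) * gaussDens y (A.σ m) u ≤
      gaussDens (A.center m j) (A.σ m) y := by
  have hh := A.h_pos m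
  have hσ := A.σ_pos m
  unfold gaussDens
  rw [mul_left_comm, ← Real.exp_add]
  refine mul_le_mul_of_nonneg_left (Real.exp_le_exp.2 ?_) (by positivity)
  rw [← neg_div, ← add_div]
  refine div_le_div_of_nonneg_right ?_ (by positivity)
  rw [EuclideanSpace.norm_sq_eq, EuclideanSpace.norm_sq_eq]
  have key : ∑ i, ‖(y - A.center m j) i‖ ^ 2 ≤
      ∑ i, (‖(u - y) i‖ ^ 2 + (τ * A.h m + A.h m ^ 2 / 4)) := by
    refine Finset.sum_le_sum fun i _ => ?_
    simp only [PiLp.sub_apply, Real.norm_eq_abs, sq_abs]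
    have h1 := hu i
    have h2 := huy i
    have h3 : |u i - A.center m j i| ≤ A.h m / 2 := abs_le.2 ⟨by linarith [h1.1], by linarith [h1.2]⟩
    have h4 : |u i - y i| ≤ τ := by linarith
    have h5 : |(u i - y i) * (u i - A.center m j i)| ≤ τ * (A.h m / 2) := by
      rw [abs_mul]; gcongr; exact (abs_nonneg _).trans h4
    have h6 : (u i - A.center m j i) ^ 2 ≤ (A.h m / 2) ^ 2 := sq_le_sq' (by linarith [abs_le.1 h3])
      (abs_le.1 h3).2
    nlinarith [(abs_le.1 h5).1]
  rw [Finset.sum_add_distrib] at key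
  simp only [Finset.sum_const, Finset.card_univ, Fintype.card_fin, nsmul_eq_mul] at key
  linarith

/-- The mixture with the cell masses of `f` as weights dominates, up to a discretisation factor,
the Gaussian smoothing of `f` restricted to a cube. -/
theorem sum_mul_gaussDens_ge {f : E D → ℝ} (hf : Integrable f) (hf0 : ∀ y, 0 ≤ f y) (y : E D)
    (τ : ℝ) :
    Real.exp (-(D * (τ * A.h m + A.h m ^ 2 / 4) / (2 * A.σ m ^ 2))) *
        ∫ u in (A.rest m)ᶜ ∩ cube y (2 * τ), gaussDens y (A.σ m) u * f u ≤
      ∑ j, (∫ u in A.cellAt m j, f u) * gaussDens (A.center m j) (A.σ m) y := by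
  have hg : Integrable fun u => gaussDens y (A.σ m) u * f u := by
    refine hf.bdd_mul (continuous_gaussDens _ _).aestronglyMeasurable
      (c := (2 * Real.pi * A.σ m ^ 2) ^ (-(D : ℝ) / 2)) (ae_of_all _ fun u => ?_)
    rw [Real.norm_eq_abs, abs_of_pos (gaussDens_pos _ (A.σ_pos m) _)]
    exact gaussDens_le _ _ _
  have hU : (A.rest m)ᶜ ∩ cube y (2 * τ) = ⋃ j, A.cellAt m j ∩ cube y (2 * τ) := by
    rw [rest, compl_compl, Set.iUnion_inter]
  rw [hU, integral_iUnion_fintype (fun j => (A.measurableSet_cellAt j).inter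
    (measurableSet_cube _ _)) (fun j k hjk => (A.pairwise_disjoint_cellAt hjk).mono
    Set.inter_subset_left Set.inter_subset_left) fun j => hg.integrableOn, Finset.mul_sum]
  refine Finset.sum_le_sum fun j _ => ?_
  rw [← integral_const_mul, ← integral_mul_const]
  calc _ ≤ ∫ u in A.cellAt m j ∩ cube y (2 * τ), f u * gaussDens (A.center m j) (A.σ m) y := by
        refine setIntegral_mono_on (hg.const_mul _).integrableOn (hf.mul_const _).integrableOn
          ((A.measurableSet_cellAt j).inter (measurableSet_cube _ _)) fun u hu => ?_
        rw [← mul_assoc, mul_comm (f u)]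
        exact mul_le_mul_of_nonneg_right (A.gaussDens_center_ge hu.1 hu.2) (hf0 u)
    _ ≤ _ := by
        refine setIntegral_mono_set (hf.mul_const _).integrableOn (ae_of_all _ fun u => ?_)
          (LE.le.eventuallyLE Set.inter_subset_left)
        exact mul_nonneg (hf0 u) (gaussDens_pos _ (A.σ_pos m) _).le

end CellPartition


/-! ### Pointwise approximation by mixtures -/

theorem norm_sub_le_of_mem_cube {D : ℕ} {u y : E D} {τ : ℝ} (hτ : 0 ≤ τ) (h : u ∈ cube y (2 * τ)) :
    ‖u - y‖ ≤ Real.sqrt D * τ := by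
  rw [EuclideanSpace.norm_eq, ← Real.sqrt_sq hτ, ← Real.sqrt_mul (Nat.cast_nonneg _)]
  refine Real.sqrt_le_sqrt ?_
  calc ∑ i, ‖(u - y) i‖ ^ 2 ≤ ∑ _i : Fin D, τ ^ 2 := by
        refine Finset.sum_le_sum fun i _ => ?_
        have := h i
        rw [PiLp.sub_apply, Real.norm_eq_abs]
        gcongr; linarith
    _ = D * τ ^ 2 := by simp

namespace CellPartition

variable {D : ℕ} {r : ℝ} (A : CellPartition D r)

theorem tendsto_h_div_σ (hD : 1 ≤ D) : Tendsto (fun m => A.h m / A.σ m) atTop (𝓝 0) := by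
  obtain ⟨D, rfl⟩ : ∃ D', D = D' + 1 := ⟨D - 1, by omega⟩
  have := A.δ_h_σ.mul (A.σ_δ.pow D)
  rw [zero_mul] at this
  refine this.congr fun m => ?_
  have h1 := (A.σ_pos m).ne'
  have h2 := (A.δ_pos m).ne'
  simp only [Nat.add_sub_cancel]
  rw [div_pow]
  field_simp
  ring

theorem tendsto_σ : Tendsto A.σ atTop (𝓝 0) := by
  have := A.σ_δ.mul A.δ_lim
  rw [zero_mul] at this
  refine this.congr fun m => ?_
  have h2 := (A.δ_pos m).ne'
  field_simp

/-- At almost every point (every Lebesgue point) the cell mixture eventually exceeds any fraction of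
the density. -/
theorem ae_eventually_smoothing_ge (hD : 1 ≤ D) {f : E D → ℝ} (hf : Integrable f)
    (hf0 : ∀ y, 0 ≤ f y) {η : ℝ} (hη : 0 < η) (hη1 : η < 1) :
    ∀ᵐ y, ∀ᶠ m in atTop, (1 - η) * f y ≤
      ∑ j, (∫ u in A.cellAt m j, f u) * gaussDens (A.center m j) (A.σ m) y := by
  obtain ⟨M, hM0, hM⟩ : ∃ M : ℝ, 0 < M ∧ 2 ^ ((D : ℝ) / 2) * Real.exp (-M ^ 2 / 4) ≤ η / 4 := by
    have h1 : Tendsto (fun M : ℝ => 2 ^ ((D : ℝ) / 2) * Real.exp (-M ^ 2 / 4)) atTop (𝓝 0) := by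
      rw [← mul_zero ((2 : ℝ) ^ ((D : ℝ) / 2))]
      refine Tendsto.const_mul _ (Real.tendsto_exp_atBot.comp ?_)
      refine Tendsto.atBot_div_const (by norm_num) (tendsto_neg_atTop_atBot.comp ?_)
      exact tendsto_pow_atTop (by norm_num)
    obtain ⟨M, h2, h3⟩ := ((eventually_gt_atTop 0).and
      (h1.eventually (eventually_le_nhds (by positivity : (0 : ℝ) < η / 4)))).exists
    exact ⟨M, h2, h3⟩
  have hσ := A.σ_pos
  have hD' : 0 < Real.sqrt D := Real.sqrt_pos.2 (by exact_mod_cast hD)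
  have hmass : ∀ (y : E D) (m : ℕ), 1 - η / 4 ≤
      ∫ u in cube y (2 * (M * A.σ m)), gaussDens y (A.σ m) u := by
    intro y m
    refine le_trans ?_ (integral_cube_gaussDens_ge y (hσ m) (mul_pos hM0 (hσ m)))
    have : -(M * A.σ m) ^ 2 / (4 * A.σ m ^ 2) = -M ^ 2 / 4 := by
      have := (hσ m).ne'
      field_simp
    rw [this]; linarith
  have hκ : Tendsto (fun m => Real.exp (-(D * (M * A.σ m * A.h m + A.h m ^ 2 / 4) /
      (2 * A.σ m ^ 2)))) atTop (𝓝 1) := by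
    have h1 : Tendsto (fun m => -(D * (M * (A.h m / A.σ m) + (A.h m / A.σ m) ^ 2 / 4) / 2)) atTop
        (𝓝 (-(D * (M * 0 + 0 ^ 2 / 4) / 2))) :=
      (((((A.tendsto_h_div_σ hD).const_mul M).add
        (((A.tendsto_h_div_σ hD).pow 2).div_const 4)).const_mul _).div_const 2).neg
    have h2 := (Real.continuous_exp.tendsto _).comp h1
    simp only [mul_zero, ne_eq, OfNat.ofNat_ne_zero, not_false_eq_true, zero_pow, zero_div,
      add_zero, neg_zero, Real.exp_zero] at h2
    refine h2.congr fun m => ?_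
    have := (hσ m).ne'
    simp only [Function.comp]
    congr 2
    field_simp
  have hrad : Tendsto (fun m => Real.sqrt D * M * A.σ m) atTop (𝓝[>] 0) := by
    refine tendsto_nhdsWithin_iff.2 ⟨?_, Eventually.of_forall fun m => ?_⟩
    · simpa using A.tendsto_σ.const_mul (Real.sqrt D * M)
    · exact mul_pos (mul_pos hD' hM0) (hσ m)
  filter_upwards [IsUnifLocDoublingMeasure.ae_tendsto_average_norm_sub volume
    hf.locallyIntegrable 1] with y hy
  have hsum0 : ∀ m, 0 ≤ ∑ j, (∫ u in A.cellAt m j, f u) * gaussDens (A.center m j) (A.σ m) y :=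
    fun m => Finset.sum_nonneg fun j _ => mul_nonneg (integral_nonneg fun u => hf0 u)
      (gaussDens_pos _ (hσ m) _).le
  rcases (hf0 y).eq_or_lt with hy0 | hy0
  · rw [← hy0, mul_zero]
    exact Eventually.of_forall hsum0
  let mass : ℕ → ℝ := fun m => ∫ u in cube y (2 * (M * A.σ m)), gaussDens y (A.σ m) u
  have hmass0 : ∀ m, 1 / 2 ≤ mass m := fun m => by
    have := hmass y m
    simp only [mass]; linarith
  let g : ℕ → E D → ℝ := fun m =>
    (cube y (2 * (M * A.σ m))).indicator fun u => (mass m)⁻¹ * gaussDens y (A.σ m) u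
  have hav := hy (l := atTop) (fun _ => y) (fun m => Real.sqrt D * M * A.σ m) hrad
    (Eventually.of_forall fun m => by
      simp only [Metric.mem_closedBall, dist_self, one_mul]
      have := hσ m; positivity)
  have hlim := tendsto_integral_smul_of_tendsto_average_norm_sub (g := g)
    (2 * (2 * Real.pi) ^ (-(D : ℝ) / 2) * (Real.sqrt D * M) ^ D *
      volume.real (Metric.closedBall (0 : E D) 1)) hav
    (Eventually.of_forall fun m => hf.integrableOn)
    (by
      refine tendsto_const_nhds.congr fun m => ?_
      have h1 := hmass0 m
      simp only [g]
      rw [integral_indicator (measurableSet_cube _ _), integral_const_mul]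
      exact (inv_mul_cancel₀ (by linarith : mass m ≠ 0)).symm)
    (Eventually.of_forall fun m u hu => by
      have hu' : u ∈ cube y (2 * (M * A.σ m)) := by
        by_contra hcon
        exact hu (Set.indicator_of_notMem hcon _)
      rw [Metric.mem_closedBall, dist_eq_norm, mul_assoc]
      exact norm_sub_le_of_mem_cube (mul_pos hM0 (hσ m)).le hu')
    (Eventually.of_forall fun m u => by
      have h1 := hmass0 m
      have h2 := hσ m
      have hV : 0 < volume.real (Metric.closedBall (0 : E D) 1) := by
        rw [measureReal_def]
        exact ENNReal.toReal_pos (Metric.measure_closedBall_pos _ _ one_pos).ne'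
          measure_closedBall_lt_top.ne
      have h3 : |g m u| ≤ 2 * (2 * Real.pi * A.σ m ^ 2) ^ (-(D : ℝ) / 2) := by
        simp only [g]
        by_cases hu : u ∈ cube y (2 * (M * A.σ m))
        · rw [Set.indicator_of_mem hu, abs_of_nonneg (mul_nonneg (by positivity)
            (gaussDens_pos _ h2 _).le)]
          refine mul_le_mul ?_ (gaussDens_le _ _ _) (gaussDens_pos _ h2 _).le (by norm_num)
          rw [inv_le_comm₀ (by linarith) (by norm_num)]
          linarith
        · rw [Set.indicator_of_notMem hu, abs_zero]; positivity
      refine h3.trans (le_of_eq ?_)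
      rw [Measure.addHaar_real_closedBall' volume y (r := Real.sqrt D * M * A.σ m) (by positivity),
        finrank_euclideanSpace_fin,
        Real.mul_rpow (x := 2 * Real.pi) (by positivity) (by positivity), mul_pow _ (A.σ m)]
      have h4 : (A.σ m ^ 2) ^ (-(D : ℝ) / 2) = (A.σ m ^ D)⁻¹ := by
        rw [← Real.rpow_natCast, ← Real.rpow_mul h2.le, ← Real.rpow_natCast, ← Real.rpow_neg h2.le]
        congr 1; push_cast; ring
      rw [h4]
      have h5 : (Real.sqrt D * M) ^ D ≠ 0 := by positivity
      field_simp)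
  have hδ : ∀ᶠ m in atTop, 2 * (M * A.σ m) ≤ A.δ m := by
    have h1 : Tendsto (fun m => 2 * M * (A.σ m / A.δ m)) atTop (𝓝 0) := by
      simpa using A.σ_δ.const_mul (2 * M)
    filter_upwards [h1.eventually (eventually_le_nhds one_pos)] with m hm
    have h2 := A.δ_pos m
    rw [← mul_div_assoc, div_le_one h2] at hm
    linarith
  have h1η : 1 - η / 4 < 1 := by linarith
  filter_upwards [hδ, A.exhaust y, hκ.eventually (eventually_ge_nhds h1η),
    hlim.eventually (eventually_ge_nhds (by nlinarith : (1 - η / 4) * f y < f y))]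
    with m hm1 hm2 hm3 hm4
  have hsub : (A.rest m)ᶜ ∩ cube y (2 * (M * A.σ m)) = cube y (2 * (M * A.σ m)) := by
    refine Set.inter_eq_right.2 fun u hu => ?_
    refine Set.disjoint_left.1 hm2 fun i => ?_
    have := hu i
    linarith
  have hkey := A.sum_mul_gaussDens_ge (m := m) hf hf0 y (M * A.σ m)
  rw [hsub] at hkey
  have hg : ∫ u, g m u • f u = (mass m)⁻¹ *
      ∫ u in cube y (2 * (M * A.σ m)), gaussDens y (A.σ m) u * f u := by
    rw [← integral_const_mul, ← integral_indicator (measurableSet_cube _ _)]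
    refine integral_congr_ae (ae_of_all _ fun u => ?_)
    by_cases hu : u ∈ cube y (2 * (M * A.σ m))
    · simp only [g, Set.indicator_of_mem hu, smul_eq_mul]; ring
    · simp [g, Set.indicator_of_notMem hu]
  have hmm := hmass y m
  have hmpos : 0 < mass m := by have := hmass0 m; linarith
  rw [hg, inv_mul_eq_div, le_div_iff₀ hmpos] at hm4
  refine le_trans ?_ hkey
  have e1 : (1 - η / 4) * f y * (1 - η / 4) ≤ (1 - η / 4) * f y * mass m := by
    refine mul_le_mul_of_nonneg_left hmm (mul_nonneg (by linarith) hy0.le)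
  have e2 : (1 - η / 4) * ((1 - η / 4) * f y * (1 - η / 4)) ≤ _ :=
    mul_le_mul hm3 (e1.trans hm4) (mul_nonneg (mul_nonneg (by linarith) hy0.le) (by linarith))
      (Real.exp_pos _).le
  refine le_trans ?_ e2
  have e3 : 1 - η ≤ (1 - η / 4) * (1 - η / 4) * (1 - η / 4) := by
    nlinarith [sq_nonneg η, mul_nonneg (sq_nonneg η) (sub_nonneg.2 hη1.le)]
  nlinarith

/-! ### Cell masses -/

theorem cube_subset_cellAt (m : ℕ) (j : Fin m) :
    cube (A.center m j) (A.h m / 2) ⊆ A.cellAt m j := by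
  intro y hy i
  have h1 := abs_le.1 (hy i)
  have h2 := A.h_pos m
  exact ⟨by linarith [h1.1], by linarith [h1.2]⟩

theorem cellAt_subset_cube (m : ℕ) (j : Fin m) :
    A.cellAt m j ⊆ cube (A.center m j) (A.h m) := by
  intro y hy i
  exact abs_le.2 ⟨by linarith [(hy i).1], by linarith [(hy i).2]⟩

theorem volume_rest (hD : 1 ≤ D) (m : ℕ) : volume (A.rest m) = ∞ := by
  have : Nonempty (Fin D) := ⟨⟨0, hD⟩⟩
  have : Nontrivial (E D) := inferInstance
  have huniv : volume (Set.univ : Set (E D)) = ∞ := by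
    have : NoncompactSpace (E D) := NormedSpace.noncompactSpace ℝ (E D)
    exact measure_univ_of_isAddLeftInvariant _
  have hfin : volume (⋃ j, A.cellAt m j) ≠ ∞ := by
    refine ((measure_iUnion_le _).trans_lt ?_).ne
    rw [tsum_fintype]
    refine ENNReal.sum_lt_top.2 fun j _ => (measure_mono (A.cellAt_subset_cube m j)).trans_lt ?_
    rw [volume_cube]
    exact ENNReal.pow_lt_top ENNReal.ofReal_lt_top
  rw [rest, measure_compl (MeasurableSet.iUnion fun j => A.measurableSet_cellAt j) hfin, huniv,
    ENNReal.top_sub hfin]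

theorem setIntegral_pos_of_pos {f : E D → ℝ} (hf : Integrable f) (hf0 : ∀ y, 0 ≤ f y)
    (hpos : ∀ᵐ y, 0 < f y) {s : Set (E D)} (hs : volume s ≠ 0) : 0 < ∫ y in s, f y := by
  rw [setIntegral_pos_iff_support_of_nonneg_ae (ae_of_all _ hf0) hf.integrableOn]
  have : s =ᵐ[volume] (Function.support f ∩ s : Set (E D)) := by
    filter_upwards [hpos] with y hy
    exact propext ⟨fun h => ⟨hy.ne', h⟩, fun h => h.2⟩
  rw [← measure_congr this]
  exact pos_iff_ne_zero.2 hs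

theorem cellMass_pos {f : E D → ℝ} (hf : Integrable f) (hf0 : ∀ y, 0 ≤ f y)
    (hpos : ∀ᵐ y, 0 < f y) (m : ℕ) (j : Fin m) : 0 < ∫ y in A.cellAt m j, f y := by
  refine setIntegral_pos_of_pos hf hf0 hpos fun h => ?_
  have := measure_mono_null (A.cube_subset_cellAt m j) h
  rw [volume_cube] at this
  exact absurd this (pow_ne_zero _ (by simpa using A.h_pos m))

theorem restMass_pos (hD : 1 ≤ D) {f : E D → ℝ} (hf : Integrable f) (hf0 : ∀ y, 0 ≤ f y)
    (hpos : ∀ᵐ y, 0 < f y) (m : ℕ) : 0 < ∫ y in A.rest m, f y :=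
  setIntegral_pos_of_pos hf hf0 hpos (by simp [A.volume_rest hD m])

end CellPartition


/-! ### Vanishing loss along an arbitrary partition sequence -/

namespace Features

variable {C : Type*} [MeasurableSpace C] {D T : ℕ} {F : Features C D T} {S : Diffusion C D T}

theorem Valid.ae_law_of_ae (hF : F.Valid S) (t : Fin T) {P : E D × E (F.d t) → Prop}
    (hP : MeasurableSet {w | P w}) (h : ∀ᵐ z ∂(F.featLaw S t), ∀ᵐ y : E D, P (y, z)) :
    ∀ᵐ w ∂(F.law S t), P w := by
  rw [ae_iff, ← Set.compl_ofPred, ← lintegral_indicator_one hP.compl,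
    hF.lintegral_law_eq t (measurable_one.indicator hP.compl), lintegral_eq_zero_of_ae_eq_zero]
  filter_upwards [h] with z hz
  refine lintegral_eq_zero_of_ae_eq_zero ?_
  refine (withDensity_absolutelyContinuous _ _) ?_
  filter_upwards [hz] with y hy
  simp [hy]

theorem ae_law_of_ae_featLaw (F : Features C D T) (S : Diffusion C D T) (t : Fin T)
    {P : E (F.d t) → Prop} (h : ∀ᵐ z ∂(F.featLaw S t), P z) : ∀ᵐ w ∂(F.law S t), P w.2 :=
  ae_of_ae_map measurable_snd.aemeasurable h

theorem logLoss_le_add {t : Fin T} {p p' : E (F.d t) → E D → ℝ} {ε : ℝ}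
    (hp : ∀ z y, 0 < p z y) (h0 : ∀ y z, 0 ≤ F.ρ t y z) (hε : 0 ≤ ε)
    (h : ∀ᵐ z ∂(F.featLaw S t), ∀ y, Real.exp (-ε) * p z y ≤ p' z y) :
    F.logLoss S t p' ≤ F.logLoss S t p + ENNReal.ofReal ε := by
  have := F.isProbabilityMeasure_law S t
  calc F.logLoss S t p' ≤ ∫⁻ w, (ENNReal.ofReal (Real.log (F.ρ t w.1 w.2 / p w.2 w.1)) +
        ENNReal.ofReal ε) ∂(F.law S t) := by
        refine lintegral_mono_ae ?_
        filter_upwards [F.ae_law_of_ae_featLaw S t h] with w hw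
        refine le_trans (ENNReal.ofReal_le_ofReal ?_) ENNReal.ofReal_add_le
        rcases (h0 w.1 w.2).eq_or_lt with h1 | h1
        · simpa [← h1] using hε
        have h2 := hp w.2 w.1
        have h3 : 0 < p' w.2 w.1 := (mul_pos (Real.exp_pos _) h2).trans_le (hw w.1)
        have h4 := Real.log_le_log (mul_pos (Real.exp_pos _) h2) (hw w.1)
        rw [Real.log_mul (Real.exp_pos _).ne' h2.ne', Real.log_exp] at h4
        rw [Real.log_div h1.ne' h2.ne', Real.log_div h1.ne' h3.ne']
        linarith
    _ = _ := by
        rw [lintegral_add_right _ measurable_const, lintegral_const, measure_univ, mul_one]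
        rfl

/-- Continuous logits can be replaced by a ReLU network at arbitrarily small cost. -/
theorem Valid.exists_net_logLoss_le {r : Fin T → ℝ} (hF : F.Valid S) (hS : S.Regular r) {t : Fin T}
    (A : CellPartition D (r t)) {m : ℕ} {u : E (F.d t) → Fin m → ℝ} {v : E (F.d t) → Fin m → ℝ}
    (hv : ∀ j, ContinuousOn (fun z => v z j) (F.K t))
    (huv : ∀ᵐ z ∂(F.featLaw S t), u z = v z) {ε : ℝ} (hε : 0 < ε) :
    ∃ N : ReLUNet (F.d t) m, F.logLoss S t (fun z => A.mixDens (N.eval z)) ≤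
      F.logLoss S t (fun z => A.mixDens (u z)) + ENNReal.ofReal ε := by
  obtain ⟨N, hN⟩ := exists_reluNet_approx (hF.compact t) v hv (half_pos hε)
  refine ⟨N, logLoss_le_add (fun z y => A.mixDens_pos _ _) (hF.nonneg t) hε.le ?_⟩
  filter_upwards [huv, hF.ae_featLaw hS t] with z hz hK y
  have := A.mixDens_ge (half_pos hε).le (hN z hK.1) y
  rw [hz]
  rwa [mul_div_cancel₀ _ (two_ne_zero' ℝ)] at this

theorem Valid.ae_density {r : Fin T → ℝ} (hF : F.Valid S) (hS : S.Regular r) (t : Fin T) :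
    ∀ᵐ z ∂(F.featLaw S t), z ∈ F.K t ∧ Integrable (fun y => F.ρ t y z) ∧ ∫ y, F.ρ t y z = 1 ∧
      ∀ᵐ y : E D, 0 < F.ρ t y z := by
  filter_upwards [hF.ae_featLaw hS t] with z ⟨h1, h2, h3⟩
  have hm : Measurable fun y => F.ρ t y z := (hF.meas t).comp measurable_prodMk_right
  have h4 : ∫⁻ y, ENNReal.ofReal (F.ρ t y z) = 1 := by
    rw [← h2.measure_univ, target, withDensity_apply _ MeasurableSet.univ, Measure.restrict_univ]
  refine ⟨h1, ⟨hm.aestronglyMeasurable, ?_⟩, ?_, h3⟩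
  · rw [hasFiniteIntegral_iff_ofReal (ae_of_all _ fun y => hF.nonneg t y z), h4]
    exact ENNReal.one_lt_top
  · rw [integral_eq_lintegral_of_nonneg_ae (ae_of_all _ fun y => hF.nonneg t y z)
      hm.aestronglyMeasurable, h4, ENNReal.toReal_one]

theorem Valid.measurable_setIntegral (hF : F.Valid S) (t : Fin T) (s : Set (E D)) :
    Measurable fun z => ∫ y in s, F.ρ t y z :=
  ((hF.meas t).comp measurable_swap).stronglyMeasurable.integral_prod_right'.measurable

end Features

namespace CellPartition

variable {D : ℕ} {r : ℝ} (A : CellPartition D r)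

/-- Logits giving cell `j` the weight `(1 - η) G_j` and the baseline the weight
`(1 - η) G_0 + η`, where `G` are the cell probabilities of the density `f`. The positive baseline
weight `η` bounds the logarithmic loss for all resolutions at once. -/
noncomputable def blendLogits (η : ℝ) (f : E D → ℝ) (m : ℕ) (j : Fin m) : ℝ :=
  Real.log ((1 - η) * (∫ y in A.cellAt m j, f y) / ((1 - η) * (∫ y in A.rest m, f y) + η))

variable {η : ℝ} {f : E D → ℝ}

theorem mixDens_blendLogits (hη : 0 < η) (hη1 : η < 1) (hf : Integrable f) (hf0 : ∀ y, 0 ≤ f y)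
    (hpos : ∀ᵐ y, 0 < f y) (hone : ∫ y, f y = 1) (m : ℕ) (y : E D) :
    A.mixDens (A.blendLogits η f m) y =
      (1 - η) * ∑ j, (∫ u in A.cellAt m j, f u) * gaussDens (A.center m j) (A.σ m) y +
        ((1 - η) * (∫ u in A.rest m, f u) + η) * gaussDens 0 A.σ0 y := by
  have h1 : (0 : ℝ) < 1 - η := by linarith
  have h0 : 0 ≤ ∫ y in A.rest m, f y := integral_nonneg fun y => hf0 y
  have hs := A.sum_integral_cellAt_add_rest (m := m) hf
  obtain ⟨h2, h3⟩ := softmax_log_div (w := fun j => (1 - η) * ∫ y in A.cellAt m j, f y)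
    (w₀ := (1 - η) * (∫ y in A.rest m, f y) + η)
    (fun j => mul_pos h1 (A.cellMass_pos hf hf0 hpos m j)) (by positivity)
    (by rw [← Finset.mul_sum, ← add_assoc, ← mul_add, hs, hone]; ring)
  unfold mixDens blendLogits
  rw [h3, Finset.mul_sum]
  simp only [h2, mul_assoc]

theorem blendLogits_eq (hD : 1 ≤ D) (hf : Integrable f) (hf0 : ∀ y, 0 ≤ f y)
    (hpos : ∀ᵐ y, 0 < f y) (hone : ∫ y, f y = 1) (m : ℕ) {L : Fin m → ℝ}
    (hL : ∀ j, L j = Real.log ((∫ y in A.cellAt m j, f y) / ∫ y in A.rest m, f y)) (j : Fin m) :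
    A.blendLogits η f m j = Real.log ((1 - η) * Real.exp (L j) /
      ((1 - η) + η * (1 + ∑ k, Real.exp (L k)))) := by
  have h0 := A.restMass_pos hD hf hf0 hpos m
  have hs := A.sum_integral_cellAt_add_rest (m := m) hf
  have h1 : ∀ j, Real.exp (L j) = (∫ y in A.cellAt m j, f y) / ∫ y in A.rest m, f y := fun j => by
    rw [hL, Real.exp_log (div_pos (A.cellMass_pos hf hf0 hpos m j) h0)]
  have h2 : 1 + ∑ k, Real.exp (L k) = 1 / ∫ y in A.rest m, f y := by
    simp only [h1]
    rw [← Finset.sum_div, eq_sub_of_add_eq hs, hone]; field_simp; ring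
  rw [h2, h1, blendLogits]
  congr 1
  have := h0.ne'
  field_simp

end CellPartition

namespace Features

variable {C : Type*} [MeasurableSpace C] {D T : ℕ} {F : Features C D T} {S : Diffusion C D T}

theorem Valid.measurable_blendLogits {r : ℝ} (hF : F.Valid S) (t : Fin T) (A : CellPartition D r)
    (η : ℝ) (m : ℕ) : Measurable fun z => A.blendLogits η (fun y => F.ρ t y z) m := by
  have h := fun s => hF.measurable_setIntegral t s
  refine measurable_pi_iff.2 fun j => ?_
  unfold CellPartition.blendLogits
  exact Real.measurable_log.comp (((h _).const_mul _).div (((h _).const_mul _).add_const _))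

set_option maxHeartbeats 1000000 in
/-- Along every partition sequence, the blended mixtures have asymptotic loss `O(η)`. -/
theorem Valid.limsup_logLoss_blend_le {r : Fin T → ℝ} (hD : 1 ≤ D) (hr : ∀ t, 0 < r t)
    (hF : F.Valid S) (hS : S.Regular r) (t : Fin T) (A : CellPartition D (r t))
    {η : ℝ} (hη : 0 < η) (hη1 : η < 1) :
    limsup (fun m => F.logLoss S t fun z => A.mixDens (A.blendLogits η (fun y => F.ρ t y z) m))
      atTop ≤ ENNReal.ofReal (-(2 * Real.log (1 - η))) := by
  obtain ⟨w, a, b, -, ha, ha0, hb, hb0, h1, h2, hint⟩ := hS.logVar t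
  have h1η : 0 < 1 - η := by linarith
  have hσ0 := A.σ0_pos
  have hφ := F.φ_meas t
  have hmix : ∀ m, Measurable (Function.uncurry fun z =>
      A.mixDens (A.blendLogits η (fun y => F.ρ t y z) m)) := fun m =>
    A.measurable_mixDens (hF.measurable_blendLogits t A η m)
  have hmeas : ∀ m, Measurable fun p : E D × E (F.d t) => ENNReal.ofReal (Real.log
      (F.ρ t p.1 p.2 / A.mixDens (A.blendLogits η (fun y => F.ρ t y p.2) m) p.1)) := fun m =>
    hF.measurable_logRatio t (hmix m)
  have hpair : Measurable fun p : C × E D × E D => (p.2.1, F.φ t (p.1, p.2.2)) := by fun_prop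
  -- the sum over the cells eventually exceeds `(1 - η) ρ`
  have hsm : ∀ m, Measurable fun p : E D × E (F.d t) =>
      ∑ j, (∫ u in A.cellAt m j, F.ρ t u p.2) * gaussDens (A.center m j) (A.σ m) p.1 := fun m =>
    Finset.measurable_sum _ fun j _ =>
      ((hF.measurable_setIntegral t _).comp measurable_snd).mul
        ((continuous_gaussDens _ _).measurable.comp measurable_fst)
  have hev : ∀ᵐ p ∂(F.law S t), ∀ᶠ m in atTop, (1 - η) * F.ρ t p.1 p.2 ≤
      ∑ j, (∫ u in A.cellAt m j, F.ρ t u p.2) * gaussDens (A.center m j) (A.σ m) p.1 := by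
    refine hF.ae_law_of_ae t ?_ ?_
    · simp only [eventually_atTop]
      have : {p : E D × E (F.d t) | ∃ k, ∀ m, k ≤ m → (1 - η) * F.ρ t p.1 p.2 ≤
          ∑ j, (∫ u in A.cellAt m j, F.ρ t u p.2) * gaussDens (A.center m j) (A.σ m) p.1} =
          ⋃ k, ⋂ m, ⋂ (_ : k ≤ m), {p | (1 - η) * F.ρ t p.1 p.2 ≤
          ∑ j, (∫ u in A.cellAt m j, F.ρ t u p.2) * gaussDens (A.center m j) (A.σ m) p.1} := by
        ext p; simp
      exact this ▸ MeasurableSet.iUnion fun k => MeasurableSet.iInter fun m =>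
        MeasurableSet.iInter fun _ => measurableSet_le ((hF.meas t).const_mul _) (hsm m)
    · filter_upwards [hF.ae_density hS t] with z ⟨_, hi, _, _⟩
      exact A.ae_eventually_smoothing_ge hD hi (fun y => hF.nonneg t y z) hη hη1
  have hdens : ∀ᵐ p ∂(F.law S t), ∀ m,
      A.mixDens (A.blendLogits η (fun y => F.ρ t y p.2) m) p.1 =
      (1 - η) * ∑ j, (∫ u in A.cellAt m j, F.ρ t u p.2) * gaussDens (A.center m j) (A.σ m) p.1 +
        ((1 - η) * (∫ u in A.rest m, F.ρ t u p.2) + η) * gaussDens 0 A.σ0 p.1 := by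
    filter_upwards [F.ae_law_of_ae_featLaw S t (hF.ae_density hS t)] with p ⟨_, hi, hone, hpos⟩ m
    exact A.mixDens_blendLogits hη hη1 hi (fun y => hF.nonneg t y _) hpos hone m _
  have hsum0 : ∀ (p : E D × E (F.d t)) m, 0 ≤
      ∑ j, (∫ u in A.cellAt m j, F.ρ t u p.2) * gaussDens (A.center m j) (A.σ m) p.1 :=
    fun p m => Finset.sum_nonneg fun j _ => mul_nonneg (integral_nonneg fun u => hF.nonneg t _ _)
      (gaussDens_pos _ (A.σ_pos m) _).le
  have hrest0 : ∀ (p : E D × E (F.d t)) m, 0 ≤ ∫ u in A.rest m, F.ρ t u p.2 := fun p m =>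
    integral_nonneg fun u => hF.nonneg t _ _
  -- an integrable majorant
  set c : ℝ := η * (2 * Real.pi * A.σ0 ^ 2) ^ (-(D : ℝ) / 2) with hc
  have hcpos : 0 < c := by positivity
  set c₀ : ℝ := |Real.log (r t ^ D) + Real.log c| with hc₀
  let B : C × E D × E D → ℝ≥0∞ := fun p => ENNReal.ofReal (a p.2.1 + b p.2.1 p.2.2) +
    (ENNReal.ofReal c₀ + ENNReal.ofReal (1 / (2 * A.σ0 ^ 2)) * ENNReal.ofReal (‖p.2.1‖ ^ 2))
  have hB : ∫⁻ p, B p ∂(S.stepLaw t) ≠ ∞ := by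
    have hm2 : Measurable fun p : C × E D × E D => ENNReal.ofReal (‖p.2.1‖ ^ 2) := by fun_prop
    have hsq : ∫⁻ p, ENNReal.ofReal (‖p.2.1‖ ^ 2) ∂(S.stepLaw t) < ∞ := by
      have : ∫⁻ p, ENNReal.ofReal (‖p.2.1‖ ^ 2) ∂(S.stepLaw t) =
          ∫⁻ q, ENNReal.ofReal (‖q.2‖ ^ 2) ∂((S.stepLaw t).map fun p => (p.1, p.2.1)) := by
        rw [lintegral_map (by fun_prop) (by fun_prop)]
      rw [this, S.map_stepLaw_fst, Measure.lintegral_compProd (by fun_prop)]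
      exact hS.moment t
    simp only [B]
    rw [lintegral_add_right _ (by fun_prop), lintegral_add_right _ (by fun_prop),
      lintegral_const_mul _ hm2, lintegral_const]
    exact (ENNReal.add_lt_top.2 ⟨hint, ENNReal.add_lt_top.2
      ⟨ENNReal.mul_lt_top ENNReal.ofReal_lt_top (measure_lt_top _ _),
        ENNReal.mul_lt_top ENNReal.ofReal_lt_top hsq⟩⟩).ne
  have hdom : ∀ m, (fun p : C × E D × E D => ENNReal.ofReal (Real.log
      (F.ρ t p.2.1 (F.φ t (p.1, p.2.2)) /
        A.mixDens (A.blendLogits η (fun y => F.ρ t y (F.φ t (p.1, p.2.2))) m) p.2.1)))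
      ≤ᵐ[S.stepLaw t] B := by
    intro m
    filter_upwards [hF.density_le hr hS t ha hb h1 h2, ae_of_ae_map hpair.aemeasurable hdens]
      with p hp hp'
    have hs0 := hsum0 (p.2.1, F.φ t (p.1, p.2.2)) m
    have hr0 := hrest0 (p.2.1, F.φ t (p.1, p.2.2)) m
    have hg := gaussDens_pos (0 : E D) hσ0 p.2.1
    have hmixge : c * Real.exp (-(‖p.2.1‖ ^ 2 / (2 * A.σ0 ^ 2))) ≤
        A.mixDens (A.blendLogits η (fun y => F.ρ t y (F.φ t (p.1, p.2.2))) m) p.2.1 := by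
      have e : c * Real.exp (-(‖p.2.1‖ ^ 2 / (2 * A.σ0 ^ 2))) = η * gaussDens 0 A.σ0 p.2.1 := by
        rw [hc, gaussDens, sub_zero, mul_assoc, neg_div (2 * A.σ0 ^ 2)]
      rw [hp' m, e]
      have h3 : 0 ≤ (1 - η) * (∫ u in A.rest m, F.ρ t u (F.φ t (p.1, p.2.2))) *
        gaussDens 0 A.σ0 p.2.1 := by positivity
      have h4 := mul_nonneg h1η.le hs0
      simp only at h4
      linarith
    simp only [B]
    rw [← ENNReal.ofReal_mul (by positivity), ← ENNReal.ofReal_add (abs_nonneg _) (by positivity),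
      ← ENNReal.ofReal_add (add_nonneg (ha0 _) (hb0 _ _)) (by positivity)]
    refine ENNReal.ofReal_le_ofReal ?_
    have hab := add_nonneg (ha0 p.2.1) (hb0 p.2.1 p.2.2)
    rcases (hF.nonneg t p.2.1 (F.φ t (p.1, p.2.2))).eq_or_lt with h0 | h0
    · rw [← h0, zero_div, Real.log_zero]; positivity
    have hrD : 0 < r t ^ D := pow_pos (hr t) D
    have l1 := Real.log_le_log (mul_pos h0 hrD) hp
    have l2 := Real.log_le_log (by positivity) hmixge
    rw [Real.log_mul h0.ne' hrD.ne', Real.log_exp] at l1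
    rw [Real.log_mul hcpos.ne' (Real.exp_pos _).ne', Real.log_exp] at l2
    rw [Real.log_div h0.ne' (A.mixDens_pos _ _).ne']
    have := neg_abs_le (Real.log (r t ^ D) + Real.log c)
    rw [← hc₀] at this
    have e : 1 / (2 * A.σ0 ^ 2) * ‖p.2.1‖ ^ 2 = ‖p.2.1‖ ^ 2 / (2 * A.σ0 ^ 2) := by ring
    rw [e]
    linarith
  have hlim := limsup_lintegral_le (μ := S.stepLaw t) (f := fun m (p : C × E D × E D) =>
    ENNReal.ofReal (Real.log (F.ρ t p.2.1 (F.φ t (p.1, p.2.2)) /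
        A.mixDens (A.blendLogits η (fun y => F.ρ t y (F.φ t (p.1, p.2.2))) m) p.2.1))) B
    (fun m => (hmeas m).comp hpair) hdom hB
  have hlaw : ∀ m, F.logLoss S t (fun z => A.mixDens (A.blendLogits η (fun y => F.ρ t y z) m)) =
      ∫⁻ p, ENNReal.ofReal (Real.log (F.ρ t p.2.1 (F.φ t (p.1, p.2.2)) /
        A.mixDens (A.blendLogits η (fun y => F.ρ t y (F.φ t (p.1, p.2.2))) m) p.2.1))
        ∂(S.stepLaw t) := fun m => F.lintegral_law S t (hmeas m)
  simp only [hlaw]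
  refine hlim.trans ?_
  have hprob : IsProbabilityMeasure (S.stepLaw t) := inferInstance
  calc _ ≤ ∫⁻ _, ENNReal.ofReal (-(2 * Real.log (1 - η))) ∂(S.stepLaw t) := by
        refine lintegral_mono_ae ?_
        filter_upwards [ae_of_ae_map hpair.aemeasurable hev, ae_of_ae_map hpair.aemeasurable hdens]
          with p hp hp'
        refine limsup_le_of_le (by isBoundedDefault) ?_
        filter_upwards [hp] with m hm
        refine ENNReal.ofReal_le_ofReal ?_
        have hl : Real.log (1 - η) ≤ 0 := Real.log_nonpos h1η.le (by linarith)
        rcases (hF.nonneg t p.2.1 (F.φ t (p.1, p.2.2))).eq_or_lt with h0 | h0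
        · rw [← h0, zero_div, Real.log_zero]; linarith
        have hr0 := hrest0 (p.2.1, F.φ t (p.1, p.2.2)) m
        have hg := gaussDens_pos (0 : E D) hσ0 p.2.1
        have hge : (1 - η) * ((1 - η) * F.ρ t p.2.1 (F.φ t (p.1, p.2.2))) ≤
            A.mixDens (A.blendLogits η (fun y => F.ρ t y (F.φ t (p.1, p.2.2))) m) p.2.1 := by
          rw [hp' m]
          have h3 : 0 ≤ ((1 - η) * (∫ u in A.rest m, F.ρ t u (F.φ t (p.1, p.2.2))) + η) *
            gaussDens 0 A.σ0 p.2.1 := by positivity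
          have h4 := mul_le_mul_of_nonneg_left hm h1η.le
          linarith
        have l2 := Real.log_le_log (by positivity) hge
        rw [Real.log_mul h1η.ne' (by positivity), Real.log_mul h1η.ne' h0.ne'] at l2
        rw [Real.log_div h0.ne' (A.mixDens_pos _ _).ne']
        linarith
    _ = _ := by rw [lintegral_const, measure_univ, mul_one]

/-- Along every partition sequence some ReLU mixture has arbitrarily small loss. -/
theorem Valid.exists_net_logLoss_le_ofReal {r : Fin T → ℝ} (hD : 1 ≤ D) (hr : ∀ t, 0 < r t)
    (hF : F.Valid S) (hS : S.Regular r) (t : Fin T) (A : CellPartition D (r t))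
    (hA : ∀ m, 1 ≤ m → ∀ j : Fin m, ∃ L : E (F.d t) → ℝ, ContinuousOn L (F.K t) ∧
      ∀ z ∈ F.K t, L z = A.logOdds (F.ρ t) m z j) {ε : ℝ} (hε : 0 < ε) :
    ∃ m, 1 ≤ m ∧ ∃ N : ReLUNet (F.d t) m,
      F.logLoss S t (fun z => A.mixDens (N.eval z)) ≤ ENNReal.ofReal ε := by
  set η : ℝ := 1 - Real.exp (-(ε / 8)) with hη
  have hη0 : 0 < η := by
    have : Real.exp (-(ε / 8)) < 1 := Real.exp_lt_one_iff.2 (by linarith)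
    linarith
  have hη1 : η < 1 := by have := Real.exp_pos (-(ε / 8)); linarith
  have hlim := hF.limsup_logLoss_blend_le hD hr hS t A hη0 hη1
  have hlog : -(2 * Real.log (1 - η)) = ε / 4 := by
    rw [hη, sub_sub_cancel, Real.log_exp]; ring
  rw [hlog] at hlim
  have hev := eventually_lt_of_limsup_lt (hlim.trans_lt
    ((ENNReal.ofReal_lt_ofReal_iff (half_pos hε)).2 (by linarith : ε / 4 < ε / 2)))
  obtain ⟨m, hm, hm1⟩ := (hev.and (eventually_ge_atTop 1)).exists
  choose L hLc hL using hA m hm1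
  have hv : ∀ j, ContinuousOn (fun z => Real.log ((1 - η) * Real.exp (L j z) /
      ((1 - η) + η * (1 + ∑ k, Real.exp (L k z))))) (F.K t) := by
    intro j
    have hη' : 0 < 1 - η := by linarith
    have hden : ∀ z, 0 < (1 - η) + η * (1 + ∑ k, Real.exp (L k z)) := fun z => by positivity
    refine ContinuousOn.log (ContinuousOn.div ?_ ?_ fun z _ => (hden z).ne')
      fun z _ => (div_pos (by positivity) (hden z)).ne'
    · exact continuousOn_const.mul (hLc j).rexp
    · exact continuousOn_const.add (continuousOn_const.mul (continuousOn_const.add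
        (continuousOn_finsetSum _ fun k _ => (hLc k).rexp)))
  have huv : ∀ᵐ z ∂(F.featLaw S t), A.blendLogits η (fun y => F.ρ t y z) m =
      fun j => Real.log ((1 - η) * Real.exp (L j z) /
      ((1 - η) + η * (1 + ∑ k, Real.exp (L k z)))) := by
    filter_upwards [hF.ae_density hS t] with z ⟨hK, hi, hone, hpos⟩
    funext j
    exact A.blendLogits_eq hD hi (fun y => hF.nonneg t y z) hpos hone m
      (L := fun j => L j z) (fun j => hL j z hK) j
  obtain ⟨N, hN⟩ := hF.exists_net_logLoss_le hS A hv huv (half_pos hε)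
  refine ⟨m, hm1, N, hN.trans ?_⟩
  calc _ ≤ ENNReal.ofReal (ε / 2) + ENNReal.ofReal (ε / 2) := by gcongr
    _ = ENNReal.ofReal ε := by
      rw [← ENNReal.ofReal_add (half_pos hε).le (half_pos hε).le, add_halves]

end Features


/-! ### A partition sequence for the explicit rate -/

/-- Finite lower sets of `ℕ^D` can be enlarged to any larger cardinality. -/
theorem exists_isLowerSet_card {D : ℕ} (hD : 1 ≤ D) (s : Finset (Fin D → ℕ))
    (hs : IsLowerSet (s : Set (Fin D → ℕ))) (n : ℕ) :
    ∃ s' : Finset (Fin D → ℕ), s ⊆ s' ∧ IsLowerSet (s' : Set (Fin D → ℕ)) ∧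
      s'.card = s.card + n := by
  classical
  induction n with
  | zero => exact ⟨s, subset_rfl, hs, rfl⟩
  | succ n ih =>
    obtain ⟨t, hst, ht, hcard⟩ := ih
    let i₀ : Fin D := ⟨0, hD⟩
    have hex : ∃ k : ℕ, Pi.single i₀ k ∉ t := by
      by_contra! hcon
      exact (Set.infinite_range_of_injective (Pi.single_injective i₀ (M := fun _ => ℕ)))
        (t.finite_toSet.subset (by rintro _ ⟨k, rfl⟩; exact hcon k))
    refine ⟨insert (Pi.single i₀ (Nat.find hex)) t, hst.trans (Finset.subset_insert _ _), ?_, ?_⟩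
    · intro a b hba ha
      simp only [Finset.coe_insert, Set.mem_insert_iff, Finset.mem_coe] at ha ⊢
      rcases ha with rfl | ha
      · have hb : b = Pi.single i₀ (b i₀) := by
          funext i
          by_cases hi : i = i₀
          · subst hi; simp
          · have := hba i
            simp only [Pi.single_eq_of_ne hi] at this ⊢
            omega
        have hle : b i₀ ≤ Nat.find hex := by simpa using hba i₀
        rcases hle.lt_or_eq with h | h
        · right
          have := Nat.find_min hex h
          rw [hb]; simpa using this
        · left; rw [hb, h]
      · exact Or.inr (ht hba ha)
    · rw [Finset.card_insert_of_notMem (Nat.find_spec hex), hcard]; rfl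

/-- Labels of `m` lattice cells forming a lower set of `ℕ^D` which contains a full cube of
side `N ≈ m^{1/D}`. -/
theorem exists_cellLabels {D : ℕ} (hD : 1 ≤ D) (m : ℕ) : ∃ (N : ℕ) (k : Fin m → Fin D → ℕ),
    m < (N + 1) ^ D ∧ Function.Injective k ∧ IsLowerSet (Set.range k) ∧
      ∀ v : Fin D → ℕ, (∀ i, v i < N) → v ∈ Set.range k := by
  classical
  have hD0 : D ≠ 0 := by omega
  obtain ⟨N, hN, hN'⟩ : ∃ N : ℕ, N ^ D ≤ m ∧ m < (N + 1) ^ D := by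
    have hex : ∃ k : ℕ, m < (k + 1) ^ D := ⟨m, (Nat.lt_succ_self m).trans_le
      (Nat.le_self_pow hD0 _)⟩
    refine ⟨Nat.find hex, ?_, Nat.find_spec hex⟩
    rcases h : Nat.find hex with _ | k
    · simp [hD0]
    · exact not_lt.1 (Nat.find_min hex (by omega : k < Nat.find hex))
  obtain ⟨s, hgs, hs, hcard⟩ := exists_isLowerSet_card hD
    (Fintype.piFinset fun _ : Fin D => Finset.range N) (by
      intro a b hba ha
      simp only [Finset.mem_coe, Fintype.mem_piFinset, Finset.mem_range] at ha ⊢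
      exact fun i => (hba i).trans_lt (ha i)) (m - N ^ D)
  have hcard' : s.card = m := by
    rw [hcard, Fintype.card_piFinset]
    simp only [Finset.card_range, Finset.prod_const, Finset.card_univ, Fintype.card_fin]
    omega
  let e := s.equivFinOfCardEq hcard'
  have hrange : Set.range (fun j : Fin m => ((e.symm j : s) : Fin D → ℕ)) = s := by
    ext v
    constructor
    · rintro ⟨j, rfl⟩; exact (e.symm j).2
    · intro hv; exact ⟨e ⟨v, hv⟩, by simp⟩
  refine ⟨N, fun j => (e.symm j : s), hN', fun a b h => e.symm.injective (Subtype.ext h), ?_, ?_⟩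
  · rw [hrange]; exact hs
  · intro v hv
    rw [hrange]
    exact hgs (by simpa using hv)

/-- The side length, in cells, of the full cube contained in the `m` cells. -/
noncomputable def gridSide {D : ℕ} (hD : 1 ≤ D) (m : ℕ) : ℕ := (exists_cellLabels hD m).choose

/-- The lattice labels of the `m` cells. -/
noncomputable def cellLabel {D : ℕ} (hD : 1 ≤ D) (m : ℕ) : Fin m → Fin D → ℕ :=
  (exists_cellLabels hD m).choose_spec.choose

section Labels

variable {D : ℕ} (hD : 1 ≤ D) (m : ℕ)

theorem lt_gridSide_pow : m < (gridSide hD m + 1) ^ D :=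
  (exists_cellLabels hD m).choose_spec.choose_spec.1

theorem cellLabel_injective : Function.Injective (cellLabel hD m) :=
  (exists_cellLabels hD m).choose_spec.choose_spec.2.1

theorem isLowerSet_range_cellLabel : IsLowerSet (Set.range (cellLabel hD m)) :=
  (exists_cellLabels hD m).choose_spec.choose_spec.2.2.1

theorem mem_range_cellLabel {v : Fin D → ℕ} (hv : ∀ i, v i < gridSide hD m) :
    v ∈ Set.range (cellLabel hD m) :=
  (exists_cellLabels hD m).choose_spec.choose_spec.2.2.2 v hv

/-- The centres of the cells of side `h`, placed so that the full cube is centred at the origin. -/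
noncomputable def gridCenter (h : ℝ) (j : Fin m) : E D :=
  WithLp.toLp 2 fun i => h * (cellLabel hD m j i - ((gridSide hD m : ℝ) - 1) / 2)

theorem mem_cell_gridCenter {h : ℝ} (hh : 0 < h) (j : Fin m) (y : E D) :
    y ∈ cell (gridCenter hD m h j) h ↔ ∀ i, (cellLabel hD m j i : ℝ) ≤ y i / h + gridSide hD m / 2 ∧
      y i / h + gridSide hD m / 2 < cellLabel hD m j i + 1 := by
  refine forall_congr' fun i => ?_
  have e : y i = y i / h * h := by field_simp
  simp only [gridCenter]
  constructor
  · rintro ⟨h1, h2⟩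
    rw [e] at h1 h2
    constructor
    · refine le_of_mul_le_mul_right (a := h) ?_ hh; linarith
    · refine lt_of_mul_lt_mul_right (a := h) ?_ hh.le; linarith
  · rintro ⟨h1, h2⟩
    rw [e]
    have h1' := mul_le_mul_of_nonneg_right h1 hh.le
    have h2' := mul_lt_mul_of_pos_right h2 hh
    constructor <;> linarith

theorem disjoint_cell_gridCenter {h : ℝ} (hh : 0 < h) : Pairwise fun j k =>
    Disjoint (cell (gridCenter hD m h j) h) (cell (gridCenter hD m h k) h) := by
  intro j k hjk
  refine Set.disjoint_left.2 fun y hj hk => hjk (cellLabel_injective hD m (funext fun i => ?_))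
  rw [mem_cell_gridCenter hD m hh] at hj hk
  have h1 : (cellLabel hD m j i : ℝ) < cellLabel hD m k i + 1 := (hj i).1.trans_lt (hk i).2
  have h2 : (cellLabel hD m k i : ℝ) < cellLabel hD m j i + 1 := (hk i).1.trans_lt (hj i).2
  norm_cast at h1 h2
  omega

theorem faceAdj_gridCenter {h : ℝ} (hh : 0 < h) {j k : Fin m} {i : Fin D}
    (hi : cellLabel hD m j i = cellLabel hD m k i + 1)
    (hne : ∀ l, l ≠ i → cellLabel hD m j l = cellLabel hD m k l) :
    FaceAdj h (gridCenter hD m h j) (gridCenter hD m h k) := by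
  refine ⟨i, ?_, fun l hl => ?_⟩
  · simp only [gridCenter, hi]
    rw [← mul_sub, abs_mul, abs_of_pos hh]
    push_cast
    rw [show ((cellLabel hD m k i : ℝ) - (gridSide hD m - 1) / 2 -
      (cellLabel hD m k i + 1 - (gridSide hD m - 1) / 2)) = -1 by ring]
    simp
  · simp only [gridCenter, hne l hl]

theorem faceAdj_symm {h : ℝ} {x y : E D} (hxy : FaceAdj h x y) : FaceAdj h y x := by
  obtain ⟨i, h1, h2⟩ := hxy
  exact ⟨i, by rw [abs_sub_comm]; exact h1, fun k hk => (h2 k hk).symm⟩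

/-- Every cell is linked to the one with label `0`, by decreasing the labels. -/
theorem adjacent_gridCenter {h : ℝ} (hh : 0 < h) (j k : Fin m) :
    Relation.ReflTransGen (fun a b => FaceAdj h (gridCenter hD m h a) (gridCenter hD m h b))
      j k := by
  have hsymm : Std.Symm
      (fun a b => FaceAdj h (gridCenter hD m h a) (gridCenter hD m h b)) :=
    ⟨fun a b => faceAdj_symm⟩
  have key : ∀ (n : ℕ) (j o : Fin m), cellLabel hD m o = 0 → ∑ i, cellLabel hD m j i = n →
      Relation.ReflTransGen (fun a b => FaceAdj h (gridCenter hD m h a) (gridCenter hD m h b))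
        j o := by
    intro n
    induction n with
    | zero =>
      intro j o ho hj
      have : cellLabel hD m j = 0 := by
        funext i
        exact Finset.sum_eq_zero_iff.1 hj i (Finset.mem_univ i)
      rw [cellLabel_injective hD m (this.trans ho.symm)]
    | succ n ih =>
      intro j o ho hj
      obtain ⟨i, -, hi⟩ : ∃ i ∈ Finset.univ, cellLabel hD m j i ≠ 0 := by
        refine Finset.exists_ne_zero_of_sum_ne_zero (f := fun i => cellLabel hD m j i) ?_
        rw [hj]; omega
      obtain ⟨l, hl⟩ := isLowerSet_range_cellLabel hD m
        (show Function.update (cellLabel hD m j) i (cellLabel hD m j i - 1) ≤ cellLabel hD m j from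
          update_le_self_iff.2 (by omega)) ⟨j, rfl⟩
      have hli : cellLabel hD m j i = cellLabel hD m l i + 1 := by
        rw [hl, Function.update_self]; omega
      have hlne : ∀ k, k ≠ i → cellLabel hD m j k = cellLabel hD m l k := fun k hk => by
        rw [hl, Function.update_of_ne hk]
      refine Relation.ReflTransGen.head (faceAdj_gridCenter hD m hh hli hlne) (ih l o ho ?_)
      have e1 := Finset.sum_erase_add Finset.univ (cellLabel hD m j) (Finset.mem_univ i)
      have e2 := Finset.sum_erase_add Finset.univ (cellLabel hD m l) (Finset.mem_univ i)
      have e3 : ∑ k ∈ Finset.univ.erase i, cellLabel hD m j k =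
          ∑ k ∈ Finset.univ.erase i, cellLabel hD m l k :=
        Finset.sum_congr rfl fun k hk => hlne k (Finset.ne_of_mem_erase hk)
      omega
  obtain ⟨o, ho⟩ := isLowerSet_range_cellLabel hD m (show (0 : Fin D → ℕ) ≤ cellLabel hD m j from
    fun _ => Nat.zero_le _) ⟨j, rfl⟩
  exact (key _ j o ho rfl).trans (Relation.ReflTransGen.stdSymm.symm _ _ (key _ k o ho rfl))

theorem cube_subset_iUnion_cell {h : ℝ} (hh : 0 < h) {y : E D} {τ : ℝ}
    (hy : ∀ i, |y i| + τ < gridSide hD m * h / 2) :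
    cube y (2 * τ) ⊆ ⋃ j, cell (gridCenter hD m h j) h := by
  intro u hu
  have hb : ∀ i, 0 ≤ u i / h + gridSide hD m / 2 ∧ u i / h + gridSide hD m / 2 < gridSide hD m := by
    intro i
    have h1 := hu i
    have h2 : |u i| ≤ |u i - y i| + |y i| := by simpa using abs_add_le (u i - y i) (y i)
    have h3 : |u i| < gridSide hD m * h / 2 := by linarith [hy i]
    have e : u i = u i / h * h := by field_simp
    rw [e] at h3
    obtain ⟨h4, h5⟩ := abs_lt.1 h3
    constructor
    · refine le_of_mul_le_mul_right (a := h) ?_ hh; linarith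
    · refine lt_of_mul_lt_mul_right (a := h) ?_ hh.le; linarith
  obtain ⟨j, hj⟩ := mem_range_cellLabel hD m
    (v := fun i => ⌊u i / h + gridSide hD m / 2⌋₊) fun i => by
      rw [Nat.floor_lt (hb i).1]; exact (hb i).2
  refine Set.mem_iUnion.2 ⟨j, (mem_cell_gridCenter hD m hh j u).2 fun i => ?_⟩
  rw [hj]
  exact ⟨Nat.floor_le (hb i).1, Nat.lt_floor_add_one _⟩

end Labels


/-! ### The scales of the explicit rate -/

/-- The averaging scale `δ_m = (m + 1)^{-β}`. -/
noncomputable def rateScale (D : ℕ) (θ ξ : ℝ) (m : ℕ) : ℝ := ((m : ℝ) + 1) ^ (-rateExp D θ ξ)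

theorem rateExp_pos {D : ℕ} (hD : 1 ≤ D) {θ ξ : ℝ} (hθ : 2 < θ) (hξ : 0 < ξ) :
    0 < rateExp D θ ξ := by
  have h1 : (0 : ℝ) < D := by exact_mod_cast hD
  have h2 : 0 < θ - 2 := by linarith
  unfold rateExp; positivity

theorem rateScale_pos (D : ℕ) (θ ξ : ℝ) (m : ℕ) : 0 < rateScale D θ ξ m := by
  unfold rateScale; positivity

theorem rateScale_le_one {D : ℕ} (hD : 1 ≤ D) {θ ξ : ℝ} (hθ : 2 < θ) (hξ : 0 < ξ) (m : ℕ) :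
    rateScale D θ ξ m ≤ 1 :=
  Real.rpow_le_one_of_one_le_of_nonpos (by linarith [Nat.cast_nonneg (α := ℝ) m])
    (neg_nonpos.2 (rateExp_pos hD hθ hξ).le)

theorem tendsto_rateScale {D : ℕ} (hD : 1 ≤ D) {θ ξ : ℝ} (hθ : 2 < θ) (hξ : 0 < ξ) :
    Tendsto (rateScale D θ ξ) atTop (𝓝 0) :=
  (tendsto_rpow_neg_atTop (rateExp_pos hD hθ hξ)).comp
    (tendsto_atTop_add_const_right _ _ tendsto_natCast_atTop_atTop)

theorem tendsto_rateScale_rpow {D : ℕ} (hD : 1 ≤ D) {θ ξ : ℝ} (hθ : 2 < θ) (hξ : 0 < ξ)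
    {a : ℝ} (ha : 0 < a) : Tendsto (fun m => rateScale D θ ξ m ^ a) atTop (𝓝 0) := by
  simpa [Real.zero_rpow ha.ne'] using (tendsto_rateScale hD hθ hξ).rpow_const (Or.inr ha.le)

theorem rateScale_le {D : ℕ} (hD : 1 ≤ D) {θ ξ : ℝ} (hθ : 2 < θ) (hξ : 0 < ξ) {m : ℕ}
    (hm : 1 ≤ m) : rateScale D θ ξ m ≤ (m : ℝ) ^ (-rateExp D θ ξ) :=
  Real.rpow_le_rpow_of_nonpos (by exact_mod_cast hm) (by linarith)
    (neg_nonpos.2 (rateExp_pos hD hθ hξ).le)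

/-- The full cube contained in the cells has side at least `δ^{-1/(θ-2)} - 1`. -/
theorem gridSide_mul_ge {D : ℕ} (hD : 1 ≤ D) {θ ξ : ℝ} (hθ : 2 < θ) (hξ : 0 < ξ) (m : ℕ) :
    rateScale D θ ξ m ^ (-(1 / (θ - 2))) - 1 ≤
      gridSide hD m * rateScale D θ ξ m ^ (2 + ξ) := by
  have hD' : (0 : ℝ) < D := by exact_mod_cast hD
  have h2 : 0 < θ - 2 := by linarith
  have hδ := rateScale_pos D θ ξ m
  have h1 : rateScale D θ ξ m ^ (-(2 + 1 / (θ - 2) + ξ)) ≤ gridSide hD m + 1 := by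
    have e : rateScale D θ ξ m ^ (-(2 + 1 / (θ - 2) + ξ)) = ((m : ℝ) + 1) ^ (D : ℝ)⁻¹ := by
      rw [rateScale, ← Real.rpow_mul (by positivity)]
      congr 1
      have : 2 + 1 / (θ - 2) + ξ ≠ 0 := by positivity
      rw [rateExp]; field_simp
    rw [e]
    have h3 : (m : ℝ) + 1 ≤ (gridSide hD m + 1 : ℝ) ^ (D : ℝ) := by
      rw [Real.rpow_natCast]
      exact_mod_cast lt_gridSide_pow hD m
    calc ((m : ℝ) + 1) ^ (D : ℝ)⁻¹ ≤ ((gridSide hD m + 1 : ℝ) ^ (D : ℝ)) ^ (D : ℝ)⁻¹ :=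
          Real.rpow_le_rpow (by positivity) h3 (by positivity)
      _ = _ := by rw [← Real.rpow_mul (by positivity), mul_inv_cancel₀ hD'.ne', Real.rpow_one]
  have h4 : rateScale D θ ξ m ^ (2 + ξ) ≤ 1 :=
    Real.rpow_le_one hδ.le (rateScale_le_one hD hθ hξ m) (by positivity)
  have h5 := mul_le_mul_of_nonneg_right h1 (Real.rpow_nonneg hδ.le (2 + ξ))
  rw [← Real.rpow_add hδ, show -(2 + 1 / (θ - 2) + ξ) + (2 + ξ) = -(1 / (θ - 2)) by ring,
    add_mul, one_mul] at h5
  linarith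

/-- Partition data with a lattice of side `δ^{2+ξ}` and bandwidth `δ^{1+ξ/(2D)}`. -/
noncomputable def ratePartition {D : ℕ} (hD : 1 ≤ D) {r : ℝ} (hr : 0 < r) {θ ξ : ℝ} (hθ : 2 < θ)
    (hξ : 0 < ξ) : CellPartition D r where
  center m := gridCenter hD m (rateScale D θ ξ m ^ (2 + ξ))
  h m := rateScale D θ ξ m ^ (2 + ξ)
  δ := rateScale D θ ξ
  σ m := rateScale D θ ξ m ^ (1 + ξ / (2 * D))
  σ0 := r
  h_pos m := Real.rpow_pos_of_pos (rateScale_pos D θ ξ m) _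
  δ_pos := rateScale_pos D θ ξ
  σ_pos m := Real.rpow_pos_of_pos (rateScale_pos D θ ξ m) _
  σ0_pos := hr
  disjoint m := disjoint_cell_gridCenter hD m (Real.rpow_pos_of_pos (rateScale_pos D θ ξ m) _)
  adjacent m j k :=
    adjacent_gridCenter hD m (Real.rpow_pos_of_pos (rateScale_pos D θ ξ m) _) j k
  h_lim := tendsto_rateScale_rpow hD hθ hξ (by positivity)
  δ_lim := tendsto_rateScale hD hθ hξ
  exhaust y := by
    have h2 : 0 < θ - 2 := by linarith
    have h1 : Tendsto (fun m => rateScale D θ ξ m ^ (-(1 / (θ - 2)))) atTop atTop := by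
      refine (tendsto_rpow_neg_nhdsGT_zero (neg_lt_zero.2 (by positivity : 0 < 1 / (θ - 2)))).comp ?_
      exact tendsto_nhdsWithin_iff.2 ⟨tendsto_rateScale hD hθ hξ,
        Eventually.of_forall fun m => rateScale_pos D θ ξ m⟩
    filter_upwards [h1.eventually_gt_atTop (2 * (‖y‖ + 1) + 1)] with m hm
    have h3 := gridSide_mul_ge hD hθ hξ m
    have h4 := rateScale_le_one hD hθ hξ m
    have h5 := rateScale_pos D θ ξ m
    have h6 := cube_subset_iUnion_cell hD m (y := y) (τ := rateScale D θ ξ m / 2)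
      (Real.rpow_pos_of_pos (rateScale_pos D θ ξ m) (2 + ξ)) fun i => by
        have : |y i| ≤ ‖y‖ := PiLp.norm_apply_le y i
        linarith
    rw [mul_div_cancel₀ _ (two_ne_zero' ℝ)] at h6
    exact Set.disjoint_compl_right_iff_subset.2 h6
  σ_δ := by
    have hD' : (0 : ℝ) < D := by exact_mod_cast hD
    refine (tendsto_rateScale_rpow hD hθ hξ (a := ξ / (2 * D)) (by positivity)).congr fun m => ?_
    have := rateScale_pos D θ ξ m
    rw [Real.rpow_add this, Real.rpow_one]
    field_simp
  δ_h_σ := by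
    have hD' : (0 : ℝ) < D := by exact_mod_cast hD
    refine (tendsto_rateScale_rpow hD hθ hξ (a := 1 + ξ / 2) (by positivity)).congr fun m => ?_
    have := rateScale_pos D θ ξ m
    rw [← Real.rpow_natCast, ← Real.rpow_natCast, ← Real.rpow_mul this.le, ← Real.rpow_add this,
      ← Real.rpow_sub this]
    congr 1
    push_cast [Nat.cast_sub hD]
    field_simp
    ring
  tail := by
    have h1 : (r / 2) ^ D / (2 * Real.pi * r ^ 2) ^ ((D : ℝ) / 2) =
        ((2 : ℝ) ^ D)⁻¹ * ((2 * Real.pi) ^ ((D : ℝ) / 2))⁻¹ := by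
      have : (r ^ 2) ^ ((D : ℝ) / 2) = r ^ D := by
        rw [← Real.rpow_natCast r 2, ← Real.rpow_mul hr.le, ← Real.rpow_natCast]
        congr 1; push_cast; ring
      rw [Real.mul_rpow (by positivity) (by positivity), this, div_pow]
      field_simp
    rw [h1, pow_succ, mul_inv]
    refine mul_le_mul_of_nonneg_left (inv_anti₀ two_pos ?_) (by positivity)
    have hpi := Real.pi_gt_three
    calc (2 : ℝ) = (4 : ℝ) ^ ((1 : ℝ) / 2) := by
          rw [show (4 : ℝ) = 2 ^ (2 : ℝ) by norm_num, ← Real.rpow_mul (by norm_num)]; norm_num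
      _ ≤ (2 * Real.pi) ^ ((1 : ℝ) / 2) :=
          Real.rpow_le_rpow (by norm_num) (by linarith) (by norm_num)
      _ ≤ (2 * Real.pi) ^ ((D : ℝ) / 2) := by
          refine Real.rpow_le_rpow_of_exponent_le (by linarith) ?_
          have : (1 : ℝ) ≤ D := by exact_mod_cast hD
          linarith


/-! ### Log-loss of the exact cell mixture -/

section Gradient

variable {D : ℕ}

theorem norm_fderiv_le_of_gradient_log {f : E D → ℝ} (hf : ContDiff ℝ 1 f) (hf0 : ∀ y, 0 ≤ f y)
    {x : E D} {S : ℝ} (hS : ‖gradient (fun u => Real.log (f u)) x‖ ≤ S) :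
    ‖fderiv ℝ f x‖ ≤ S * f x := by
  rcases (hf0 x).eq_or_lt with h | h
  · -- a zero of a nonnegative function is a minimum
    have : IsLocalMin f x := Eventually.of_forall fun u => h ▸ hf0 u
    rw [this.fderiv_eq_zero, norm_zero, ← h, mul_zero]
  · have h1 := ((hf.differentiable one_ne_zero) x).hasFDerivAt.log h.ne'
    rw [gradient, h1.fderiv, LinearIsometryEquiv.norm_map, norm_smul, norm_inv,
      Real.norm_of_nonneg h.le, inv_mul_le_iff₀ h] at hS
    linarith

/-- A bound on the logarithmic gradient on a cube gives a multiplicative lower bound, also where the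
density vanishes. -/
theorem mul_exp_le_of_gradient_log {f : E D → ℝ} (hf : ContDiff ℝ 1 f) (hf0 : ∀ y, 0 ≤ f y)
    {y u : E D} {r S : ℝ} (hu : u ∈ cube y r)
    (hS : ∀ x ∈ cube y r, ‖gradient (fun u => Real.log (f u)) x‖ ≤ S) :
    f y * Real.exp (-(S * ‖u - y‖)) ≤ f u := by
  let g : ℝ → ℝ := fun t => f (y + t • (u - y)) * Real.exp (S * ‖u - y‖ * t)
  have hmem : ∀ t ∈ Set.Icc (0 : ℝ) 1, y + t • (u - y) ∈ cube y r := by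
    intro t ht i
    have h1 := hu i
    simp only [PiLp.add_apply, PiLp.smul_apply, PiLp.sub_apply, smul_eq_mul, add_sub_cancel_left,
      abs_mul, abs_of_nonneg ht.1]
    nlinarith [abs_nonneg (u i - y i), ht.2]
  have hd : ∀ t, HasDerivAt g ((fderiv ℝ f (y + t • (u - y)) (u - y) +
      f (y + t • (u - y)) * (S * ‖u - y‖)) * Real.exp (S * ‖u - y‖ * t)) t := by
    intro t
    have h1 : HasDerivAt (fun t : ℝ => y + t • (u - y)) (u - y) t := by
      simpa using ((hasDerivAt_id t).smul_const (u - y)).const_add y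
    have h2 := ((hf.differentiable one_ne_zero) (y + t • (u - y))).hasFDerivAt.comp_hasDerivAt t h1
    have h3 : HasDerivAt (fun t : ℝ => Real.exp (S * ‖u - y‖ * t))
        (Real.exp (S * ‖u - y‖ * t) * (S * ‖u - y‖)) t := by
      simpa using ((hasDerivAt_id t).const_mul (S * ‖u - y‖)).exp
    convert! h2.mul h3 using 1
    simp only [Function.comp]
    ring
  have hmono : MonotoneOn g (Set.Icc 0 1) := by
    refine monotoneOn_of_deriv_nonneg (convex_Icc 0 1)
      (fun t _ => (hd t).continuousAt.continuousWithinAt)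
      (fun t _ => (hd t).differentiableAt.differentiableWithinAt) fun t ht => ?_
    rw [interior_Icc] at ht
    rw [(hd t).deriv]
    refine mul_nonneg ?_ (Real.exp_pos _).le
    have h1 := norm_fderiv_le_of_gradient_log hf hf0 (hS _ (hmem t ⟨ht.1.le, ht.2.le⟩))
    have h2 := (fderiv ℝ f (y + t • (u - y))).le_opNorm (u - y)
    have h3 := neg_le_of_abs_le (h2.trans (mul_le_mul_of_nonneg_right h1 (norm_nonneg _)))
    linarith
  have h01 := hmono (Set.left_mem_Icc.2 zero_le_one) (Set.right_mem_Icc.2 zero_le_one) zero_le_one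
  simp only [g, zero_smul, add_zero, mul_zero, Real.exp_zero, mul_one, one_smul,
    add_sub_cancel] at h01
  calc f y * Real.exp (-(S * ‖u - y‖))
      ≤ f u * Real.exp (S * ‖u - y‖) * Real.exp (-(S * ‖u - y‖)) := by gcongr
    _ = f u := by rw [mul_assoc, ← Real.exp_add, add_neg_cancel, Real.exp_zero, mul_one]

end Gradient

namespace CellPartition

variable {D : ℕ} {r : ℝ} (A : CellPartition D r)

/-- The Gaussian mixture whose weights are the cell probabilities of the density `f`. -/
noncomputable def cellMixture (f : E D → ℝ) (m : ℕ) (y : E D) : ℝ :=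
  ∑ j, (∫ u in A.cellAt m j, f u) * gaussDens (A.center m j) (A.σ m) y +
    (∫ u in A.rest m, f u) * gaussDens 0 A.σ0 y

theorem mixDens_logOdds {Z : Type*} {ρ : E D → Z → ℝ} {z : Z} (hD : 1 ≤ D)
    (hf : Integrable fun y => ρ y z) (hf0 : ∀ y, 0 ≤ ρ y z)
    (hpos : ∀ᵐ y, 0 < ρ y z) (hone : ∫ y, ρ y z = 1) (m : ℕ) :
    A.mixDens (A.logOdds ρ m z) = A.cellMixture (fun y => ρ y z) m := by
  obtain ⟨h2, h3⟩ := softmax_log_div (fun j => A.cellMass_pos hf hf0 hpos m j)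
    (A.restMass_pos hD hf hf0 hpos m) ((A.sum_integral_cellAt_add_rest hf).trans hone)
  funext y
  unfold mixDens cellMixture logOdds
  rw [h3]
  simp only [h2]

variable {f : E D → ℝ} {m : ℕ} {y : E D}

/-- Where a cube around the point lies in the union of the cells, the loss is governed by the
oscillation on the cube, the mesh and the Gaussian mass outside of the cube. -/
theorem log_div_cellMixture_le_of_subset (hf : Integrable f) (hf0 : ∀ y, 0 ≤ f y) (hy : 0 < f y)
    {τ S t : ℝ} (hτ : 0 < τ) (hS : 0 ≤ S) (hsub : cube y (2 * τ) ⊆ (A.rest m)ᶜ)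
    (hlow : ∀ u ∈ cube y (2 * τ), f y * Real.exp (-(S * ‖u - y‖)) ≤ f u)
    (hmass : Real.exp (-t) ≤ ∫ u in cube y (2 * τ), gaussDens y (A.σ m) u) :
    Real.log (f y / A.cellMixture f m y) ≤ Real.sqrt D * τ * S +
      D * (τ * A.h m + A.h m ^ 2 / 4) / (2 * A.σ m ^ 2) + t := by
  have hσ := A.σ_pos m
  have hgi := integrable_gaussDens y hσ
  set κ : ℝ := D * (τ * A.h m + A.h m ^ 2 / 4) / (2 * A.σ m ^ 2) with hκ
  have hkey := A.sum_mul_gaussDens_ge (m := m) hf hf0 y τ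
  rw [Set.inter_eq_right.2 hsub, ← hκ] at hkey
  have hfg : Integrable fun u => gaussDens y (A.σ m) u * f u :=
    hf.bdd_mul (continuous_gaussDens _ _).aestronglyMeasurable
      (c := (2 * Real.pi * A.σ m ^ 2) ^ (-(D : ℝ) / 2)) (ae_of_all _ fun u => by
        rw [Real.norm_of_nonneg (gaussDens_pos _ hσ _).le]; exact gaussDens_le _ _ _)
  have h1 : Real.exp (-t) * (f y * Real.exp (-(Real.sqrt D * τ * S))) ≤
      ∫ u in cube y (2 * τ), gaussDens y (A.σ m) u * f u := by
    calc _ ≤ (∫ u in cube y (2 * τ), gaussDens y (A.σ m) u) *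
          (f y * Real.exp (-(Real.sqrt D * τ * S))) := by gcongr
      _ = ∫ u in cube y (2 * τ), gaussDens y (A.σ m) u *
          (f y * Real.exp (-(Real.sqrt D * τ * S))) := by rw [integral_mul_const]
      _ ≤ _ := by
        refine setIntegral_mono_on (hgi.integrableOn.mul_const _) hfg.integrableOn
          (measurableSet_cube _ _) fun u hu => ?_
        refine mul_le_mul_of_nonneg_left (le_trans ?_ (hlow u hu)) (gaussDens_pos _ hσ _).le
        have := mul_le_mul_of_nonneg_left (norm_sub_le_of_mem_cube hτ.le hu) hS
        exact mul_le_mul_of_nonneg_left (Real.exp_le_exp.2 (by linarith)) hy.le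
  have h2 : Real.exp (-κ) * (Real.exp (-t) * (f y * Real.exp (-(Real.sqrt D * τ * S)))) ≤
      A.cellMixture f m y := by
    refine le_trans (mul_le_mul_of_nonneg_left h1 (Real.exp_pos _).le) (hkey.trans ?_)
    exact le_add_of_nonneg_right (mul_nonneg (integral_nonneg fun u => hf0 u)
      (gaussDens_pos _ A.σ0_pos _).le)
  have h3 : 0 < A.cellMixture f m y := lt_of_lt_of_le (by positivity) h2
  have h4 := Real.log_le_log (by positivity) h2
  rw [Real.log_mul (Real.exp_pos _).ne' (by positivity),
    Real.log_mul (Real.exp_pos _).ne' (by positivity),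
    Real.log_mul hy.ne' (Real.exp_pos _).ne', Real.log_exp, Real.log_exp, Real.log_exp] at h4
  rw [Real.log_div hy.ne' h3.ne']
  linarith

/-- A crude bound for the loss at an arbitrary point: half of the cube of side `2σ` around the
point lies in the union of the cells or in the remainder. -/
theorem log_div_cellMixture_le (hf : Integrable f) (hf0 : ∀ y, 0 ≤ f y) (hy : 0 < f y)
    {S : ℝ} (hS : 0 ≤ S) (hσ1 : A.σ m ≤ 1) (hhσ : A.h m ≤ A.σ m)
    (hlow : ∀ u ∈ cube y (2 * A.σ m), f y * Real.exp (-(S * ‖u - y‖)) ≤ f u) :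
    Real.log (f y / A.cellMixture f m y) ≤ Real.sqrt D * A.σ m * S +
      (|Real.log (2 ^ D / 2 * (2 * Real.pi) ^ (-(D : ℝ) / 2) * Real.exp (-(D : ℝ) / 2))| +
        |Real.log (2 ^ D / 2 * (2 * Real.pi * A.σ0 ^ 2) ^ (-(D : ℝ) / 2))| + D) +
      D * -Real.log (A.σ m) + ‖y‖ ^ 2 / (2 * A.σ0 ^ 2) := by
  have hσ := A.σ_pos m
  have hh := A.h_pos m
  have hσ0 := A.σ0_pos
  have hlog : 0 ≤ -Real.log (A.σ m) := by have := Real.log_nonpos hσ.le hσ1; linarith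
  have hQ := measurableSet_cube y (2 * A.σ m)
  have hR := A.measurableSet_rest (m := m)
  set k₁ : ℝ := 2 ^ D / 2 * (2 * Real.pi) ^ (-(D : ℝ) / 2) * Real.exp (-(D : ℝ) / 2) with hk₁
  set k₂ : ℝ := 2 ^ D / 2 * (2 * Real.pi * A.σ0 ^ 2) ^ (-(D : ℝ) / 2) with hk₂
  set c : ℝ := f y * Real.exp (-(Real.sqrt D * A.σ m * S)) with hc
  have hcpos : 0 < c := by positivity
  have hlow' : ∀ u ∈ cube y (2 * A.σ m), c ≤ f u := fun u hu => by
    refine le_trans ?_ (hlow u hu)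
    have := mul_le_mul_of_nonneg_left (norm_sub_le_of_mem_cube hσ.le hu) hS
    exact mul_le_mul_of_nonneg_left (Real.exp_le_exp.2 (by linarith)) hy.le
  have hvolQ : volume.real (cube y (2 * A.σ m)) = (2 * A.σ m) ^ D := by
    rw [measureReal_def, volume_cube, ENNReal.toReal_pow, ENNReal.toReal_ofReal (by positivity)]
  have hfin : volume (cube y (2 * A.σ m)) ≠ ∞ := by
    rw [volume_cube]; exact (ENNReal.pow_lt_top ENNReal.ofReal_lt_top).ne
  have hsplit : volume.real (A.rest m ∩ cube y (2 * A.σ m)) +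
      volume.real ((A.rest m)ᶜ ∩ cube y (2 * A.σ m)) = (2 * A.σ m) ^ D := by
    rw [← hvolQ, Set.inter_comm, Set.inter_comm (A.rest m)ᶜ, ← Set.sdiff_eq]
    exact measureReal_inter_add_sdiff hR hfin
  -- the logarithm of the mixture in terms of a lower bound `c * b`
  have hlogc : Real.log c = Real.log (f y) - Real.sqrt D * A.σ m * S := by
    rw [hc, Real.log_mul hy.ne' (Real.exp_pos _).ne', Real.log_exp]; ring
  have hfinish : ∀ b : ℝ, 0 < b → c * b ≤ A.cellMixture f m y →
      Real.log (f y / A.cellMixture f m y) ≤ Real.sqrt D * A.σ m * S - Real.log b := by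
    intro b hb hle
    have h3 : 0 < A.cellMixture f m y := lt_of_lt_of_le (by positivity) hle
    have h4 := Real.log_le_log (by positivity) hle
    rw [Real.log_mul hcpos.ne' hb.ne', hlogc] at h4
    rw [Real.log_div hy.ne' h3.ne']
    linarith
  have habs1 := neg_abs_le (Real.log k₁)
  have habs2 := neg_abs_le (Real.log k₂)
  have hn1 := abs_nonneg (Real.log k₁)
  have hn2 := abs_nonneg (Real.log k₂)
  have hD0 : (0 : ℝ) ≤ D := Nat.cast_nonneg D
  have hyy : 0 ≤ ‖y‖ ^ 2 / (2 * A.σ0 ^ 2) := by positivity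
  have hDl := mul_nonneg hD0 hlog
  have hsum0 : 0 ≤ ∑ j, (∫ u in A.cellAt m j, f u) * gaussDens (A.center m j) (A.σ m) y :=
    Finset.sum_nonneg fun j _ => mul_nonneg (integral_nonneg fun u => hf0 u)
      (gaussDens_pos _ hσ _).le
  rcases le_total (volume.real ((A.rest m)ᶜ ∩ cube y (2 * A.σ m)))
    (volume.real (A.rest m ∩ cube y (2 * A.σ m))) with hcase | hcase
  · -- half of the cube lies in the remainder
    have h1 : c * ((2 * A.σ m) ^ D / 2) ≤ ∫ u in A.rest m, f u := by
      calc c * ((2 * A.σ m) ^ D / 2) ≤ c * volume.real (A.rest m ∩ cube y (2 * A.σ m)) := by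
            gcongr; linarith
        _ = ∫ _ in A.rest m ∩ cube y (2 * A.σ m), c := by
            rw [setIntegral_const, smul_eq_mul, mul_comm]
        _ ≤ ∫ u in A.rest m ∩ cube y (2 * A.σ m), f u := by
            refine setIntegral_mono_on (integrableOn_const ?_) hf.integrableOn (hR.inter hQ)
              fun u hu => hlow' u hu.2
            exact ((measure_mono Set.inter_subset_right).trans_lt hfin.lt_top).ne
        _ ≤ _ := setIntegral_mono_set hf.integrableOn (ae_of_all _ hf0)
            (Set.inter_subset_left.eventuallyLE)
    have h2 : c * (k₂ * A.σ m ^ D * Real.exp (-(‖y‖ ^ 2 / (2 * A.σ0 ^ 2)))) ≤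
        A.cellMixture f m y := by
      have h3 := mul_le_mul_of_nonneg_right h1 (gaussDens_pos (0 : E D) hσ0 y).le
      have e : c * ((2 * A.σ m) ^ D / 2) * gaussDens 0 A.σ0 y =
          c * (k₂ * A.σ m ^ D * Real.exp (-(‖y‖ ^ 2 / (2 * A.σ0 ^ 2)))) := by
        rw [gaussDens, sub_zero, neg_div (2 * A.σ0 ^ 2), mul_pow, hk₂]; ring
      rw [← e]
      exact h3.trans (le_add_of_nonneg_left hsum0)
    have h5 := hfinish _ (by positivity) h2
    rw [Real.log_mul (by positivity) (Real.exp_pos _).ne', Real.log_mul (by positivity)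
      (by positivity), Real.log_exp, Real.log_pow] at h5
    linarith
  · -- half of the cube lies in the cells
    have hg : ∀ u ∈ cube y (2 * A.σ m),
        (2 * Real.pi * A.σ m ^ 2) ^ (-(D : ℝ) / 2) * Real.exp (-(D : ℝ) / 2) ≤
          gaussDens y (A.σ m) u := by
      intro u hu
      unfold gaussDens
      refine mul_le_mul_of_nonneg_left (Real.exp_le_exp.2 ?_) (by positivity)
      have h1 := norm_sub_le_of_mem_cube hσ.le hu
      have h2 : ‖u - y‖ ^ 2 ≤ D * A.σ m ^ 2 := by
        calc ‖u - y‖ ^ 2 ≤ (Real.sqrt D * A.σ m) ^ 2 := by gcongr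
          _ = _ := by rw [mul_pow, Real.sq_sqrt hD0]
      rw [neg_div, neg_div, neg_le_neg_iff, div_le_div_iff₀ (by positivity) two_pos]
      linarith
    set g₀ : ℝ := (2 * Real.pi * A.σ m ^ 2) ^ (-(D : ℝ) / 2) * Real.exp (-(D : ℝ) / 2) with hg₀
    have hfg : Integrable fun u => gaussDens y (A.σ m) u * f u :=
      hf.bdd_mul (continuous_gaussDens _ _).aestronglyMeasurable
        (c := (2 * Real.pi * A.σ m ^ 2) ^ (-(D : ℝ) / 2)) (ae_of_all _ fun u => by
          rw [Real.norm_of_nonneg (gaussDens_pos _ hσ _).le]; exact gaussDens_le _ _ _)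
    have h1 : g₀ * c * ((2 * A.σ m) ^ D / 2) ≤
        ∫ u in (A.rest m)ᶜ ∩ cube y (2 * A.σ m), gaussDens y (A.σ m) u * f u := by
      calc g₀ * c * ((2 * A.σ m) ^ D / 2)
          ≤ g₀ * c * volume.real ((A.rest m)ᶜ ∩ cube y (2 * A.σ m)) := by gcongr; linarith
        _ = ∫ _ in (A.rest m)ᶜ ∩ cube y (2 * A.σ m), g₀ * c := by
            rw [setIntegral_const, smul_eq_mul, mul_comm]
        _ ≤ _ := by
            refine setIntegral_mono_on (integrableOn_const ?_) hfg.integrableOn (hR.compl.inter hQ)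
              fun u hu => mul_le_mul (hg u hu.2) (hlow' u hu.2) hcpos.le (gaussDens_pos _ hσ _).le
            exact ((measure_mono Set.inter_subset_right).trans_lt hfin.lt_top).ne
    have hκ : Real.exp (-(D : ℝ)) ≤ Real.exp (-(D * (A.σ m * A.h m + A.h m ^ 2 / 4) /
        (2 * A.σ m ^ 2))) := by
      refine Real.exp_le_exp.2 (neg_le_neg ?_)
      rw [div_le_iff₀ (by positivity)]
      refine mul_le_mul_of_nonneg_left ?_ hD0
      nlinarith
    have h2 : c * (Real.exp (-(D : ℝ)) * k₁) ≤ A.cellMixture f m y := by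
      have e : Real.exp (-(D : ℝ)) * (g₀ * c * ((2 * A.σ m) ^ D / 2)) =
          c * (Real.exp (-(D : ℝ)) * k₁) := by
        have h4 : (A.σ m ^ 2) ^ (-(D : ℝ) / 2) = (A.σ m ^ D)⁻¹ := by
          rw [← Real.rpow_natCast, ← Real.rpow_mul hσ.le, ← Real.rpow_natCast,
            ← Real.rpow_neg hσ.le]
          congr 1; push_cast; ring
        rw [hg₀, hk₁, Real.mul_rpow (x := 2 * Real.pi) (by positivity) (by positivity), h4, mul_pow]
        field_simp
      rw [← e]
      refine le_trans (mul_le_mul hκ h1 (by positivity) (Real.exp_pos _).le) ?_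
      refine (A.sum_mul_gaussDens_ge hf hf0 y (A.σ m)).trans ?_
      exact le_add_of_nonneg_right (mul_nonneg (integral_nonneg fun u => hf0 u)
        (gaussDens_pos _ hσ0 _).le)
    have h5 := hfinish _ (by positivity) h2
    rw [Real.log_mul (Real.exp_pos _).ne' (by positivity), Real.log_exp] at h5
    linarith

end CellPartition


/-! ### The explicit rate -/

/-- Outside of the cube covered by the cells the crude bound is absorbed by the `θ`-th moments. -/
theorem tail_le_moment {D : ℕ} {θ : ℝ} (hθ : 2 < θ) {δ : ℝ} (hδ : 0 < δ) (hδ1 : δ ≤ 1)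
    {y : E D} {i : Fin D} (hi : δ ^ (-(1 / (θ - 2))) / 4 ≤ |y i|) {c₁ c₂ c₃ : ℝ} (h1 : 0 ≤ c₁)
    (h2 : 0 ≤ c₂) (h3 : 0 ≤ c₃) :
    c₁ + c₂ * -Real.log δ + c₃ * ‖y‖ ^ 2 ≤
      δ * ((16 * (c₁ + c₂ * ((θ - 2) / 2)) + c₃ * D) * 4 ^ (θ - 2) * ∑ i, |y i| ^ θ) := by
  have hθ2 : 0 < θ - 2 := by linarith
  set a : ℝ := 1 / (θ - 2) with ha
  have ha0 : 0 < a := by positivity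
  have : Nonempty (Fin D) := ⟨i⟩
  obtain ⟨j, hj⟩ := Finite.exists_max fun i => |y i|
  set Y : ℝ := |y j| with hY
  have hL : 0 < δ ^ (-a) / 4 := by positivity
  have hLY : δ ^ (-a) / 4 ≤ Y := hi.trans (hj i)
  have hY0 : 0 < Y := hL.trans_le hLY
  have hnorm : ‖y‖ ^ 2 ≤ D * Y ^ 2 := by
    rw [EuclideanSpace.norm_sq_eq]
    calc ∑ i, ‖y i‖ ^ 2 ≤ ∑ _i : Fin D, Y ^ 2 := by
          refine Finset.sum_le_sum fun i _ => ?_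
          rw [Real.norm_eq_abs]
          exact pow_le_pow_left₀ (abs_nonneg _) (hj i) 2
      _ = D * Y ^ 2 := by simp
  -- the powers of the scale
  have hpow : (δ ^ (-a)) ^ 2 ≤ 16 * Y ^ 2 := by
    have := pow_le_pow_left₀ hL.le hLY 2
    rw [div_pow] at this
    linarith
  have hY2 : Y ^ 2 ≤ δ * (4 ^ (θ - 2) * Y ^ θ) := by
    have e : Y ^ θ = Y ^ 2 * Y ^ (θ - 2) := by
      rw [← Real.rpow_natCast Y 2, ← Real.rpow_add hY0]; congr 1; push_cast; ring
    have h4 : 1 ≤ δ * (4 ^ (θ - 2) * Y ^ (θ - 2)) := by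
      have h5 := Real.rpow_le_rpow hL.le hLY hθ2.le
      rw [Real.div_rpow (by positivity) (by norm_num), ← Real.rpow_mul hδ.le,
        show -a * (θ - 2) = -1 by rw [ha]; field_simp, Real.rpow_neg_one,
        div_le_iff₀ (by positivity)] at h5
      have h6 := mul_le_mul_of_nonneg_left h5 hδ.le
      rw [mul_inv_cancel₀ hδ.ne'] at h6
      linarith
    rw [e]
    calc Y ^ 2 ≤ Y ^ 2 * (δ * (4 ^ (θ - 2) * Y ^ (θ - 2))) := le_mul_of_one_le_right (by positivity) h4
      _ = _ := by ring
  have hYsum : Y ^ θ ≤ ∑ i, |y i| ^ θ :=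
    Finset.single_le_sum (f := fun i => |y i| ^ θ) (fun i _ => by positivity) (Finset.mem_univ j)
  have hlog : -Real.log δ ≤ (θ - 2) / 2 * (δ ^ (-a)) ^ 2 := by
    have h5 := Real.log_le_rpow_div (x := δ⁻¹) (by positivity) (by positivity : 0 < 2 * a)
    rw [Real.log_inv, Real.inv_rpow hδ.le, ← Real.rpow_neg hδ.le] at h5
    refine h5.trans (le_of_eq ?_)
    rw [← Real.rpow_natCast (δ ^ (-a)) 2, ← Real.rpow_mul hδ.le,
      show -(2 * a) = -a * ((2 : ℕ) : ℝ) by push_cast; ring]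
    rw [ha]; field_simp
  have hone : 1 ≤ (δ ^ (-a)) ^ 2 :=
    one_le_pow₀ (Real.one_le_rpow_of_pos_of_le_one_of_nonpos hδ hδ1 (by linarith))
  calc c₁ + c₂ * -Real.log δ + c₃ * ‖y‖ ^ 2
      ≤ c₁ * (δ ^ (-a)) ^ 2 + c₂ * ((θ - 2) / 2 * (δ ^ (-a)) ^ 2) + c₃ * (D * Y ^ 2) := by
        gcongr
        exact le_mul_of_one_le_right h1 hone
    _ = (c₁ + c₂ * ((θ - 2) / 2)) * (δ ^ (-a)) ^ 2 + c₃ * D * Y ^ 2 := by ring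
    _ ≤ (c₁ + c₂ * ((θ - 2) / 2)) * (16 * Y ^ 2) + c₃ * D * Y ^ 2 := by gcongr
    _ = (16 * (c₁ + c₂ * ((θ - 2) / 2)) + c₃ * D) * Y ^ 2 := by ring
    _ ≤ (16 * (c₁ + c₂ * ((θ - 2) / 2)) + c₃ * D) * (δ * (4 ^ (θ - 2) * ∑ i, |y i| ^ θ)) := by
        refine mul_le_mul_of_nonneg_left (hY2.trans ?_) (by positivity)
        gcongr
    _ = _ := by ring

/-- Uniformly over densities, the logarithmic loss of the exact cell mixture is `O(δ_m)`. -/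
theorem exists_log_div_ratePartition_le {D : ℕ} (hD : 1 ≤ D) {r : ℝ} (hr : 0 < r) {θ ξ : ℝ}
    (hθ : 2 < θ) (hξ : 0 < ξ) : ∃ c : ℝ, 0 ≤ c ∧ ∀ᶠ m in atTop, ∀ f : E D → ℝ, Integrable f →
      (∀ y, 0 ≤ f y) → ∀ y, 0 < f y → ∀ S : ℝ, 0 ≤ S →
      (∀ u ∈ cube y r, f y * Real.exp (-(S * ‖u - y‖)) ≤ f u) →
      Real.log (f y / (ratePartition hD hr hθ hξ).cellMixture f m y) ≤
        rateScale D θ ξ m * (Real.sqrt D * S + ((D : ℝ) + 1 + c * ∑ i, |y i| ^ θ)) := by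
  have hD' : (1 : ℝ) ≤ D := by exact_mod_cast hD
  have hD0 : (0 : ℝ) < D := by linarith
  have hθ2 : 0 < θ - 2 := by linarith
  set A := ratePartition hD hr hθ hξ with hA
  set ζ : ℝ := ξ / (2 * D) with hζ
  have hζ0 : 0 < ζ := by positivity
  set c₁ : ℝ := |Real.log (2 ^ D / 2 * (2 * Real.pi) ^ (-(D : ℝ) / 2) *
      Real.exp (-(D : ℝ) / 2))| +
    |Real.log (2 ^ D / 2 * (2 * Real.pi * r ^ 2) ^ (-(D : ℝ) / 2))| + D with hc₁
  have hc₁0 : 0 ≤ c₁ := by positivity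
  set c₂ : ℝ := D * (1 + ζ) with hc₂
  set c₃ : ℝ := 1 / (2 * r ^ 2) with hc₃
  refine ⟨(16 * (c₁ + c₂ * ((θ - 2) / 2)) + c₃ * D) * 4 ^ (θ - 2), by positivity, ?_⟩
  have hδ0 := rateScale_pos D θ ξ
  have hδ1 := rateScale_le_one hD hθ hξ
  have hlim := tendsto_rateScale hD hθ hξ
  have hlim' : Tendsto (rateScale D θ ξ) atTop (𝓝[>] 0) :=
    tendsto_nhdsWithin_iff.2 ⟨hlim, Eventually.of_forall hδ0⟩
  have hE3 : Tendsto (fun m => rateScale D θ ξ m ^ (-(1 / (θ - 2)))) atTop atTop :=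
    (tendsto_rpow_neg_nhdsGT_zero (neg_lt_zero.2 (by positivity : 0 < 1 / (θ - 2)))).comp hlim'
  have hE2 : Tendsto (fun m => (rateScale D θ ξ m)⁻¹ *
      Real.exp (-(1 / 4) * rateScale D θ ξ m ^ (-(2 * ζ)))) atTop (𝓝 0) := by
    have h1 : Tendsto (fun m => rateScale D θ ξ m ^ (-(2 * ζ))) atTop atTop :=
      (tendsto_rpow_neg_nhdsGT_zero (neg_lt_zero.2 (by positivity))).comp hlim'
    refine ((tendsto_rpow_mul_exp_neg_mul_atTop_nhds_zero (1 / (2 * ζ)) (1 / 4)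
      (by norm_num)).comp h1).congr fun m => ?_
    simp only [Function.comp]
    rw [← Real.rpow_mul (hδ0 m).le, show -(2 * ζ) * (1 / (2 * ζ)) = -1 by field_simp,
      Real.rpow_neg_one]
  filter_upwards [hlim.eventually (eventually_le_nhds (half_pos hr)),
    hE3.eventually_ge_atTop 6,
    hE2.eventually (eventually_le_nhds
      (by positivity : (0 : ℝ) < (2 * 2 ^ ((D : ℝ) / 2))⁻¹))] with m hm1 hm3 hm2 f hf hf0 y hy S hS
      hlow
  set δ : ℝ := rateScale D θ ξ m with hδ
  have hδp : 0 < δ := hδ0 m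
  have hδle : δ ≤ 1 := hδ1 m
  have hσ : A.σ m = δ ^ (1 + ζ) := rfl
  have hh : A.h m = δ ^ (2 + ξ) := rfl
  have hσ0 : A.σ0 = r := rfl
  have hζξ : 2 * ζ ≤ ξ := by
    rw [hζ, show 2 * (ξ / (2 * D)) = ξ / D by field_simp, div_le_iff₀ hD0]
    nlinarith
  have hσδ : A.σ m ≤ δ := by
    rw [hσ]
    simpa using Real.rpow_le_rpow_of_exponent_ge hδp hδle (by linarith : (1 : ℝ) ≤ 1 + ζ)
  have hhσ : A.h m ≤ A.σ m := by
    rw [hσ, hh]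
    exact Real.rpow_le_rpow_of_exponent_ge hδp hδle (by linarith)
  have hσp := A.σ_pos m
  have hhp := A.h_pos m
  have hmoment : 0 ≤ (16 * (c₁ + c₂ * ((θ - 2) / 2)) + c₃ * D) * 4 ^ (θ - 2) *
      ∑ i, |y i| ^ θ := by positivity
  by_cases hint : ∀ i, |y i| + δ < gridSide hD m * A.h m / 2
  · -- the cube of side `2δ` around the point is covered by the cells
    have hsub : cube y (2 * δ) ⊆ (A.rest m)ᶜ := by
      rw [CellPartition.rest, compl_compl]
      exact cube_subset_iUnion_cell hD m hhp hint
    have hmass : Real.exp (-δ) ≤ ∫ u in cube y (2 * δ), gaussDens y (A.σ m) u := by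
      refine le_trans ?_ (integral_cube_gaussDens_ge y hσp hδp)
      have e : -δ ^ 2 / (4 * A.σ m ^ 2) = -(1 / 4) * δ ^ (-(2 * ζ)) := by
        have : A.σ m ^ 2 = δ ^ 2 * δ ^ (2 * ζ) := by
          rw [hσ, Real.rpow_add hδp, Real.rpow_one, mul_pow, ← Real.rpow_natCast (δ ^ ζ),
            ← Real.rpow_mul hδp.le]
          congr 2; push_cast; ring
        rw [this, Real.rpow_neg hδp.le]
        field_simp
      rw [e]
      rw [inv_mul_le_iff₀ hδp, ← div_eq_mul_inv, le_div_iff₀ (by positivity)] at hm2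
      have h1 : Real.exp (-δ) ≤ 1 - δ / 2 := by
        rw [Real.exp_neg, inv_le_iff_one_le_mul₀ (Real.exp_pos _)]
        have := Real.add_one_le_exp δ
        nlinarith
      linarith
    have h1 := A.log_div_cellMixture_le_of_subset hf hf0 hy hδp hS hsub
      (fun u hu => hlow u fun i => (hu i).trans (by linarith)) hmass
    have h2 : D * (δ * A.h m + A.h m ^ 2 / 4) / (2 * A.σ m ^ 2) ≤ D * δ := by
      have h3 : A.h m ≤ A.σ m ^ 2 := by
        rw [hσ, hh, ← Real.rpow_natCast, ← Real.rpow_mul hδp.le]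
        refine Real.rpow_le_rpow_of_exponent_ge hδp hδle ?_
        push_cast; linarith
      rw [div_le_iff₀ (by positivity), mul_assoc]
      refine mul_le_mul_of_nonneg_left ?_ hD0.le
      have h4 := mul_le_mul_of_nonneg_left h3 hδp.le
      have h5 := mul_le_mul_of_nonneg_right (hhσ.trans hσδ) hhp.le
      nlinarith
    have h6 := mul_nonneg hδp.le hmoment
    calc _ ≤ _ := h1
      _ ≤ Real.sqrt D * δ * S + D * δ + δ := by linarith
      _ ≤ _ := by linarith
  · -- the point is far away
    push Not at hint
    obtain ⟨i, hi⟩ := hint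
    have hfar : δ ^ (-(1 / (θ - 2))) / 4 ≤ |y i| := by
      have := gridSide_mul_ge hD hθ hξ m
      rw [← hδ, ← hh] at this
      linarith
    have h1 := A.log_div_cellMixture_le hf hf0 hy hS (hσδ.trans hδle) hhσ
      (fun u hu => hlow u fun i => (hu i).trans (by linarith))
    rw [hσ0, ← hc₁, hσ, Real.log_rpow hδp] at h1
    have h2 := tail_le_moment hθ hδp hδle hfar hc₁0 (by positivity : 0 ≤ c₂)
      (by positivity : 0 ≤ c₃)
    have h3 : Real.sqrt D * δ ^ (1 + ζ) * S ≤ Real.sqrt D * δ * S := by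
      rw [hσ] at hσδ
      gcongr
    have h4 : c₃ * ‖y‖ ^ 2 = ‖y‖ ^ 2 / (2 * r ^ 2) := by rw [hc₃]; ring
    have h5 : c₂ * -Real.log δ = D * -((1 + ζ) * Real.log δ) := by rw [hc₂]; ring
    have h6 : 0 ≤ δ * ((D : ℝ) + 1) := by positivity
    rw [h4, h5] at h2
    linarith

namespace Features

variable {C : Type*} [MeasurableSpace C] {D T : ℕ} {F : Features C D T} {S : Diffusion C D T}

/-- The stepwise rate: the loss of the exact mixtures is at most a multiple of `m^{-β}`. -/
theorem Valid.exists_logLoss_exactDens_le {r : Fin T → ℝ} (hD : 1 ≤ D) (hr : ∀ t, 0 < r t)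
    (hF : F.Valid S) (hS : S.Regular r) (t : Fin T) {θ ξ : ℝ} (hθ : 2 < θ) (hξ : 0 < ξ)
    (hC : F.C1Branch S t (r t) θ) : ∃ c : ℝ, 0 ≤ c ∧ ∀ᶠ m : ℕ in atTop,
      F.logLoss S t (fun z => (ratePartition hD (hr t) hθ hξ).mixDens
        ((ratePartition hD (hr t) hθ hξ).logOdds (F.ρ t) m z)) ≤
        ENNReal.ofReal (c * (m : ℝ) ^ (-rateExp D θ ξ)) := by
  have hprob := F.isProbabilityMeasure_law S t
  have hD0 : (0 : ℝ) < D := by exact_mod_cast hD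
  obtain ⟨c, hc0, hc⟩ := exists_log_div_ratePartition_le hD (hr t) hθ hξ
  set A := ratePartition hD (hr t) hθ hξ with hA
  let G : E D × E (F.d t) → ℝ≥0∞ := fun w =>
    ENNReal.ofReal (Real.sqrt D) * F.gradSup t (r t) w.1 w.2
  let H : E D × E (F.d t) → ℝ≥0∞ := fun w =>
    ENNReal.ofReal ((D : ℝ) + 1) + ENNReal.ofReal c * ∑ i, ENNReal.ofReal (|w.1 i| ^ θ)
  have hHm : Measurable H := by
    have : ∀ i, Measurable fun w : E D × E (F.d t) => |w.1 i| ^ θ := fun i =>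
      (Measurable.abs (by fun_prop)).pow_const θ
    fun_prop
  have hH : ∫⁻ w, H w ∂(F.law S t) < ∞ := by
    have : ∀ i, Measurable fun w : E D × E (F.d t) => |w.1 i| ^ θ := fun i =>
      (Measurable.abs (by fun_prop)).pow_const θ
    simp only [H]
    rw [lintegral_add_left measurable_const, lintegral_const, measure_univ, mul_one,
      lintegral_const_mul _ (by fun_prop), lintegral_finsetSum _ fun i _ => by fun_prop]
    exact ENNReal.add_lt_top.2 ⟨ENNReal.ofReal_lt_top, ENNReal.mul_lt_top ENNReal.ofReal_lt_top
      (ENNReal.sum_lt_top.2 fun i _ => hC.moment i)⟩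
  have hG : ∫⁻ w, G w ∂(F.law S t) < ∞ := by
    simp only [G]
    rw [lintegral_const_mul' _ _ ENNReal.ofReal_ne_top]
    exact ENNReal.mul_lt_top ENNReal.ofReal_lt_top hC.gradIntegrable
  have hGH : ∫⁻ w, (G w + H w) ∂(F.law S t) ≠ ∞ := by
    rw [lintegral_add_right _ hHm]
    exact (ENNReal.add_lt_top.2 ⟨hG, hH⟩).ne
  refine ⟨(∫⁻ w, (G w + H w) ∂(F.law S t)).toReal, ENNReal.toReal_nonneg, ?_⟩
  filter_upwards [hc, eventually_ge_atTop 1] with m hm hm1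
  have hδ := rateScale_pos D θ ξ m
  calc F.logLoss S t (fun z => A.mixDens (A.logOdds (F.ρ t) m z))
      ≤ ∫⁻ w, ENNReal.ofReal (rateScale D θ ξ m) * (G w + H w) ∂(F.law S t) := by
        refine lintegral_mono_ae ?_
        filter_upwards [F.ae_law_of_ae_featLaw S t (hF.ae_density hS t),
          F.ae_law_of_ae_featLaw S t hC.smooth] with w ⟨_, hi, hone, hpos⟩ hsm
        rw [A.mixDens_logOdds hD hi (fun y => hF.nonneg t y _) hpos hone]
        rcases (hF.nonneg t w.1 w.2).eq_or_lt with h0 | h0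
        · simp [← h0]
        by_cases htop : F.gradSup t (r t) w.1 w.2 = ∞
        · have : G w = ∞ := by
            simp only [G, htop]
            exact ENNReal.mul_top (by simpa using Nat.lt_of_lt_of_le one_pos hD)
          rw [this, top_add, ENNReal.mul_top (by simpa using hδ)]
          exact le_top
        have hgrad : ∀ x ∈ cube w.1 (r t),
            ‖gradient (fun u => Real.log (F.ρ t u w.2)) x‖ ≤
              (F.gradSup t (r t) w.1 w.2).toReal := fun x hx => by
          rw [← ENNReal.ofReal_le_iff_le_toReal htop]
          exact le_iSup₂ (f := fun x (_ : x ∈ cube w.1 (r t)) =>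
            ENNReal.ofReal ‖gradient (fun u => Real.log (F.ρ t u w.2)) x‖) x hx
        have key := hm (fun y => F.ρ t y w.2) hi (fun y => hF.nonneg t y _) w.1 h0
          (F.gradSup t (r t) w.1 w.2).toReal ENNReal.toReal_nonneg fun u hu =>
            mul_exp_le_of_gradient_log hsm (fun y => hF.nonneg t y _) hu hgrad
        refine (ENNReal.ofReal_le_ofReal key).trans (le_of_eq ?_)
        have hs : 0 ≤ ∑ i, |w.1 i| ^ θ := Finset.sum_nonneg fun i _ => by positivity
        simp only [G, H]
        rw [ENNReal.ofReal_mul hδ.le, ENNReal.ofReal_add (by positivity) (by positivity),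
          ENNReal.ofReal_mul (Real.sqrt_nonneg _), ENNReal.ofReal_toReal htop,
          ENNReal.ofReal_add (by positivity) (by positivity), ENNReal.ofReal_mul hc0,
          ENNReal.ofReal_sum_of_nonneg fun i _ => by positivity]
    _ = ENNReal.ofReal (rateScale D θ ξ m) * ∫⁻ w, (G w + H w) ∂(F.law S t) :=
        lintegral_const_mul' _ _ ENNReal.ofReal_ne_top
    _ = ENNReal.ofReal ((∫⁻ w, (G w + H w) ∂(F.law S t)).toReal * rateScale D θ ξ m) := by
        rw [ENNReal.ofReal_mul ENNReal.toReal_nonneg, ENNReal.ofReal_toReal hGH, mul_comm]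
    _ ≤ _ := by
        refine ENNReal.ofReal_le_ofReal ?_
        exact mul_le_mul_of_nonneg_left (rateScale_le hD hθ hξ hm1) ENNReal.toReal_nonneg

end Features


/-! ### Neural reverse models -/

section Neural

variable {C : Type*} [MeasurableSpace C] {D T : ℕ} {r : Fin T → ℝ} {F : Features C D T}
  {S : Diffusion C D T}

theorem ReLUNet.measurable_eval {a b : ℕ} (N : ReLUNet a b) :
    Measurable fun x : E a => N.eval x :=
  (N.continuous_eval.comp (PiLp.continuous_ofLp 2 _)).measurable

theorem NeuralModel.kernel_apply (A : ∀ t, CellPartition D (r t)) (N : NeuralModel F.d)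
    (t : Fin T) (p : C × E D) : N.kernel F A t p =
      volume.withDensity fun y => ENNReal.ofReal ((A t).mixDens ((N.net t).eval (F.φ t p)) y) := by
  have hm : Measurable (Function.uncurry fun (p : C × E D) (y : E D) =>
      ENNReal.ofReal ((A t).mixDens ((N.net t).eval (F.φ t p)) y)) :=
    ((A t).measurable_mixDens (u := fun p : C × E D => (N.net t).eval (F.φ t p))
      ((N.net t).measurable_eval.comp (F.φ_meas t))).ennreal_ofReal
  rw [NeuralModel.kernel, Kernel.withDensity_apply _ hm, Kernel.const_apply]

/-- The excess of the output error over the terminal mismatch is at most the sum of the stepwise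
losses. -/
theorem Features.Valid.outputKL_predictor_le (hF : F.Valid S) (A : ∀ t, CellPartition D (r t))
    (N : NeuralModel F.d) : S.outputKL (N.predictor S F A) ≤
      S.meanComp + ∑ t, F.logLoss S t fun z => (A t).mixDens ((N.net t).eval z) := by
  refine (S.outputKL_predictor_le _ fun t => ⟨fun p => ?_⟩).trans ?_
  · rw [N.kernel_apply]
    exact (A t).isProbabilityMeasure_mixDens _
  · gcongr with t
    have hm : Measurable (Function.uncurry fun (z : E (F.d t)) (y : E D) =>
        (A t).mixDens ((N.net t).eval z) y) :=
      (A t).measurable_mixDens (u := fun z : E (F.d t) => (N.net t).eval z)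
        (N.net t).measurable_eval
    have hpos : ∀ (z : E (F.d t)) (y : E D), 0 < (A t).mixDens ((N.net t).eval z) y :=
      fun z y => (A t).mixDens_pos _ y
    have hprob : ∀ z : E (F.d t), IsProbabilityMeasure (volume.withDensity fun y =>
        ENNReal.ofReal ((A t).mixDens ((N.net t).eval z) y)) :=
      fun z => (A t).isProbabilityMeasure_mixDens _
    refine (lintegral_congr fun w => ?_).trans_le
      (hF.lintegral_klDiv_reverseKernel_le t hm hpos hprob)
    rw [N.kernel_apply]

theorem SmoothLogOdds.exists_continuousOn {A : ∀ t, CellPartition D (r t)}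
    (h : SmoothLogOdds F A) (t : Fin T) {m : ℕ} (hm : 1 ≤ m) (j : Fin m) :
    ∃ L : E (F.d t) → ℝ, ContinuousOn L (F.K t) ∧
      ∀ z ∈ F.K t, L z = (A t).logOdds (F.ρ t) m z j := by
  obtain ⟨-, hK, h⟩ := h t
  obtain ⟨U, L, -, hQ, hL, hz⟩ := h m hm j
  exact ⟨L, hL.continuousOn.mono (hK.trans hQ), hz⟩

/-- Some neural reverse model attains the terminal mismatch up to `ε`. -/
theorem exists_neuralModel_outputKL_le (hD : 1 ≤ D) (hr : ∀ t, 0 < r t)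
    (A : ∀ t, CellPartition D (r t)) (hF : F.Valid S) (hS : S.Regular r) (hA : SmoothLogOdds F A)
    {ε : ℝ} (hε : 0 < ε) : ∃ N : NeuralModel F.d,
      S.outputKL (N.predictor S F A) ≤ S.meanComp + ENNReal.ofReal ε := by
  have hT : (0 : ℝ) < T + 1 := by positivity
  choose m hm N hN using fun t => hF.exists_net_logLoss_le_ofReal hD hr hS t (A t)
    (fun m hm j => hA.exists_continuousOn t hm j) (div_pos hε hT)
  refine ⟨⟨m, hm, N⟩, (hF.outputKL_predictor_le A _).trans ?_⟩
  gcongr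
  calc ∑ t, F.logLoss S t (fun z => (A t).mixDens ((N t).eval z))
      ≤ ∑ _t : Fin T, ENNReal.ofReal (ε / (T + 1)) := Finset.sum_le_sum fun t _ => hN t
    _ = ENNReal.ofReal (T * (ε / (T + 1))) := by
        rw [Finset.sum_const, Finset.card_univ, Fintype.card_fin, nsmul_eq_mul,
          ENNReal.ofReal_mul (Nat.cast_nonneg _), ENNReal.ofReal_natCast]
    _ ≤ ENNReal.ofReal ε := by
        refine ENNReal.ofReal_le_ofReal ?_
        rw [← mul_div_assoc, div_le_iff₀ hT]
        nlinarith

/-- Replacing the exact logits by networks costs at most `1 / (2n)` in total. -/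
theorem exists_neuralModel_outputKL_le_of_logLoss_le (hT : 1 ≤ T)
    (A : ∀ t, CellPartition D (r t)) (hF : F.Valid S) (hS : S.Regular r) (hA : SmoothLogOdds F A)
    {n : ℕ} (hn : 1 ≤ n) {b : Fin T → ℝ} (hb0 : ∀ t, 0 ≤ b t)
    (hb : ∀ t, F.logLoss S t (exactDens F A t n) ≤ ENNReal.ofReal (b t)) :
    ∃ N : NeuralModel F.d, (∀ t, N.m t = n) ∧ S.outputKL (N.predictor S F A) ≤
      S.meanComp + ENNReal.ofReal (∑ t, b t + 1 / (2 * (n : ℝ))) := by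
  have hn0 : (0 : ℝ) < n := by exact_mod_cast hn
  have hT0 : (0 : ℝ) < T := by exact_mod_cast hT
  have hε : (0 : ℝ) < 1 / (2 * (n : ℝ)) / T := by positivity
  have hex : ∀ t, ∃ N : ReLUNet (F.d t) n, F.logLoss S t (fun z => (A t).mixDens (N.eval z)) ≤
      F.logLoss S t (exactDens F A t n) + ENNReal.ofReal (1 / (2 * (n : ℝ)) / T) := by
    intro t
    choose L hLc hL using fun j => hA.exists_continuousOn t hn j
    refine hF.exists_net_logLoss_le hS (A t) (v := fun z j => L j z) hLc ?_ hε
    filter_upwards [hF.ae_density hS t] with z hz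
    funext j
    exact (hL j z hz.1).symm
  choose N hN using hex
  refine ⟨⟨fun _ => n, fun _ => hn, N⟩, fun _ => rfl, (hF.outputKL_predictor_le A _).trans ?_⟩
  gcongr
  calc ∑ t, F.logLoss S t (fun z => (A t).mixDens ((N t).eval z))
      ≤ ∑ t, ENNReal.ofReal (b t + 1 / (2 * (n : ℝ)) / T) := by
        refine Finset.sum_le_sum fun t _ => (hN t).trans ?_
        rw [ENNReal.ofReal_add (hb0 t) hε.le]
        gcongr
        exact hb t
    _ = ENNReal.ofReal (∑ t, (b t + 1 / (2 * (n : ℝ)) / T)) :=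
        (ENNReal.ofReal_sum_of_nonneg fun t _ => add_nonneg (hb0 t) hε.le).symm
    _ = _ := by
        rw [Finset.sum_add_distrib, Finset.sum_const, Finset.card_univ, Fintype.card_fin,
          nsmul_eq_mul, mul_div_cancel₀ _ hT0.ne']

theorem stepKL_exactDens_le (hF : F.Valid S) (hS : S.Regular r) (A : ∀ t, CellPartition D (r t))
    (t : Fin T) (m : ℕ) : F.stepKL S t (exactDens F A t m) ≤ F.logLoss S t (exactDens F A t m) := by
  refine hF.stepKL_le_logLoss hS t ((A t).measurable_mixDens ?_)
    (fun z y => (A t).mixDens_pos _ _) fun z => (A t).isProbabilityMeasure_mixDens _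
  refine measurable_pi_iff.2 fun j => Real.measurable_log.comp ?_
  exact (hF.measurable_setIntegral t _).div (hF.measurable_setIntegral t _)

end Neural

end RevDiff

theorem proposition4p1 (D T : ℕ) (hD : 1 ≤ D) (hT : 1 ≤ T) (r : Fin T → ℝ) (hr : ∀ t, 0 < r t) :
    -- general case
    (∀ (C : Type*) [MeasurableSpace C] [StandardBorelSpace C] (S : Diffusion C D T)
        (F : Features C D T) (A : ∀ t, CellPartition D (r t)),
      F.Valid S → S.Regular r → SmoothLogOdds F A →
      (∀ ε : ℝ, 0 < ε → ∃ N : NeuralModel F.d,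
        S.outputKL (N.predictor S F A) ≤ S.meanComp + ENNReal.ofReal ε) ∧
      (⨅ π ∈ neuralFamily S F A, S.outputKL π) ≤ S.meanComp) ∧
    -- explicit rate under the `C¹` branch
    (∀ θ ξ : Fin T → ℝ, (∀ t, 2 < θ t) → (∀ t, 0 < ξ t) →
      ∃ A : ∀ t, CellPartition D (r t),
        ∀ (C : Type*) [MeasurableSpace C] [StandardBorelSpace C] (S : Diffusion C D T)
          (F : Features C D T),
        F.Valid S → S.Regular r → SmoothLogOdds F A → (∀ t, 1 ≤ F.s t) →
        (∀ t, F.C1Branch S t (r t) (θ t)) →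
        ∃ cst : Fin T → ℝ, (∀ t, 0 ≤ cst t) ∧
          (∀ t, ∀ᶠ m : ℕ in atTop, F.stepKL S t (exactDens F A t m) ≤
            ENNReal.ofReal (cst t * (m : ℝ) ^ (-rateExp D (θ t) (ξ t)))) ∧
          ∃ (n₀ : ℕ) (N : ℕ → NeuralModel F.d), 1 ≤ n₀ ∧
            (∀ n, n₀ ≤ n → (∀ t, (N n).m t = n) ∧
              S.outputKL ((N n).predictor S F A) ≤ S.meanComp +
                ENNReal.ofReal (∑ t, cst t * (n : ℝ) ^ (-rateExp D (θ t) (ξ t))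
                  + 1 / (2 * (n : ℝ)))) ∧
            limsup (fun n => S.outputKL ((N n).predictor S F A)) atTop ≤ S.meanComp) := by
  refine ⟨fun C _ _ S F A hF hS hA => ?_, fun θ ξ hθ hξ =>
    ⟨fun t => ratePartition hD (hr t) (hθ t) (hξ t), fun C _ _ S F hF hS hA _ hC => ?_⟩⟩
  · have h1 := fun (ε : ℝ) (hε : 0 < ε) => exists_neuralModel_outputKL_le hD hr A hF hS hA hε
    refine ⟨h1, ENNReal.le_of_forall_pos_le_add fun ε hε _ => ?_⟩
    obtain ⟨N, hN⟩ := h1 ε hε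
    rw [ENNReal.ofReal_coe_nnreal] at hN
    exact (iInf₂_le _ ⟨N, rfl⟩).trans hN
  set A : ∀ t, CellPartition D (r t) := fun t => ratePartition hD (hr t) (hθ t) (hξ t)
  choose cst hcst hrate using fun t =>
    hF.exists_logLoss_exactDens_le hD hr hS t (hθ t) (hξ t) (hC t)
  refine ⟨cst, hcst, fun t => ?_, ?_⟩
  · filter_upwards [hrate t] with m hm using (stepKL_exactDens_le hF hS A t m).trans hm
  have hmodel : ∀ᶠ n : ℕ in atTop, ∃ N : NeuralModel F.d, (∀ t, N.m t = n) ∧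
      S.outputKL (N.predictor S F A) ≤ S.meanComp +
        ENNReal.ofReal (∑ t, cst t * (n : ℝ) ^ (-rateExp D (θ t) (ξ t)) + 1 / (2 * (n : ℝ))) := by
    filter_upwards [eventually_all.2 hrate, eventually_ge_atTop 1] with n hn hn1
    exact exists_neuralModel_outputKL_le_of_logLoss_le hT A hF hS hA hn1
      (fun t => mul_nonneg (hcst t) (Real.rpow_nonneg (Nat.cast_nonneg n) _)) hn
  obtain ⟨n₀, hn₀⟩ := eventually_atTop.1 hmodel
  have : Nonempty (NeuralModel F.d) := (hn₀ n₀ le_rfl).nonempty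
  choose! N hN using hn₀
  refine ⟨max n₀ 1, N, le_max_right _ _, fun n hn => hN n ((le_max_left _ _).trans hn), ?_⟩
  have hlim : Tendsto (fun n : ℕ => S.meanComp + ENNReal.ofReal
      (∑ t, cst t * (n : ℝ) ^ (-rateExp D (θ t) (ξ t)) + 1 / (2 * (n : ℝ)))) atTop
      (𝓝 S.meanComp) := by
    have h1 : Tendsto (fun n : ℕ => ∑ t, cst t * (n : ℝ) ^ (-rateExp D (θ t) (ξ t)) +
        1 / (2 * (n : ℝ))) atTop (𝓝 (∑ t, cst t * 0 + 0)) := by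
      refine (tendsto_finsetSum _ fun t _ => ((tendsto_rpow_neg_atTop
        (rateExp_pos hD (hθ t) (hξ t))).comp tendsto_natCast_atTop_atTop).const_mul _).add ?_
      exact tendsto_const_nhds.div_atTop
        (tendsto_natCast_atTop_atTop.const_mul_atTop two_pos)
    have h2 := (ENNReal.tendsto_ofReal h1).const_add S.meanComp
    simpa using h2
  refine (limsup_le_limsup ?_).trans hlim.limsup_eq.le
  filter_upwards [eventually_ge_atTop n₀] with n hn using (hN n hn).2
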